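/- For $k\in\mathbb N$ let $\mathbb Q_k$ be the set of rationals $p/q$ with $\max\{|p|,|q|\}\le 2^k$. A distribution $\mathcal D$ over $\{0,1\}^d$ is $\lambda$-precise if all its point probabilities lie in $\mathbb Q_\lambda$. For $f,h:\{0,1\}^d\to\mathcal Y$ let $\mathcal L_{\mathcal D}(h,f)=\Pr_{x\sim\mathcal D}[h(x)\ne f(x)]$ be the zero-one loss. In a protocol $[\mathcal P_0,\mathcal P_1,\mathcal V]$ a randomized verifier $\mathcal V$ exchanges messages with two provers. All parties get $d,\varepsilon,\beta$. The verifier can query $f$, the hypotheses $h_0,h_1$ and the probability mass function of $\mathcal D$; the provers have access to $h_0,h_1$ and the probability mass function, but not to $f$, and are computationally unbounded. The verifier is a random access machine with logarithmic cost (each instruction is charged the bit lengths of the numbers and addresses it handles); the real inputs $\varepsilon,\beta$ are read by comparing them with rationals, and elements of $\mathcal Y$ are atomic labels that can be stored and tested for equality at unit cost apart from addresses. Communication complexity is the total number of bits exchanged. **Theorem.** There are an absolute constant $C$ and a polynomial $\mathrm{poly}$ with natural coefficients such that the following holds. Fix a set $\mathcal Y$ and an integer $\lambda\ge 1$. There is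 a protocol $[\mathcal P_0,\mathcal P_1,\mathcal V]$ such that for all inputs $d\in\mathbb N$ and all real $\varepsilon,\beta>0$: 1. For every $\lambda$-precise distribution $\mathcal D$ over $\{0,1\}^d$, all functions $f,h_0,h_1:\{0,1\}^d\to\mathcal Y$, every $b\in\{0,1\}$ and every strategy $\mathcal P^*_{1-b}$ of the other prover, the bit $v$ output by the verifier when interacting with the honest $\mathcal P_b$ and with $\mathcal P^*_{1-b}$ satisfies $$\Pr\Bigl[\mathcal L_{\mathcal D}(h_v,f)\le(1+\varepsilon)\min_{s\in\{0,1\}}\mathcal L_{\mathcal D}(h_s,f)\Bigr]\ge 1-\beta .$$ 2. In every such execution, for all outcomes of the coins, the verifier halts, and both its running time and the communication are at most $$\lambda\Bigl(1+\frac1\varepsilon\Bigr)^2\cdot\max\Bigl\{1,\log\Bigl(1+\frac1\varepsilon\Bigr)\Bigr\}\cdot\max\Bigl\{1,\log\frac1\beta\Bigr\}\cdot\mathrm{poly}(d),$$ and the verifier makes at most $C\,\bigl(1+\frac1{\varepsilon^2}\bigr)\max\{0,\log\frac1\beta\}$ queries to $f$. -/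

import Mathlib

open MeasureTheory

namespace RefereedLearning

/-! ### Distributions and losses -/

/-- The Boolean cube `{0,1}^d`. -/
abbrev Cube (d : ℕ) : Type := Fin d → Bool

/-- The point of the cube whose coordinates are the `d` low-order bits of `n`. -/
def Cube.ofNat (d n : ℕ) : Cube d := fun i => n.testBit i

/-- `Q_k`: the rationals `p / q` with `|p|, |q| ≤ 2 ^ k`. -/
def rationalsOfPrecision (k : ℕ) : Set ℚ :=
  {r | ∃ p q : ℤ, q ≠ 0 ∧ |p| ≤ 2 ^ k ∧ |q| ≤ 2 ^ k ∧ r = (p : ℚ) / (q : ℚ)}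

/-- The family of `k`-precise distributions over `{0,1}^d`: every value of the probability mass
function lies in `Q_k`. -/
def preciseDistributions (d k : ℕ) : Set (PMF (Cube d)) :=
  {D | ∀ x, ∃ r ∈ rationalsOfPrecision k, (D x).toReal = (r : ℝ)}

open Classical in
/-- The zero-one metric. -/
noncomputable def zeroOne {Y : Type*} (y y' : Y) : ℝ := if y = y' then 0 else 1

/-- The expected loss `E_{x ∼ D} [ℓ (f x) (h x)]`. -/
noncomputable def loss {Y : Type*} {d : ℕ} (l : Y → Y → ℝ) (D : PMF (Cube d))
    (f h : Cube d → Y) : ℝ :=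
  ∑ x, (D x).toReal * l (f x) (h x)

/-! ### The verifier: a random access machine with logarithmic cost

Memory cells hold natural numbers of arbitrary size, and every instruction is charged the binary
lengths of all the addresses and numbers that it handles (the logarithmic cost criterion).
Elements of the range `Y` have no prescribed encoding: they are atomic labels, kept in a separate
bank of label cells, and can only be obtained from an oracle and tested for equality. -/

/-- Binary length of a natural number (`1` for `0`). -/
def len (n : ℕ) : ℕ := max 1 n.size

/-- Operands: a constant `n`, the contents `M[n]` of a cell, or the contents `M[M[n]]` of the cell
to which another one points. Where an instruction expects the address of a cell, the value of the
operand is that address. -/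
inductive Operand where
  | const (n : ℕ)
  | cell (n : ℕ)
  | ind (n : ℕ)

/-- The value of an operand. -/
def Operand.val (M : ℕ → ℕ) : Operand → ℕ
  | .const n => n
  | .cell n => M n
  | .ind n => M (M n)

/-- The logarithmic cost of an operand. -/
def Operand.cost (M : ℕ → ℕ) : Operand → ℕ
  | .const n => len n
  | .cell n => len n + len (M n)
  | .ind n => len n + len (M n) + len (M (M n))

/-- Arithmetic on natural numbers: addition, truncated subtraction, multiplication, and division
with rounding down. -/
inductive ArithOp where
  | add
  | sub
  | mul
  | div

/-- Meaning of an arithmetic operation. -/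
def ArithOp.eval : ArithOp → ℕ → ℕ → ℕ
  | .add, a, b => a + b
  | .sub, a, b => a - b
  | .mul, a, b => a * b
  | .div, a, b => a / b

/-- The two real parameters of the protocol. -/
inductive Param where
  | eps
  | beta

/-- The oracles with values in the range `Y`: the ground truth and the two hypotheses. -/
inductive LabelOracle where
  | truth
  | hyp (s : Bool)

/-- The instructions of the verifier.
* `arith o dst a b` : `M[dst] := o a b`.
* `coin dst n` : `M[dst]` becomes a number made of `n` fresh fair coins.
* `send b a n` : send the `n` low-order bits of `a` to prover `b`.
* `recv b dst n` : receive a message of `n` bits from prover `b` into `M[dst]`.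
* `cut p dst a b` : `M[dst] := 1` if `a ≤ θ * b` for the real parameter `θ` named by `p`, and
  `M[dst] := 0` otherwise (a real input is read by comparing it with rationals).
* `queryPmf num den x` : query the probability mass function at the point encoded by `x`; numerator
  and denominator, in lowest terms, go to `M[num]` and `M[den]`.
* `queryLabel o dst x` : query `o` at the point encoded by `x`; the answer goes to label cell `dst`.
* `eqLabel dst i j` : `M[dst] := 1` if label cells `i` and `j` agree, `M[dst] := 0` otherwise. -/
inductive Instr where
  | arith (o : ArithOp) (dst a b : Operand)
  | coin (dst n : Operand)
  | send (b : Bool) (a n : Operand)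
  | recv (b : Bool) (dst n : Operand)
  | cut (p : Param) (dst a b : Operand)
  | queryPmf (num den x : Operand)
  | queryLabel (o : LabelOracle) (dst x : Operand)
  | eqLabel (dst i j : Operand)

/-- Programs. A test succeeds when the value of its operand is nonzero. -/
inductive Program where
  | instr (i : Instr)
  | seq (p q : Program)
  | ite (a : Operand) (p q : Program)
  | loop (a : Operand) (p : Program)

/-- A message of `bits` bits, with contents `value`, on the channel between the verifier and prover
`prover`; `fromProver` tells its direction. -/
structure Message where
  prover : Bool
  fromProver : Bool
  bits : ℕ
  value : ℕ

/-- The configuration of the verifier: memory, label cells, number of coins tossed so far,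
the messages exchanged so far (most recent first), the running time, and the number of queries made
to the ground truth. -/
structure State (Y : Type*) where
  mem : ℕ → ℕ
  label : ℕ → Option Y
  coins : ℕ
  transcript : List Message
  time : ℕ
  truthQueries : ℕ

/-- Everything an execution of the verifier depends on: the inputs `d`, `ε`, `β`, the coins, the
oracles for the ground truth, the hypotheses and the probability mass function, and the two provers.
A prover determines its next message from a list of messages (most recent first). -/
structure Env (Y : Type*) where
  d : ℕ
  eps : ℝ
  beta : ℝ
  coin : ℕ → Bool
  truth : Cube d → Y
  hyp : Bool → Cube d → Y
  dist : PMF (Cube d)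
  prover : Bool → List Message → ℕ

/-- The real parameter named by `p`. -/
def Env.param {Y : Type*} (E : Env Y) : Param → ℝ
  | .eps => E.eps
  | .beta => E.beta

/-- The function behind an oracle with values in `Y`. -/
def Env.oracle {Y : Type*} (E : Env Y) : LabelOracle → Cube E.d → Y
  | .truth => E.truth
  | .hyp s => E.hyp s

/-- The rational number equal to the probability of `x` (if that probability is rational). -/
noncomputable def Env.pmf {Y : Type*} (E : Env Y) (x : Cube E.d) : ℚ :=
  Function.invFun (fun r : ℚ => (r : ℝ)) (E.dist x).toReal

/-- The number whose binary digits are the coins `k, k + 1, …, k + n - 1`. -/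
def Env.toss {Y : Type*} (E : Env Y) (k n : ℕ) : ℕ :=
  ∑ i ∈ Finset.range n, if E.coin (k + i) then 2 ^ i else 0

/-- The total number of bits in a list of messages. -/
def totalBits (t : List Message) : ℕ := (t.map Message.bits).sum

open Classical in
/-- The effect of one instruction, including its cost. -/
noncomputable def Instr.exec {Y : Type*} (E : Env Y) : Instr → State Y → State Y
  | .arith o dst a b, s =>
      let v := o.eval (a.val s.mem) (b.val s.mem)
      { s with
        mem := Function.update s.mem (dst.val s.mem) v
        time := s.time + 1 + dst.cost s.mem + a.cost s.mem + b.cost s.mem + len v }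
  | .coin dst n, s =>
      let k := n.val s.mem
      { s with
        mem := Function.update s.mem (dst.val s.mem) (E.toss s.coins k)
        coins := s.coins + k
        time := s.time + 1 + dst.cost s.mem + n.cost s.mem + k }
  | .send b a n, s =>
      let k := n.val s.mem
      { s with
        transcript := ⟨b, false, k, a.val s.mem % 2 ^ k⟩ :: s.transcript
        time := s.time + 1 + a.cost s.mem + n.cost s.mem + k }
  | .recv b dst n, s =>
      let k := n.val s.mem
      let v := E.prover b s.transcript % 2 ^ k
      { s with
        mem := Function.update s.mem (dst.val s.mem) v
        transcript := ⟨b, true, k, v⟩ :: s.transcript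
        time := s.time + 1 + dst.cost s.mem + n.cost s.mem + k }
  | .cut p dst a b, s =>
      let v := if (a.val s.mem : ℝ) ≤ E.param p * (b.val s.mem : ℝ) then 1 else 0
      { s with
        mem := Function.update s.mem (dst.val s.mem) v
        time := s.time + 1 + dst.cost s.mem + a.cost s.mem + b.cost s.mem }
  | .queryPmf num den x, s =>
      let r := E.pmf (Cube.ofNat E.d (x.val s.mem))
      { s with
        mem := Function.update (Function.update s.mem (num.val s.mem) r.num.toNat)
          (den.val s.mem) r.den
        time := s.time + 1 + num.cost s.mem + den.cost s.mem + x.cost s.mem + E.d +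
          len r.num.toNat + len r.den }
  | .queryLabel o dst x, s =>
      { s with
        label := Function.update s.label (dst.val s.mem)
          (some (E.oracle o (Cube.ofNat E.d (x.val s.mem))))
        time := s.time + 1 + dst.cost s.mem + x.cost s.mem + E.d
        truthQueries := match o with
          | .truth => s.truthQueries + 1
          | .hyp _ => s.truthQueries }
  | .eqLabel dst i j, s =>
      let v := if s.label (i.val s.mem) = s.label (j.val s.mem) then 1 else 0
      { s with
        mem := Function.update s.mem (dst.val s.mem) v
        time := s.time + 1 + dst.cost s.mem + i.cost s.mem + j.cost s.mem }

/-- The state after charging for a test of the operand `a`. -/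
def State.test {Y : Type*} (s : State Y) (a : Operand) : State Y :=
  { s with time := s.time + 1 + a.cost s.mem }

/-- `Exec E p s t`: in the environment `E`, the program `p` started in the state `s` halts, and it
does so in the state `t`. -/
inductive Exec {Y : Type*} (E : Env Y) : Program → State Y → State Y → Prop where
  | instr (i : Instr) (s : State Y) : Exec E (.instr i) s (i.exec E s)
  | seq {p q : Program} {s t u : State Y} :
      Exec E p s t → Exec E q t u → Exec E (.seq p q) s u
  | iteTrue {a : Operand} {p q : Program} {s t : State Y} :
      a.val s.mem ≠ 0 → Exec E p (s.test a) t → Exec E (.ite a p q) s t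
  | iteFalse {a : Operand} {p q : Program} {s t : State Y} :
      a.val s.mem = 0 → Exec E q (s.test a) t → Exec E (.ite a p q) s t
  | loopTrue {a : Operand} {p : Program} {s t u : State Y} :
      a.val s.mem ≠ 0 → Exec E p (s.test a) t → Exec E (.loop a p) t u → Exec E (.loop a p) s u
  | loopFalse {a : Operand} {p : Program} {s : State Y} :
      a.val s.mem = 0 → Exec E (.loop a p) s (s.test a)

/-- Executions are deterministic, so that "the" final state makes sense. -/
theorem Exec.unique {Y : Type*} {E : Env Y} {p : Program} {s t t' : State Y}
    (h : Exec E p s t) (h' : Exec E p s t') : t = t' := by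
  induction h generalizing t' with
  | instr i s => cases h'; rfl
  | seq _ _ ih₁ ih₂ =>
    cases h' with
    | seq h₁ h₂ => cases ih₁ h₁; exact ih₂ h₂
  | iteTrue ha _ ih =>
    cases h' with
    | iteTrue _ h => exact ih h
    | iteFalse hb _ => exact absurd hb ha
  | iteFalse ha _ ih =>
    cases h' with
    | iteTrue hb _ => exact absurd ha hb
    | iteFalse _ h => exact ih h
  | loopTrue ha _ _ ih₁ ih₂ =>
    cases h' with
    | loopTrue _ h₁ h₂ => cases ih₁ h₁; exact ih₂ h₂
    | loopFalse hb => exact absurd hb ha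
  | loopFalse ha =>
    cases h' with
    | loopTrue hb _ _ => exact absurd ha hb
    | loopFalse _ => rfl

/-- The initial state: cell `0` holds the input `d`, everything else is blank. -/
def State.init (Y : Type*) (d : ℕ) : State Y where
  mem := fun i => if i = 0 then d else 0
  label := fun _ => none
  coins := 0
  transcript := []
  time := 0
  truthQueries := 0

/-- The output bit, read from cell `0`. -/
def State.output {Y : Type*} (s : State Y) : Bool := decide (s.mem 0 ≠ 0)

/-! ### Protocols -/

/-- A protocol `[P₀, P₁, V]` for functions with range `Y`. The verifier is a program, the same for
all inputs `d`, `ε`, `β`. An honest prover is computationally unbounded: knowing `d`, `ε`, `β`, the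
hypotheses and the distribution (but not the ground truth), it determines its next message from the
messages that it has itself exchanged with the verifier. -/
structure Protocol (Y : Type*) where
  verifier : Program
  prover : Bool → (d : ℕ) → (eps beta : ℝ) → (hyp : Bool → Cube d → Y) → (dist : PMF (Cube d)) →
    List Message → ℕ

/-- A malicious prover. It may be any function of all the messages exchanged so far, including those
between the verifier and the other prover. -/
abbrev Adversary : Type := List Message → ℕ

open Classical in
/-- The execution in which prover `b` is honest and the other prover is replaced by `adv`. -/
noncomputable def Protocol.env {Y : Type*} (P : Protocol Y) {d : ℕ} (eps beta : ℝ)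
    (D : PMF (Cube d)) (f : Cube d → Y) (h : Bool → Cube d → Y) (b : Bool) (adv : Adversary)
    (coin : ℕ → Bool) : Env Y where
  d := d
  eps := eps
  beta := beta
  coin := coin
  truth := f
  hyp := h
  dist := D
  prover := fun c t =>
    if c = b then P.prover b d eps beta h D (t.filter (fun m => m.prover = b)) else adv t

/-- The verifier halts in the state `s` when prover `b` is honest, the other prover is `adv`, and
the coins are `coin`. -/
def Protocol.HaltsIn {Y : Type*} (P : Protocol Y) {d : ℕ} (eps beta : ℝ)
    (D : PMF (Cube d)) (f : Cube d → Y) (h : Bool → Cube d → Y) (b : Bool) (adv : Adversary)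
    (coin : ℕ → Bool) (s : State Y) : Prop :=
  Exec (P.env eps beta D f h b adv coin) P.verifier (State.init Y d) s

/-- The law of an infinite sequence of independent fair coins. -/
noncomputable def coinMeasure : Measure (ℕ → Bool) :=
  Measure.infinitePi (fun _ : ℕ => (PMF.uniformOfFintype Bool).toMeasure)

/-- On the inputs `d`, `eps`, `beta`, the protocol is an `(α, δ)`-refereed learning protocol for the
hypotheses in `H` and the distributions in `Ds` with respect to the metric `l`: for every ground
truth, and whichever prover is honest, the hypothesis selected by the verifier has, with
probability at least `1 - δ`, loss at most `α` times the smaller loss. -/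
def Protocol.IsRefereedLearning {Y : Type*} (P : Protocol Y) (d : ℕ) (eps beta : ℝ)
    (H : Set (Cube d → Y)) (Ds : Set (PMF (Cube d))) (l : Y → Y → ℝ) (α δ : ℝ) : Prop :=
  ∀ D ∈ Ds, ∀ (f : Cube d → Y) (h : Bool → Cube d → Y), (∀ s, h s ∈ H) →
    ∀ (b : Bool) (adv : Adversary),
      1 - δ ≤ coinMeasure.real {coin | ∃ s, P.HaltsIn eps beta D f h b adv coin s ∧
        loss l D (h s.output) f ≤ α * min (loss l D (h false) f) (loss l D (h true) f)}

end RefereedLearning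

/-! Let `p` be the probability that the two hypotheses disagree. Points of agreement contribute
nothing to the difference of the losses, and if one loss exceeds `1 + ε` times the other, the
difference is at least `g * p` with `g = ε / (2 * (1 + ε))` (`mul_le_sub_of_lt`). So, conditioned on
disagreement, the true label favours the better hypothesis with bias at least `g`. By Hoeffding's
inequality a majority vote over order `(1 + 1/ε)^2 log (1/β)` conditional samples selects an
acceptable hypothesis except with probability `β` (`coinMeasure_bad_le`). For `β ≥ 1/2` a single
coin flip is good enough.

Disagreement may be too rare for rejection sampling, so the provers help to invert the cumulative
distribution. A point of disagreement has the integer weight `⌊(2^n - 1) D(x)⌋`, any other point has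
weight zero, and `F` denotes the prefix sums. For a random `n`-bit number `r` the verifier looks for
`x` with `F x ≤ r F(2^d) / 2^n < F (x + 1)` by bisection, asking both provers for values of `F`. One
prover is honest, so a value on which they agree is correct. Once they differ, the search follows
the dispute instead, keeping an agreed left end and a disputed right end, down to a single point
whose weight the verifier computes from its own oracles. This exposes the liar, who is ignored from
then on, and the search is repeated (`settle_runs`, `locate_runs`). Hence the selected point is a
function of the coins alone, whatever the adversary does, and samples drawn from disjoint blocks of
coins are independent (`iIndepFun_tossOf`).

Precision enters through rounding: a nonzero `p` is at least `2^(-lam)`, so `n = d + l + lam + 4`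
bits with `2^l ≥ 1 + 1/ε` keep at least half of the bias (`le_sum_selected_prefixWeight`).

A search handles numbers of `O(n)` bits in `O(d + 1)` rounds. A sample counter held in one cell
would cost an additional `log log (1/β)` per sample, which the time bound does not allow. The
counters therefore keep one binary digit per cell, and an increment has constant amortised cost
(`incr_runs`). -/

namespace RefereedLearning

open ProbabilityTheory

/-! ### Reasoning about programs -/

section Programs

variable {Y : Type*} {E : Env Y}

/-- `Runs E p s Q`: started in `s`, the program `p` halts in a state satisfying `Q`. -/
def Runs (E : Env Y) (p : Program) (s : State Y) (Q : State Y → Prop) : Prop :=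
  ∃ t, Exec E p s t ∧ Q t

theorem Runs.mono {p : Program} {s : State Y} {Q R : State Y → Prop} (h : Runs E p s Q)
    (hQR : ∀ t, Q t → R t) : Runs E p s R := by
  obtain ⟨t, ht, hq⟩ := h
  exact ⟨t, ht, hQR t hq⟩

theorem Runs.seq {p q : Program} {s : State Y} {Q R : State Y → Prop} (h : Runs E p s Q)
    (hq : ∀ t, Q t → Runs E q t R) : Runs E (.seq p q) s R := by
  obtain ⟨t, ht, h1⟩ := h
  obtain ⟨u, hu, h2⟩ := hq t h1
  exact ⟨u, .seq ht hu, h2⟩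

theorem Runs.instr {i : Instr} {s : State Y} {Q : State Y → Prop} (h : Q (i.exec E s)) :
    Runs E (.instr i) s Q :=
  ⟨_, .instr i s, h⟩

theorem Runs.ite {a : Operand} {p q : Program} {s : State Y} {Q : State Y → Prop}
    (hp : a.val s.mem ≠ 0 → Runs E p (s.test a) Q)
    (hq : a.val s.mem = 0 → Runs E q (s.test a) Q) : Runs E (.ite a p q) s Q := by
  by_cases h : a.val s.mem = 0
  · obtain ⟨t, ht, h1⟩ := hq h
    exact ⟨t, .iteFalse h ht, h1⟩
  · obtain ⟨t, ht, h1⟩ := hp h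
    exact ⟨t, .iteTrue h ht, h1⟩

theorem Runs.loop_false {a : Operand} {p : Program} {s : State Y} {Q : State Y → Prop}
    (h : a.val s.mem = 0) (hq : Q (s.test a)) : Runs E (.loop a p) s Q :=
  ⟨_, .loopFalse h, hq⟩

theorem Runs.loop_true {a : Operand} {p : Program} {s : State Y} {Q R : State Y → Prop}
    (h : a.val s.mem ≠ 0) (hp : Runs E p (s.test a) R)
    (hl : ∀ t, R t → Runs E (.loop a p) t Q) : Runs E (.loop a p) s Q := by
  obtain ⟨t, ht, h1⟩ := hp
  obtain ⟨u, hu, h2⟩ := hl t h1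
  exact ⟨u, .loopTrue h ht hu, h2⟩

/-- A program that only takes time. -/
def Program.skip : Program := .loop (.const 0) (.instr (.arith .add (.const 0) (.const 0) (.const 0)))

/-- Straight-line code. -/
def Program.block : List Instr → Program
  | [] => .skip
  | i :: l => .seq (.instr i) (Program.block l)

/-- The effect of straight-line code. -/
noncomputable def run (E : Env Y) : List Instr → State Y → State Y
  | [], s => s.test (.const 0)
  | i :: l, s => run E l (i.exec E s)

theorem Exec.skip (s : State Y) : Exec E .skip s (s.test (.const 0)) := .loopFalse rfl

theorem Exec.block (l : List Instr) (s : State Y) : Exec E (.block l) s (run E l s) := by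
  induction l generalizing s with
  | nil => exact Exec.skip s
  | cons i l ih => exact .seq (.instr i s) (ih _)

theorem Runs.block {l : List Instr} {s : State Y} {Q : State Y → Prop} (h : Q (run E l s)) :
    Runs E (.block l) s Q :=
  ⟨_, Exec.block l s, h⟩

theorem Runs.skip {s : State Y} {Q : State Y → Prop} (h : Q (s.test (.const 0))) :
    Runs E .skip s Q :=
  ⟨_, Exec.skip s, h⟩

/-! ### Projections of the state after an instruction -/

@[simp] theorem run_nil (s : State Y) : run E [] s = s.test (.const 0) := rfl
@[simp] theorem run_cons (i : Instr) (l : List Instr) (s : State Y) :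
    run E (i :: l) s = run E l (i.exec E s) := rfl

@[simp] theorem test_mem (s : State Y) (a : Operand) : (s.test a).mem = s.mem := rfl
@[simp] theorem test_label (s : State Y) (a : Operand) : (s.test a).label = s.label := rfl
@[simp] theorem test_coins (s : State Y) (a : Operand) : (s.test a).coins = s.coins := rfl
@[simp] theorem test_transcript (s : State Y) (a : Operand) :
    (s.test a).transcript = s.transcript := rfl
@[simp] theorem test_truthQueries (s : State Y) (a : Operand) :
    (s.test a).truthQueries = s.truthQueries := rfl
theorem test_time (s : State Y) (a : Operand) : (s.test a).time = s.time + 1 + a.cost s.mem := rfl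

variable (s : State Y) (o : ArithOp) (p : Param) (q : LabelOracle) (c : Bool) (x y z : Operand)

@[simp] theorem exec_arith_mem : (Instr.exec E (.arith o x y z) s).mem =
    Function.update s.mem (x.val s.mem) (o.eval (y.val s.mem) (z.val s.mem)) := rfl
@[simp] theorem exec_coin_mem : (Instr.exec E (.coin x y) s).mem =
    Function.update s.mem (x.val s.mem) (E.toss s.coins (y.val s.mem)) := rfl
@[simp] theorem exec_send_mem : (Instr.exec E (.send c x y) s).mem = s.mem := rfl
@[simp] theorem exec_recv_mem : (Instr.exec E (.recv c x y) s).mem =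
    Function.update s.mem (x.val s.mem) (E.prover c s.transcript % 2 ^ (y.val s.mem)) := rfl
open Classical in
@[simp] theorem exec_cut_mem : (Instr.exec E (.cut p x y z) s).mem =
    Function.update s.mem (x.val s.mem)
      (if (y.val s.mem : ℝ) ≤ E.param p * (z.val s.mem : ℝ) then 1 else 0) := rfl
@[simp] theorem exec_queryPmf_mem : (Instr.exec E (.queryPmf x y z) s).mem =
    Function.update (Function.update s.mem (x.val s.mem)
      (E.pmf (Cube.ofNat E.d (z.val s.mem))).num.toNat) (y.val s.mem)
      (E.pmf (Cube.ofNat E.d (z.val s.mem))).den := rfl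
@[simp] theorem exec_queryLabel_mem : (Instr.exec E (.queryLabel q x y) s).mem = s.mem := rfl
open Classical in
@[simp] theorem exec_eqLabel_mem : (Instr.exec E (.eqLabel x y z) s).mem =
    Function.update s.mem (x.val s.mem)
      (if s.label (y.val s.mem) = s.label (z.val s.mem) then 1 else 0) := rfl

@[simp] theorem exec_arith_label : (Instr.exec E (.arith o x y z) s).label = s.label := rfl
@[simp] theorem exec_coin_label : (Instr.exec E (.coin x y) s).label = s.label := rfl
@[simp] theorem exec_send_label : (Instr.exec E (.send c x y) s).label = s.label := rfl
@[simp] theorem exec_recv_label : (Instr.exec E (.recv c x y) s).label = s.label := rfl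
@[simp] theorem exec_cut_label : (Instr.exec E (.cut p x y z) s).label = s.label := rfl
@[simp] theorem exec_queryPmf_label : (Instr.exec E (.queryPmf x y z) s).label = s.label := rfl
@[simp] theorem exec_queryLabel_label : (Instr.exec E (.queryLabel q x y) s).label =
    Function.update s.label (x.val s.mem)
      (some (E.oracle q (Cube.ofNat E.d (y.val s.mem)))) := rfl
@[simp] theorem exec_eqLabel_label : (Instr.exec E (.eqLabel x y z) s).label = s.label := rfl

@[simp] theorem exec_arith_coins : (Instr.exec E (.arith o x y z) s).coins = s.coins := rfl
@[simp] theorem exec_coin_coins : (Instr.exec E (.coin x y) s).coins =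
    s.coins + y.val s.mem := rfl
@[simp] theorem exec_send_coins : (Instr.exec E (.send c x y) s).coins = s.coins := rfl
@[simp] theorem exec_recv_coins : (Instr.exec E (.recv c x y) s).coins = s.coins := rfl
@[simp] theorem exec_cut_coins : (Instr.exec E (.cut p x y z) s).coins = s.coins := rfl
@[simp] theorem exec_queryPmf_coins : (Instr.exec E (.queryPmf x y z) s).coins = s.coins := rfl
@[simp] theorem exec_queryLabel_coins : (Instr.exec E (.queryLabel q x y) s).coins = s.coins := rfl
@[simp] theorem exec_eqLabel_coins : (Instr.exec E (.eqLabel x y z) s).coins = s.coins := rfl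

@[simp] theorem exec_arith_truthQueries :
    (Instr.exec E (.arith o x y z) s).truthQueries = s.truthQueries := rfl
@[simp] theorem exec_coin_truthQueries :
    (Instr.exec E (.coin x y) s).truthQueries = s.truthQueries := rfl
@[simp] theorem exec_send_truthQueries :
    (Instr.exec E (.send c x y) s).truthQueries = s.truthQueries := rfl
@[simp] theorem exec_recv_truthQueries :
    (Instr.exec E (.recv c x y) s).truthQueries = s.truthQueries := rfl
@[simp] theorem exec_cut_truthQueries :
    (Instr.exec E (.cut p x y z) s).truthQueries = s.truthQueries := rfl
@[simp] theorem exec_queryPmf_truthQueries :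
    (Instr.exec E (.queryPmf x y z) s).truthQueries = s.truthQueries := rfl
@[simp] theorem exec_queryTruth_truthQueries :
    (Instr.exec E (.queryLabel .truth x y) s).truthQueries = s.truthQueries + 1 := rfl
@[simp] theorem exec_queryHyp_truthQueries :
    (Instr.exec E (.queryLabel (.hyp c) x y) s).truthQueries = s.truthQueries := rfl
@[simp] theorem exec_eqLabel_truthQueries :
    (Instr.exec E (.eqLabel x y z) s).truthQueries = s.truthQueries := rfl

@[simp] theorem exec_send_transcript : (Instr.exec E (.send c x y) s).transcript =
    ⟨c, false, y.val s.mem, x.val s.mem % 2 ^ (y.val s.mem)⟩ :: s.transcript := rfl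

@[simp] theorem val_const (n : ℕ) (M : ℕ → ℕ) : (Operand.const n).val M = n := rfl
@[simp] theorem val_cell (n : ℕ) (M : ℕ → ℕ) : (Operand.cell n).val M = M n := rfl
@[simp] theorem val_ind (n : ℕ) (M : ℕ → ℕ) : (Operand.ind n).val M = M (M n) := rfl
@[simp] theorem eval_add (m n : ℕ) : ArithOp.add.eval m n = m + n := rfl
@[simp] theorem eval_sub (m n : ℕ) : ArithOp.sub.eval m n = m - n := rfl
@[simp] theorem eval_mul (m n : ℕ) : ArithOp.mul.eval m n = m * n := rfl
@[simp] theorem eval_div (m n : ℕ) : ArithOp.div.eval m n = m / n := rfl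

end Programs

/-! ### Costs -/

section Costs

variable {Y : Type*} {E : Env Y}

theorem len_le {x B : ℕ} (hB : 1 ≤ B) (h : x < 2 ^ B) : len x ≤ B :=
  max_le hB (Nat.size_le.2 h)

theorem len_le_succ (x : ℕ) : len x ≤ x + 1 :=
  len_le (by omega) (x.lt_two_pow_self.trans (Nat.pow_lt_pow_right (by omega) (by omega)))

theorem toss_lt (E : Env Y) (k n : ℕ) : E.toss k n < 2 ^ n := by
  unfold Env.toss
  induction n with
  | zero => simp
  | succ n ih =>
    rw [Finset.sum_range_succ, pow_succ]
    split_ifs <;> omega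

/-- The cells below `R` hold numbers of at most `B` bits. -/
def Bounded (R B : ℕ) (s : State Y) : Prop := ∀ a < R, s.mem a < 2 ^ B

/-- The operand refers only to cells below `R` and to numbers of at most `B` bits. -/
def Operand.Within (R B : ℕ) (M : ℕ → ℕ) : Operand → Prop
  | .const n => n < 2 ^ B
  | .cell n => n < R
  | .ind n => n < R ∧ M n < R

/-- The instruction reads and writes only cells below `R`, and handles only numbers of at most
`B` bits. -/
def Instr.Within (E : Env Y) (R B : ℕ) (s : State Y) : Instr → Prop
  | .arith o dst a b => dst.Within R B s.mem ∧ dst.val s.mem < R ∧ a.Within R B s.mem ∧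
      b.Within R B s.mem ∧ o.eval (a.val s.mem) (b.val s.mem) < 2 ^ B
  | .coin dst n => dst.Within R B s.mem ∧ dst.val s.mem < R ∧ n.Within R B s.mem ∧ n.val s.mem ≤ B
  | .send _ a n => a.Within R B s.mem ∧ n.Within R B s.mem ∧ n.val s.mem ≤ B
  | .recv _ dst n => dst.Within R B s.mem ∧ dst.val s.mem < R ∧ n.Within R B s.mem ∧
      n.val s.mem ≤ B
  | .cut _ dst a b => dst.Within R B s.mem ∧ dst.val s.mem < R ∧ a.Within R B s.mem ∧
      b.Within R B s.mem
  | .queryPmf num den x => num.Within R B s.mem ∧ num.val s.mem < R ∧ den.Within R B s.mem ∧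
      den.val s.mem < R ∧ x.Within R B s.mem ∧ E.d ≤ B ∧
      (E.pmf (Cube.ofNat E.d (x.val s.mem))).num.toNat < 2 ^ B ∧
      (E.pmf (Cube.ofNat E.d (x.val s.mem))).den < 2 ^ B
  | .queryLabel _ dst x => dst.Within R B s.mem ∧ x.Within R B s.mem ∧ E.d ≤ B
  | .eqLabel dst i j => dst.Within R B s.mem ∧ dst.val s.mem < R ∧ i.Within R B s.mem ∧
      j.Within R B s.mem

/-- Every instruction of a straight-line program satisfies `Instr.Within` when it is executed. -/
def BlockWithin (E : Env Y) (R B : ℕ) : List Instr → State Y → Prop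
  | [], _ => True
  | i :: l, s => i.Within E R B s ∧ BlockWithin E R B l (i.exec E s)

theorem Operand.Within.cost_le {R B : ℕ} {s : State Y} {a : Operand} (h : a.Within R B s.mem)
    (hs : Bounded R B s) (hB : 1 ≤ B) (hR : R ≤ 2 ^ B) : a.cost s.mem ≤ 3 * B := by
  cases a with
  | const n => have := len_le hB h; simp only [Operand.cost]; omega
  | cell n =>
    have h1 := len_le hB (lt_of_lt_of_le h hR)
    have h2 := len_le hB (hs n h)
    simp only [Operand.cost]; omega
  | ind n =>
    have h1 := len_le hB (lt_of_lt_of_le h.1 hR)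
    have h2 := len_le hB (hs n h.1)
    have h3 := len_le hB (hs _ h.2)
    simp only [Operand.cost]; omega

theorem Bounded.update {R B : ℕ} {M : ℕ → ℕ} (h : ∀ a < R, M a < 2 ^ B) {k v : ℕ}
    (hv : v < 2 ^ B) : ∀ a < R, Function.update M k v a < 2 ^ B := by
  intro a ha
  rw [Function.update_apply]
  split_ifs
  · exact hv
  · exact h a ha

/-- An operand costs at most `3 * B`, since an indirect one involves three numbers of at most `B`
bits. The dearest instruction is `queryPmf`: three operands, the dimension and two outputs, that is
at most `1 + 12 * B`. -/
theorem Instr.Within.exec {R B : ℕ} {s : State Y} {i : Instr} (h : i.Within E R B s)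
    (hs : Bounded R B s) (hB : 1 ≤ B) (hR : R ≤ 2 ^ B) :
    Bounded R B (i.exec E s) ∧ (∀ a, R ≤ a → (i.exec E s).mem a = s.mem a) ∧
      (i.exec E s).time ≤ s.time + 13 * B := by
  have h1B : 1 < 2 ^ B := Nat.one_lt_two_pow (by omega)
  have frame : ∀ (M : ℕ → ℕ) (k v : ℕ), k < R → ∀ a, R ≤ a → Function.update M k v a = M a :=
    fun M k v hk a ha => Function.update_of_ne (by omega) _ _
  cases i with
  | arith o dst a b =>
    obtain ⟨h1, h2, h3, h4, h5⟩ := h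
    have c1 := h1.cost_le hs hB hR
    have c2 := h3.cost_le hs hB hR
    have c3 := h4.cost_le hs hB hR
    have c4 := len_le hB h5
    refine ⟨Bounded.update hs h5, frame _ _ _ h2, ?_⟩
    simp only [Instr.exec]; omega
  | coin dst n =>
    obtain ⟨h1, h2, h3, h4⟩ := h
    have c1 := h1.cost_le hs hB hR
    have c2 := h3.cost_le hs hB hR
    refine ⟨Bounded.update hs ((toss_lt E _ _).trans_le (Nat.pow_le_pow_right (by omega) h4)),
      frame _ _ _ h2, ?_⟩
    simp only [Instr.exec]; omega
  | send c a n =>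
    obtain ⟨h1, h2, h3⟩ := h
    have c1 := h1.cost_le hs hB hR
    have c2 := h2.cost_le hs hB hR
    refine ⟨hs, fun _ _ => rfl, ?_⟩
    simp only [Instr.exec]; omega
  | recv c dst n =>
    obtain ⟨h1, h2, h3, h4⟩ := h
    have c1 := h1.cost_le hs hB hR
    have c2 := h3.cost_le hs hB hR
    refine ⟨Bounded.update hs ((Nat.mod_lt _ (by positivity)).trans_le
      (Nat.pow_le_pow_right (by omega) h4)), frame _ _ _ h2, ?_⟩
    simp only [Instr.exec]; omega
  | cut p dst a b =>
    obtain ⟨h1, h2, h3, h4⟩ := h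
    have c1 := h1.cost_le hs hB hR
    have c2 := h3.cost_le hs hB hR
    have c3 := h4.cost_le hs hB hR
    refine ⟨Bounded.update hs ?_, frame _ _ _ h2, ?_⟩
    · split_ifs <;> omega
    · simp only [Instr.exec]; omega
  | queryPmf num den x =>
    obtain ⟨h1, h2, h3, h4, h5, h6, h7, h8⟩ := h
    have c1 := h1.cost_le hs hB hR
    have c2 := h3.cost_le hs hB hR
    have c3 := h5.cost_le hs hB hR
    have c4 := len_le hB h7
    have c5 := len_le hB h8
    refine ⟨Bounded.update (Bounded.update hs h7) h8, fun a ha => ?_, ?_⟩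
    · exact (frame _ _ _ h4 a ha).trans (frame _ _ _ h2 a ha)
    · simp only [Instr.exec]; omega
  | queryLabel o dst x =>
    obtain ⟨h1, h2, h3⟩ := h
    have c1 := h1.cost_le hs hB hR
    have c2 := h2.cost_le hs hB hR
    refine ⟨hs, fun _ _ => rfl, ?_⟩
    simp only [Instr.exec]; omega
  | eqLabel dst i j =>
    obtain ⟨h1, h2, h3, h4⟩ := h
    have c1 := h1.cost_le hs hB hR
    have c2 := h3.cost_le hs hB hR
    have c3 := h4.cost_le hs hB hR
    refine ⟨Bounded.update hs ?_, frame _ _ _ h2, ?_⟩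
    · split_ifs <;> omega
    · simp only [Instr.exec]; omega

theorem Bounded.test {R B : ℕ} {s : State Y} (hs : Bounded R B s) (a : Operand) :
    Bounded R B (s.test a) := hs

theorem test_time_le {R B : ℕ} {s : State Y} {a : Operand} (hs : Bounded R B s)
    (h : a.Within R B s.mem) (hB : 1 ≤ B) (hR : R ≤ 2 ^ B) :
    (s.test a).time ≤ s.time + 4 * B := by
  have := h.cost_le hs hB hR
  rw [test_time]; omega

theorem BlockWithin.run {R B : ℕ} {l : List Instr} {s : State Y} (h : BlockWithin E R B l s)
    (hs : Bounded R B s) (hB : 1 ≤ B) (hR : R ≤ 2 ^ B) :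
    Bounded R B (run E l s) ∧ (∀ a, R ≤ a → (run E l s).mem a = s.mem a) ∧
      (run E l s).time ≤ s.time + 13 * B * (l.length + 1) := by
  induction l generalizing s with
  | nil =>
    refine ⟨hs, fun _ _ => rfl, ?_⟩
    simp only [run_nil, test_time, Operand.cost, len, Nat.size_zero]
    simp; omega
  | cons i l ih =>
    obtain ⟨h1, h2, h3⟩ := h.1.exec hs hB hR
    obtain ⟨k1, k2, k3⟩ := ih h.2 h1
    refine ⟨k1, fun a ha => (k2 a ha).trans (h2 a ha), k3.trans ?_⟩
    rw [List.length_cons]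
    linarith

/-- The number of bits exchanged is bounded by the running time. -/
theorem Exec.totalBits_le {p : Program} {s t : State Y} (h : Exec E p s t) :
    totalBits t.transcript + s.time ≤ totalBits s.transcript + t.time := by
  induction h with
  | instr i s =>
    cases i <;> simp only [Instr.exec, totalBits, List.map_cons, List.sum_cons] <;> omega
  | seq _ _ ih₁ ih₂ => omega
  | iteTrue _ _ ih => simp only [test_time, test_transcript] at ih; omega
  | iteFalse _ _ ih => simp only [test_time, test_transcript] at ih; omega
  | loopTrue _ _ _ ih₁ ih₂ => simp only [test_time, test_transcript] at ih₁; omega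
  | loopFalse _ => simp only [test_time, test_transcript]; omega

end Costs

/-! ### Binary counters with one digit per cell -/

section Counters

variable {Y : Type*} {E : Env Y}

/-- Increment the binary counter whose digits are the cells `48 + off`, `51 + off`, ... -/
def incr (off : ℕ) : Program :=
  .seq (.instr (.arith .add (.const 40) (.const (48 + off)) (.const 0)))
    (.seq
      (.loop (.ind 40) (.block [.arith .add (.cell 40) (.const 0) (.const 0),
        .arith .add (.const 40) (.cell 40) (.const 3)]))
      (.instr (.arith .add (.cell 40) (.const 1) (.const 0))))

/-- The potential of a counter with value `c` whose lowest digit has index `k`. -/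
def potential (k : ℕ) (c : ℕ) : ℕ :=
  if h : c = 0 then 0 else (c % 2) * (1000 * (k + 3)) + potential (k + 1) (c / 2)
termination_by c
decreasing_by omega

theorem potential_zero (k : ℕ) : potential k 0 = 0 := by rw [potential]; simp

theorem potential_even (k c : ℕ) : potential k (2 * c) = potential (k + 1) c := by
  rcases Nat.eq_zero_or_pos c with rfl | h
  · simp [potential_zero]
  · rw [potential, dif_neg (by omega)]
    simp

theorem potential_odd (k c : ℕ) :
    potential k (2 * c + 1) = 1000 * (k + 3) + potential (k + 1) c := by
  rw [potential, dif_neg (by omega)]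
  congr 1
  · have : (2 * c + 1) % 2 = 1 := by omega
    rw [this, one_mul]
  · congr 1; omega

theorem potential_two_pow (k e : ℕ) : potential k (2 ^ e) = 1000 * (k + e + 3) := by
  induction e generalizing k with
  | zero =>
    have := potential_odd k 0
    simpa [potential_zero] using this
  | succ e ih =>
    rw [pow_succ, mul_comm, potential_even, ih]
    ring

/-- Amortised analysis of the carry. Clearing digit `k` releases `1000 * (k + 3)` of potential. This
pays for one round of the loop, whose cost depends on `k` only through addresses, and for the `2000`
by which the allowance `1000 * (2 * k + 4)` grows at the next digit. The digit that is finally set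
takes its potential from the allowance. The term `10 * t.mem 40` is credit for later instructions
that handle the address where the carry stopped. -/
theorem carry_loop (off : ℕ) (hoff : off ≤ 2) (q : ℕ) : ∀ (k : ℕ) (s : State Y),
    s.mem 40 = 48 + 3 * k + off →
    (∀ i, s.mem (48 + 3 * (k + i) + off) = (q.testBit i).toNat) →
    Runs E (.seq
      (.loop (.ind 40) (.block [.arith .add (.cell 40) (.const 0) (.const 0),
        .arith .add (.const 40) (.cell 40) (.const 3)]))
      (.instr (.arith .add (.cell 40) (.const 1) (.const 0)))) s
    fun t => t.label = s.label ∧ t.coins = s.coins ∧ t.truthQueries = s.truthQueries ∧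
      (∀ a, a ≠ 40 → (∀ i, a ≠ 48 + 3 * (k + i) + off) → t.mem a = s.mem a) ∧
      (∀ i, t.mem (48 + 3 * (k + i) + off) = ((q + 1).testBit i).toNat) ∧
      (∃ z, t.mem 40 = 48 + 3 * (k + z) + off ∧ (∀ i < z, q.testBit i = true) ∧
        q.testBit z = false) ∧
      t.time + potential k (q + 1) + 10 * t.mem 40 ≤ s.time + potential k q + 1000 * (2 * k + 4) := by
  induction q using Nat.strong_induction_on with
  | _ q ih =>
  intro k s h40 hbits
  have hb0 := hbits 0
  rw [add_zero, ← h40] at hb0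
  have hne : 40 ≠ s.mem 40 := by omega
  have l40 := len_le_succ 40
  have lp := len_le_succ (s.mem 40)
  have lz : len 0 = 1 := by simp [len]
  have l1 : len 1 = 1 := by simp [len]
  have l3 := len_le_succ 3
  -- An even value stops the carry. An odd value `2 * c + 1` clears its lowest digit and leaves the
  -- increment of `c` to the digits from `k + 1` on.
  obtain ⟨c, rfl | rfl⟩ := Nat.even_or_odd' q
  · have h0 : (2 * c).testBit 0 = false := by simp
    rw [h0] at hb0
    refine Runs.seq (Runs.loop_false hb0 (Q := fun t => t = s.test (.ind 40)) rfl) ?_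
    rintro t rfl
    refine Runs.instr ⟨rfl, rfl, rfl, ?_, ?_, ⟨0, ?_, by simp, h0⟩, ?_⟩
    · intro a ha hi
      have := hi 0
      simp only [exec_arith_mem, test_mem, val_cell]
      rw [Function.update_of_ne (by omega)]
    · intro i
      simp only [exec_arith_mem, test_mem, val_cell]
      rcases i with _ | i
      · rw [h40]; simp
      · rw [Function.update_of_ne (by omega), hbits]
        congr 1
        rw [Nat.testBit_succ, Nat.testBit_succ]
        congr 1
        omega
    · simp only [exec_arith_mem, test_mem, val_cell]
      rw [Function.update_of_ne (by omega), h40, add_zero]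
    · rw [potential_odd, potential_even]
      simp only [Instr.exec, State.test, Operand.cost, val_cell, val_const, eval_add, hb0,
        Function.update_of_ne hne, Bool.toNat_false]
      simp only [add_zero, lz, l1]
      omega
  · have h0 : (2 * c + 1).testBit 0 = true := by simp
    rw [h0] at hb0
    have hs : ∀ i, (2 * c + 1).testBit (i + 1) = c.testBit i := by
      intro i; rw [Nat.testBit_succ]; congr 1; omega
    have hs' : ∀ i, (2 * c + 1 + 1).testBit (i + 1) = (c + 1).testBit i := by
      intro i; rw [Nat.testBit_succ]; congr 1; omega
    obtain ⟨u, hu, hq⟩ := ih c (by omega) (k + 1) (run E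
        [.arith .add (.cell 40) (.const 0) (.const 0),
        .arith .add (.const 40) (.cell 40) (.const 3)] (s.test (.ind 40)))
      (by
        simp only [run_cons, run_nil, test_mem, exec_arith_mem, val_cell, val_const, eval_add,
          Function.update_self, Function.update_of_ne hne]
        omega)
      (fun i => by
        simp only [run_cons, run_nil, test_mem, exec_arith_mem, val_cell, val_const]
        rw [Function.update_of_ne (by omega), Function.update_of_ne (by omega), ← hs, ← hbits]
        congr 2; ring)
    -- The run given by induction is split into loop and final write, so that the first round can be
    -- put in front of the loop.
    cases hu with | seq hv hu' => ?_
    refine ⟨u, .seq (.loopTrue (by simp [hb0]) (Exec.block _ _) hv) hu', ?_⟩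
    obtain ⟨q1, q2, q3, q4, q5, ⟨z, q6, q7, q8⟩, q9⟩ := hq
    refine ⟨q1, q2, q3, ?_, ?_, ⟨z + 1, ?_, ?_, ?_⟩, ?_⟩
    · intro a ha hi
      have h1 := hi 0
      rw [q4 a ha fun i => by have := hi (i + 1); omega]
      simp only [run_cons, run_nil, test_mem, exec_arith_mem, val_cell, val_const]
      rw [Function.update_of_ne (by omega), Function.update_of_ne (by omega)]
    · intro i
      rcases i with _ | i
      · rw [q4 _ (by omega) fun i => by omega]
        simp only [run_cons, run_nil, test_mem, exec_arith_mem, val_cell, val_const]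
        rw [Function.update_of_ne (by omega), h40]
        have : (2 * c + 1 + 1) % 2 = 0 := by omega
        simp [this]
      · rw [hs', ← q5]; congr 2; ring
    · rw [q6]; ring
    · intro i hi
      rcases i with _ | i
      · exact h0
      · rw [hs]; exact q7 i (by omega)
    · rw [hs]; exact q8
    · have e2 : 2 * c + 1 + 1 = 2 * (c + 1) := by ring
      rw [potential_odd, e2, potential_even]
      simp only [run_cons, run_nil, Instr.exec, State.test, Operand.cost, val_cell, val_const,
        eval_add, hb0, Function.update_of_ne hne, Bool.toNat_true] at q9
      simp only [add_zero, lz, l1] at q9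
      have l3' := len_le_succ (s.mem 40 + 3)
      linarith

/-- The cells `48 + off`, `51 + off`, ... are the binary digits of `c`. -/
def IsCounter (off c : ℕ) (M : ℕ → ℕ) : Prop := ∀ i, M (48 + 3 * i + off) = (c.testBit i).toNat

theorem incr_runs {off c : ℕ} (hoff : off ≤ 2) (s : State Y) (hc : IsCounter off c s.mem) :
    Runs E (incr off) s fun t => t.label = s.label ∧ t.coins = s.coins ∧
      t.truthQueries = s.truthQueries ∧
      (∀ a, a ≠ 40 → (∀ i, a ≠ 48 + 3 * i + off) → t.mem a = s.mem a) ∧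
      IsCounter off (c + 1) t.mem ∧
      (∃ z, t.mem 40 = 48 + 3 * z + off ∧ (∀ i < z, c.testBit i = true) ∧
        c.testBit z = false) ∧
      t.time + potential 0 (c + 1) + 10 * t.mem 40 ≤ s.time + potential 0 c + 5000 := by
  refine Runs.seq (Runs.instr (Q := fun t => t = Instr.exec E _ s) rfl) ?_
  rintro t rfl
  refine (carry_loop off hoff c 0 _ (by simp) fun i => ?_).mono ?_
  · simp only [exec_arith_mem, val_const, zero_add]
    rw [Function.update_of_ne (by omega), hc i]
  · rintro t ⟨h1, h2, h3, h4, h5, h6, h7⟩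
    refine ⟨h1, h2, h3, fun a ha hi => ?_, by simpa [IsCounter] using h5, by simpa using h6, ?_⟩
    · rw [h4 a ha (by simpa using hi)]
      simp only [exec_arith_mem, val_const]
      rw [Function.update_of_ne ha]
    · refine h7.trans ?_
      have l1 := len_le_succ (48 + off)
      have l40 := len_le_succ 40
      have lz : len 0 = 1 := by simp [len]
      simp only [Instr.exec, Operand.cost, val_const, eval_add, add_zero]
      omega

/-- The carry of an increment stops at the digit `e` exactly when the new value is `2 ^ e`. -/
theorem carry_eq_iff {c z e : ℕ} (hz : ∀ i < z, c.testBit i = true) (hz' : c.testBit z = false)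
    (hc : c < 2 ^ e) : z = e ↔ c + 1 = 2 ^ e := by
  constructor
  · rintro rfl
    have : c = 2 ^ z - 1 := by
      refine Nat.eq_of_testBit_eq fun i => ?_
      rw [Nat.testBit_two_pow_sub_one]
      by_cases hi : i < z
      · simp [hz i hi, hi]
      · simp only [hi, decide_false]
        exact Nat.testBit_lt_two_pow (hc.trans_le (Nat.pow_le_pow_right (by omega) (by omega)))
    omega
  · intro h
    have hce : c = 2 ^ e - 1 := by omega
    have hbit : ∀ i, c.testBit i = decide (i < e) := fun i => by
      rw [hce, Nat.testBit_two_pow_sub_one]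
    rcases lt_trichotomy z e with h | h | h
    · rw [hbit] at hz'; simp [h] at hz'
    · exact h
    · have := hz e h; rw [hbit] at this; simp at this

end Counters

/-! ### One step of the bisection with two provers. -/

section Descent

variable {Y : Type*} {E : Env Y} {b : Bool} {n : ℕ} {F : ℕ → ℕ} {s : State Y}

/-- Only the cells in `l` (and the labels, the transcript and the time) change from `s` to `t`. -/
def Keeps (l : List ℕ) (s t : State Y) : Prop :=
  t.coins = s.coins ∧ t.truthQueries = s.truthQueries ∧ ∀ a ∉ l, t.mem a = s.mem a

theorem Keeps.trans {l : List ℕ} {s t u : State Y} (h : Keeps l s t) (h' : Keeps l t u) :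
    Keeps l s u :=
  ⟨h'.1.trans h.1, h'.2.1.trans h.2.1, fun a ha => (h'.2.2 a ha).trans (h.2.2 a ha)⟩

theorem Keeps.mono {l l' : List ℕ} {s t : State Y} (h : Keeps l s t) (hl : l ⊆ l') :
    Keeps l' s t :=
  ⟨h.1, h.2.1, fun a ha => h.2.2 a fun h' => ha (hl h')⟩

/-- Prover `b` reports the prefix sums `F` of the weights that the verifier computes from its
oracles, with precision `n`. -/
structure Reports (E : Env Y) (b : Bool) (n : ℕ) (F : ℕ → ℕ) : Prop where
  dim_lt : E.d < n
  five_le : 5 ≤ n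
  zero : F 0 = 0
  succ_eq : ∀ y, E.hyp false (Cube.ofNat E.d y) = E.hyp true (Cube.ofNat E.d y) → F (y + 1) = F y
  succ_ne : ∀ y, E.hyp false (Cube.ofNat E.d y) ≠ E.hyp true (Cube.ofNat E.d y) →
    F (y + 1) = F y + (2 ^ n - 1) * (E.pmf (Cube.ofNat E.d y)).num.toNat /
      (E.pmf (Cube.ofNat E.d y)).den
  lt : ∀ x ≤ 2 ^ E.d, F x < 2 ^ n
  honest : ∀ x ≤ 2 ^ E.d, ∀ tr, E.prover b (⟨b, false, n, x⟩ :: tr) = F x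
  num_lt : ∀ x, (E.pmf x).num.toNat < 2 ^ n
  den_lt : ∀ x, (E.pmf x).den < 2 ^ n

/-- The cells `1` to `5` hold the parameters. -/
def HasParams (n d : ℕ) (M : ℕ → ℕ) : Prop :=
  M 1 = n ∧ M 2 = 2 ^ n ∧ M 3 = 2 ^ n - 1 ∧ M 4 = 2 ^ d ∧ M 5 = 2 ^ d / 2

/-- The verifier has caught the dishonest prover, and reads the claims of prover `b` instead. -/
def Caught (b : Bool) (M : ℕ → ℕ) : Prop := M 16 = 14 + b.toNat ∧ M 17 = 14 + b.toNat

/-- The cells `16` and `17` point to the answers that the verifier takes for those of the two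
provers. -/
def Trust (b : Bool) (M : ℕ → ℕ) : Prop := (M 16 = 14 ∧ M 17 = 15) ∨ Caught b M

/-- Ask both provers for the prefix sum at the number in cell `13`. The claims go to the cells `28`
and `29`. -/
def ask : List Instr :=
  [.send false (.cell 13) (.cell 1), .recv false (.const 14) (.cell 1),
   .send true (.cell 13) (.cell 1), .recv true (.const 15) (.cell 1),
   .arith .add (.const 28) (.ind 16) (.const 0), .arith .add (.const 29) (.ind 17) (.const 0)]

theorem two_pow_five_le {n : ℕ} (h : 5 ≤ n) : 32 ≤ 2 ^ n :=
  (Nat.pow_le_pow_right (n := 2) (by omega) h : 2 ^ 5 ≤ 2 ^ n)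

/-- The search works with `2 * n + 3` bits: its largest numbers are products of two `n`-bit numbers,
and sums of a few `n`-bit numbers fit as well. -/
theorem four_mul_two_pow_lt (n : ℕ) : 4 * 2 ^ n < 2 ^ (2 * n + 3) := by
  have h : 2 ^ (2 * n + 3) = 8 * 2 ^ n * 2 ^ n := by ring
  have := Nat.one_le_two_pow (n := n)
  nlinarith

theorem Reports.prefix_lt (hE : Reports E b n F) : 2 ^ E.d < 2 ^ n :=
  Nat.pow_lt_pow_right (by omega) hE.dim_lt

/-- A question `x ≤ 2 ^ E.d < 2 ^ n` and the honest answer both survive truncation to `n` bits. When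
the cells `16` and `17` are equal, both claims are read from the same answer, so no dispute can
arise. -/
theorem ask_runs (hE : Reports E b n F) (h1 : s.mem 1 = n) (ht : Trust b s.mem)
    (hs : Bounded 32 (2 * n + 3) s) (h13 : s.mem 13 ≤ 2 ^ E.d) :
    Runs E (.block ask) s fun t => Keeps [14, 15, 28, 29] s t ∧ Bounded 32 (2 * n + 3) t ∧
      (∀ a, 32 ≤ a → t.mem a = s.mem a) ∧
      cond b (t.mem 29) (t.mem 28) = F (s.mem 13) ∧ t.mem 28 < 2 ^ n ∧ t.mem 29 < 2 ^ n ∧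
      (s.mem 16 = s.mem 17 → t.mem 28 = t.mem 29) ∧ t.time ≤ s.time + 13 * (2 * n + 3) * 7 := by
  have hd := hE.prefix_lt
  have h5 := two_pow_five_le hE.five_le
  have h4 := four_mul_two_pow_lt n
  have hm : s.mem 13 % 2 ^ n = s.mem 13 := Nat.mod_eq_of_lt (by omega)
  have hF : F (s.mem 13) % 2 ^ n = F (s.mem 13) := Nat.mod_eq_of_lt (hE.lt _ h13)
  have hF' := hE.lt _ h13
  have hpos : 0 < 2 ^ n := by positivity
  have hx : ∀ x, x % 2 ^ n < 2 ^ (2 * n + 3) := fun x => by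
    have := Nat.mod_lt x hpos; omega
  have hx' : ∀ x, x % 2 ^ n < 2 ^ n := fun x => Nat.mod_lt x hpos
  have hhon := hE.honest _ h13
  have key : BlockWithin E 32 (2 * n + 3) ask s := by
    rcases ht with ⟨h16, h17⟩ | ⟨h16, h17⟩ <;> cases b <;>
    simp [ask, BlockWithin, Instr.Within, Operand.Within, h1, h16, h17, hx]
      <;> omega
  obtain ⟨k1, k2, k3⟩ := key.run hs (by omega) (by omega)
  refine Runs.block ⟨⟨?_, ?_, ?_⟩, k1, k2, ?_, ?_, ?_, ?_, k3⟩
  · simp [ask]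
  · simp [ask]
  · intro a ha
    simp only [List.mem_cons, List.not_mem_nil, or_false, not_or] at ha
    simp [ask, Function.update_apply, ha]
  · rcases ht with ⟨h16, h17⟩ | ⟨h16, h17⟩ <;> cases b <;>
    simp [ask, h1, h16, h17, hm, hhon, hF]
  · rcases ht with ⟨h16, h17⟩ | ⟨h16, h17⟩ <;> cases b <;>
    simp [ask, h1, h16, h17, hx']
  · rcases ht with ⟨h16, h17⟩ | ⟨h16, h17⟩ <;> cases b <;>
    simp [ask, h1, h16, h17, hx']
  · intro h
    rcases ht with ⟨h16, h17⟩ | ⟨h16, h17⟩ <;> cases b <;>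
    simp [ask, h1, h16, h17] at h ⊢

/-- One step of the bisection: the current interval begins at cell `9` and has twice the length
in cell `8`. -/
def bisect : Program :=
  .seq (.block [.arith .add (.const 13) (.cell 9) (.cell 8)])
  (.seq (.block ask)
  (.seq (.block [
      .arith .sub (.const 19) (.cell 28) (.cell 29), .arith .sub (.const 22) (.cell 29) (.cell 28),
      .arith .add (.const 19) (.cell 19) (.cell 22), .arith .sub (.const 22) (.cell 28) (.cell 7),
      .arith .sub (.const 24) (.const 1) (.cell 25), .arith .mul (.const 22) (.cell 22) (.cell 24),
      .arith .add (.const 22) (.cell 22) (.cell 19), .arith .div (.const 8) (.cell 8) (.const 2)])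
  (.ite (.cell 22)
    (.block [.arith .add (.const 11) (.cell 28) (.const 0),
      .arith .add (.const 12) (.cell 29) (.const 0), .arith .add (.const 25) (.cell 19) (.const 0)])
    (.block [.arith .add (.const 9) (.cell 13) (.const 0),
      .arith .add (.const 10) (.cell 28) (.const 0)]))))

/-- The cells used in the bisection. -/
def scratch : List ℕ := [7, 8, 9, 10, 11, 12, 13, 14, 15, 19, 20, 21, 22, 23, 24, 25, 28, 29]

/-- The invariant of the bisection for the target `v`: the current interval is `[lo, lo + 2 ^ k)`,
the provers agree on its left end, and the target is in the interval if they also agree on its right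
end. -/
structure Bisecting (E : Env Y) (b : Bool) (n : ℕ) (F : ℕ → ℕ) (v k : ℕ) (s : State Y) :
    Prop where
  one : s.mem 1 = n
  trust : Trust b s.mem
  bounded : Bounded 32 (2 * n + 3) s
  target : s.mem 7 = v
  half : s.mem 8 = 2 ^ k / 2
  le : s.mem 9 + 2 ^ k ≤ 2 ^ E.d
  left : s.mem 10 = F (s.mem 9)
  right : cond b (s.mem 12) (s.mem 11) = F (s.mem 9 + 2 ^ k)
  lt0 : s.mem 11 < 2 ^ n
  lt1 : s.mem 12 < 2 ^ n
  dispute : s.mem 25 = 0 ↔ s.mem 11 = s.mem 12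
  agree : s.mem 16 = s.mem 17 → s.mem 25 = 0
  mem_left : s.mem 25 = 0 → F (s.mem 9) ≤ v
  mem_right : s.mem 25 = 0 → v < F (s.mem 9 + 2 ^ k) ∨ s.mem 9 + 2 ^ k = 2 ^ E.d

/-- Cell `22` is nonzero exactly when the claims about the midpoint differ, or when there is no
dispute yet and the claim exceeds the target. In this case the midpoint becomes the right end,
otherwise the left end. So the left end is always agreed upon, and a disputed right end is replaced
only by a disputed one. -/
theorem bisect_runs (hE : Reports E b n F) {v k : ℕ} (h : Bisecting E b n F v (k + 1) s) :
    Runs E bisect s fun t => Bisecting E b n F v k t ∧ (t.mem 25 = 0 → s.mem 25 = 0) ∧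
      Keeps scratch s t ∧
      (∀ a, 32 ≤ a → t.mem a = s.mem a) ∧ t.time ≤ s.time + 13 * (2 * n + 3) * 25 := by
  have hd := hE.prefix_lt
  have h5 := two_pow_five_le hE.five_le
  have h4 := four_mul_two_pow_lt n
  have hk : 2 ^ (k + 1) = 2 * 2 ^ k := by ring
  have hk1 : 2 ^ (k + 1) / 2 = 2 ^ k := by omega
  have hle := h.le
  have hhalf := h.half
  have hB : 1 ≤ 2 * n + 3 := by omega
  have hR : 32 ≤ 2 ^ (2 * n + 3) := by omega
  rw [hk1] at hhalf
  have w1 : BlockWithin E 32 (2 * n + 3) [.arith .add (.const 13) (.cell 9) (.cell 8)] s := by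
    simp [BlockWithin, Instr.Within, Operand.Within]
    omega
  obtain ⟨b1, f1, t1⟩ := w1.run h.bounded hB hR
  refine Runs.seq (Runs.block (Q := fun t => t = run E _ s) rfl) ?_
  rintro s1 rfl
  set s1 := run E [.arith .add (.const 13) (.cell 9) (.cell 8)] s with hs1
  have m1 : s1.mem = Function.update s.mem 13 (s.mem 9 + 2 ^ k) := by
    simp [hs1, hhalf]
  have c1 : s1.coins = s.coins := by simp [hs1]
  have q1 : s1.truthQueries = s.truthQueries := by simp [hs1]
  clear_value s1
  refine Runs.seq (ask_runs hE (s := s1) (by simp [m1, h.one])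
    (by simpa [m1, Trust, Caught] using h.trust) b1 (by simp [m1]; omega)) ?_
  rintro s2 ⟨kp2, b2, f2, hon, lt28, lt29, agr, t2⟩
  have m2 : ∀ a, a ≠ 14 → a ≠ 15 → a ≠ 28 → a ≠ 29 → a ≠ 13 → s2.mem a = s.mem a := by
    intro a h1 h2 h3 h4 h5
    rw [kp2.2.2 a (by simp [h1, h2, h3, h4]), m1]
    simp [h5]
  have m13 : s2.mem 13 = s.mem 9 + 2 ^ k := by
    rw [kp2.2.2 13 (by simp), m1]; simp
  have hon' : cond b (s2.mem 29) (s2.mem 28) = F (s.mem 9 + 2 ^ k) := by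
    rw [hon, m1]; simp
  have agr' : s.mem 16 = s.mem 17 → s2.mem 28 = s2.mem 29 := by
    simpa [m1] using agr
  have e1 := m2 1 (by simp) (by simp) (by simp) (by simp) (by simp)
  have e7 := m2 7 (by simp) (by simp) (by simp) (by simp) (by simp)
  have e8 := m2 8 (by simp) (by simp) (by simp) (by simp) (by simp)
  have e9 := m2 9 (by simp) (by simp) (by simp) (by simp) (by simp)
  have e10 := m2 10 (by simp) (by simp) (by simp) (by simp) (by simp)
  have e11 := m2 11 (by simp) (by simp) (by simp) (by simp) (by simp)
  have e12 := m2 12 (by simp) (by simp) (by simp) (by simp) (by simp)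
  have e16 := m2 16 (by simp) (by simp) (by simp) (by simp) (by simp)
  have e17 := m2 17 (by simp) (by simp) (by simp) (by simp) (by simp)
  have e25 := m2 25 (by simp) (by simp) (by simp) (by simp) (by simp)
  have hmul : (s2.mem 28 - v) * (1 - s.mem 25) < 2 ^ n :=
    (Nat.mul_le_mul_left _ (by omega : 1 - s.mem 25 ≤ 1)).trans_lt (by omega)
  have w3 : BlockWithin E 32 (2 * n + 3) [
      .arith .sub (.const 19) (.cell 28) (.cell 29), .arith .sub (.const 22) (.cell 29) (.cell 28),
      .arith .add (.const 19) (.cell 19) (.cell 22), .arith .sub (.const 22) (.cell 28) (.cell 7),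
      .arith .sub (.const 24) (.const 1) (.cell 25), .arith .mul (.const 22) (.cell 22) (.cell 24),
      .arith .add (.const 22) (.cell 22) (.cell 19), .arith .div (.const 8) (.cell 8) (.const 2)]
      s2 := by
    simp [BlockWithin, Instr.Within, Operand.Within, e7, e8, e25, h.target,
      hhalf]
    omega
  obtain ⟨b3, f3, t3⟩ := w3.run b2 hB hR
  refine Runs.seq (Runs.block (Q := fun t => t = run E _ s2) rfl) ?_
  rintro s3 rfl
  generalize hs3 : run E _ s2 = s3 at *
  have m3 : s3.mem = Function.update (Function.update (Function.update (Function.update s2.mem 19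
      (s2.mem 28 - s2.mem 29 + (s2.mem 29 - s2.mem 28))) 24 (1 - s.mem 25)) 22
      ((s2.mem 28 - v) * (1 - s.mem 25) + (s2.mem 28 - s2.mem 29 + (s2.mem 29 - s2.mem 28))))
      8 (2 ^ k / 2) := by
    funext a
    simp only [← hs3, run_cons, run_nil, test_mem, exec_arith_mem, val_const, val_cell, eval_add,
      eval_sub, eval_mul, eval_div, Function.update_apply, e7, e8, e25, h.target, hhalf]
    by_cases a = 8 <;> by_cases a = 22 <;> by_cases a = 24 <;> by_cases a = 19 <;> simp_all
  have c3 : s3.coins = s.coins := by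
    rw [← c1, ← kp2.1, ← hs3]; simp
  have q3 : s3.truthQueries = s.truthQueries := by
    rw [← q1, ← kp2.2.1, ← hs3]; simp
  have fr3 : ∀ a, 32 ≤ a → s3.mem a = s.mem a := fun a ha => by
    rw [f3 a ha, f2 a ha, f1 a ha]
  have n3 : ∀ a ∉ scratch, s3.mem a = s.mem a := by
    intro a ha
    simp only [scratch, List.mem_cons, List.not_mem_nil, or_false, not_or] at ha
    rw [m3]
    simp only [Function.update_apply, ha, if_false]
    exact m2 a (by omega) (by omega) (by omega) (by omega) (by omega)
  clear hs3 w3 w1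
  have g1 : s3.mem 1 = n := by simp [m3, e1, h.one]
  have g7 : s3.mem 7 = v := by simp [m3, e7, h.target]
  have g8 : s3.mem 8 = 2 ^ k / 2 := by simp [m3]
  have g9 : s3.mem 9 = s.mem 9 := by simp [m3, e9]
  have g10 : s3.mem 10 = F (s.mem 9) := by simp [m3, e10, h.left]
  have g11 : s3.mem 11 = s.mem 11 := by simp [m3, e11]
  have g12 : s3.mem 12 = s.mem 12 := by simp [m3, e12]
  have g13 : s3.mem 13 = s.mem 9 + 2 ^ k := by simp [m3, m13]
  have g16 : s3.mem 16 = s.mem 16 := by simp [m3, e16]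
  have g17 : s3.mem 17 = s.mem 17 := by simp [m3, e17]
  have g19 : s3.mem 19 = s2.mem 28 - s2.mem 29 + (s2.mem 29 - s2.mem 28) := by simp [m3]
  have g22 : s3.mem 22 = (s2.mem 28 - v) * (1 - s.mem 25) +
      (s2.mem 28 - s2.mem 29 + (s2.mem 29 - s2.mem 28)) := by simp [m3]
  have g25 : s3.mem 25 = s.mem 25 := by simp [m3, e25]
  have g28 : s3.mem 28 = s2.mem 28 := by simp [m3]
  have g29 : s3.mem 29 = s2.mem 29 := by simp [m3]
  clear m3 e1 e7 e8 e9 e10 e11 e12 e16 e17 e25 m2 m13 m1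
  generalize s2.mem 28 = x at *
  generalize s2.mem 29 = y at *
  have bt := b3.test (.cell 22)
  have tt := test_time_le (a := .cell 22) b3 (by simp [Operand.Within]) hB hR
  -- Agreement means truth, because one of the two claims is the honest one.
  have hxF : x = y → x = F (s.mem 9 + 2 ^ k) := by
    rintro rfl; simpa using hon'
  refine Runs.ite (fun hne => ?_) (fun heq => ?_)
  · rw [val_cell, g22] at hne
    have w4 : BlockWithin E 32 (2 * n + 3) [.arith .add (.const 11) (.cell 28) (.const 0),
        .arith .add (.const 12) (.cell 29) (.const 0),
        .arith .add (.const 25) (.cell 19) (.const 0)] (s3.test (.cell 22)) := by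
      simp [BlockWithin, Instr.Within, Operand.Within, g28, g29, g19]
      omega
    obtain ⟨b4, f4, t4⟩ := w4.run bt hB hR
    -- If the claims agree, this branch was entered because of the target, and the factor `1 - s.mem
    -- 25` lets the target count only in the absence of a dispute.
    have hdis : x - y + (y - x) = 0 → s.mem 25 = 0 := by
      intro hxy
      by_contra h25
      have : 1 - s.mem 25 = 0 := by omega
      simp [this] at hne
      omega
    have hag : s.mem 16 = s.mem 17 → x - y + (y - x) = 0 := fun h16 => by
      have := agr' h16; omega
    refine Runs.block ⟨⟨by simpa using g1, ?_, b4, by simpa using g7, by simpa using g8,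
      by simp [g9]; omega, by simpa [g9] using g10, by simpa [g28, g29, g9] using hon',
      by simpa [g28] using lt28, by simpa [g29] using lt29, by simp [g28, g29, g19]; omega,
      by simpa [g16, g17, g19] using hag, ?_, ?_⟩, by simpa [g19] using hdis,
      ⟨by simpa using c3, by simpa using q3, fun a ha => ?_⟩,
      fun a ha => by rw [f4 a ha, test_mem, fr3 a ha], ?_⟩
    · simpa [Trust, Caught, g16, g17] using h.trust
    · simp only [run_cons, run_nil, test_mem, exec_arith_mem, val_const, val_cell, eval_add]
      simp only [Function.update_self, ne_eq, Nat.reduceEqDiff,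
        not_false_eq_true, Function.update_of_ne, g9, g19, add_zero]
      exact fun hxy => h.mem_left (hdis hxy)
    · simp only [run_cons, run_nil, test_mem, exec_arith_mem, val_const, val_cell, eval_add]
      simp only [Function.update_self, ne_eq, Nat.reduceEqDiff,
        not_false_eq_true, Function.update_of_ne, g9, g19, add_zero]
      intro hxy
      left
      rw [← hxF (by omega)]
      by_contra hv
      have : x - v = 0 := by omega
      simp [this] at hne
      omega
    · have ha' := ha
      simp only [scratch, List.mem_cons, List.not_mem_nil, or_false, not_or] at ha'
      rw [← n3 a ha]
      simp [ha']
    · simp only [List.length_cons, List.length_nil] at *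
      omega
  · rw [val_cell, g22] at heq
    have hxy : x = y := by omega
    subst hxy
    have hx := hxF rfl
    have w4 : BlockWithin E 32 (2 * n + 3) [.arith .add (.const 9) (.cell 13) (.const 0),
        .arith .add (.const 10) (.cell 28) (.const 0)] (s3.test (.cell 22)) := by
      simp [BlockWithin, Instr.Within, Operand.Within, g28, g13]
      omega
    obtain ⟨b4, f4, t4⟩ := w4.run bt hB hR
    refine Runs.block ⟨⟨by simpa using g1, ?_, b4, by simpa using g7, by simpa using g8,
      by simp [g13]; omega, by simpa [g13, g28] using hx, ?_,
      by simpa [g11] using h.lt0, by simpa [g12] using h.lt1,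
      by simpa [g11, g12, g25] using h.dispute,
      by simpa [g16, g17, g25] using h.agree, ?_, ?_⟩, by simp [g25],
      ⟨by simpa using c3, by simpa using q3, fun a ha => ?_⟩,
      fun a ha => by rw [f4 a ha, test_mem, fr3 a ha], ?_⟩
    · simpa [Trust, Caught, g16, g17] using h.trust
    · have := h.right
      rw [hk, two_mul, ← add_assoc] at this
      simpa [g11, g12, g13] using this
    · simp only [run_cons, run_nil, test_mem, exec_arith_mem, val_const, val_cell, eval_add]
      simp only [Function.update_self, ne_eq, Nat.reduceEqDiff,
        not_false_eq_true, Function.update_of_ne, g13, g25, add_zero]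
      intro h25
      rw [h25] at heq
      rw [← hx]
      omega
    · have := h.mem_right
      rw [hk, two_mul, ← add_assoc] at this
      simpa [g13, g25] using this
    · have ha' := ha
      simp only [scratch, List.mem_cons, List.not_mem_nil, or_false, not_or] at ha'
      rw [← n3 a ha]
      simp [ha']
    · simp only [List.length_cons, List.length_nil] at *
      omega

end Descent

/-! ### Selecting a point and exposing the liar. -/

section Locate

variable {Y : Type*} {E : Env Y} {b : Bool} {n : ℕ} {F : ℕ → ℕ} {s : State Y}

theorem bisect_loop_runs (hE : Reports E b n F) {v : ℕ} (k : ℕ) : ∀ s : State Y,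
    Bisecting E b n F v k s →
    Runs E (.loop (.cell 8) bisect) s fun t => Bisecting E b n F v 0 t ∧
      (t.mem 25 = 0 → s.mem 25 = 0) ∧ Keeps scratch s t ∧
      (∀ a, 32 ≤ a → t.mem a = s.mem a) ∧
      t.time ≤ s.time + 329 * (2 * n + 3) * k + 4 * (2 * n + 3) := by
  have h5 := two_pow_five_le hE.five_le
  have h4 := four_mul_two_pow_lt n
  have hB : 1 ≤ 2 * n + 3 := by omega
  have hR : 32 ≤ 2 ^ (2 * n + 3) := by omega
  have key : ∀ s : State Y, Bisecting E b n F v k s →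
      Bisecting E b n F v k (s.test (.cell 8)) ∧
      (s.test (.cell 8)).time ≤ s.time + 4 * (2 * n + 3) := fun s h =>
    ⟨⟨h.one, h.trust, h.bounded, h.target, h.half, h.le, h.left, h.right, h.lt0, h.lt1,
      h.dispute, h.agree, h.mem_left, h.mem_right⟩,
      test_time_le (a := .cell 8) h.bounded (by simp [Operand.Within]) hB hR⟩
  induction k with
  | zero =>
    intro s h
    obtain ⟨h', ht⟩ := key s h
    exact Runs.loop_false (by simpa using h.half) ⟨h', id, ⟨rfl, rfl, fun _ _ => rfl⟩, fun _ _ => rfl,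
      ht.trans (by omega)⟩
  | succ k ih =>
    intro s h
    obtain ⟨h', ht⟩ := key s h
    have hk : 2 ^ (k + 1) = 2 * 2 ^ k := by ring
    have hpos : 0 < 2 ^ k := by positivity
    refine Runs.loop_true (by rw [val_cell, h.half]; omega) (bisect_runs hE h') ?_
    rintro t ⟨h1, hz, h2, h3, h4⟩
    refine (ih (fun s h => ⟨⟨h.one, h.trust, h.bounded, h.target, h.half, h.le, h.left, h.right,
      h.lt0, h.lt1, h.dispute, h.agree, h.mem_left, h.mem_right⟩,
      test_time_le (a := .cell 8) h.bounded (by simp [Operand.Within]) hB hR⟩) t h1).mono ?_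
    rintro u ⟨k1, kz, k2, k3, k4⟩
    refine ⟨k1, fun h => hz (kz h), Keeps.trans h2 k2, fun a ha => (k3 a ha).trans (h3 a ha), ?_⟩
    have : 329 * (2 * n + 3) * (k + 1) = 329 * (2 * n + 3) * k + 329 * (2 * n + 3) := by ring
    omega

/-- Find the point of the cube selected by the random number in cell `6`. -/
def descend : Program :=
  .seq (.block [.arith .add (.const 13) (.cell 4) (.const 0)])
  (.seq (.block ask)
  (.seq (.block [
      .arith .add (.const 11) (.cell 28) (.const 0), .arith .add (.const 12) (.cell 29) (.const 0),
      .arith .sub (.const 19) (.cell 28) (.cell 29), .arith .sub (.const 22) (.cell 29) (.cell 28),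
      .arith .add (.const 25) (.cell 19) (.cell 22), .arith .mul (.const 7) (.cell 6) (.cell 28),
      .arith .div (.const 7) (.cell 7) (.cell 2), .arith .add (.const 8) (.cell 5) (.const 0),
      .arith .add (.const 9) (.const 0) (.const 0), .arith .add (.const 10) (.const 0) (.const 0)])
  (.loop (.cell 8) bisect)))

theorem HasParams.of_keeps {d : ℕ} {l : List ℕ} {s t : State Y} (h : HasParams n d s.mem)
    (hk : Keeps l s t) (hl : ∀ a ∈ l, 5 < a) : HasParams n d t.mem := by
  have : ∀ a, a ≤ 5 → t.mem a = s.mem a := fun a ha => hk.2.2 a fun h => by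
    have := hl a h; omega
  simpa only [HasParams, this 1 (by simp), this 2 (by simp), this 3 (by simp), this 4 (by simp),
    this 5 (by simp)] using h

theorem mul_two_pow_lt {r x n : ℕ} (hr : r < 2 ^ n) (hx : x < 2 ^ n) :
    r * x < 2 ^ (2 * n + 3) := by
  have h1 : 2 ^ (2 * n + 3) = 8 * (2 ^ n * 2 ^ n) := by ring
  have h2 : r * x ≤ 2 ^ n * 2 ^ n := Nat.mul_le_mul hr.le hx.le
  have h3 : 0 < 2 ^ n * 2 ^ n := by positivity
  omega

/-- The target is computed from the claim in cell `28` about the total weight, which may be false.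
It is therefore existentially quantified and identified only when no dispute remains; since a
dispute never disappears during the bisection, the claims about the total then agreed too. -/
theorem descend_runs (hE : Reports E b n F) (hp : HasParams n E.d s.mem) (ht : Trust b s.mem)
    (hs : Bounded 32 (2 * n + 3) s) (hr : s.mem 6 < 2 ^ n) :
    Runs E descend s fun t => ∃ v, Bisecting E b n F v 0 t ∧
      (t.mem 25 = 0 → v = s.mem 6 * F (2 ^ E.d) / 2 ^ n) ∧ Keeps scratch s t ∧
      (∀ a, 32 ≤ a → t.mem a = s.mem a) ∧ t.time ≤ s.time + 329 * (2 * n + 3) * (E.d + 1) := by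
  have hd := hE.prefix_lt
  have h5 := two_pow_five_le hE.five_le
  have h4 := four_mul_two_pow_lt n
  have hB : 1 ≤ 2 * n + 3 := by omega
  have hR : 32 ≤ 2 ^ (2 * n + 3) := by omega
  obtain ⟨p1, p2, p3, p4, p5⟩ := hp
  have w1 : BlockWithin E 32 (2 * n + 3) [.arith .add (.const 13) (.cell 4) (.const 0)] s := by
    simp [BlockWithin, Instr.Within, Operand.Within, p4]
    omega
  obtain ⟨b1, f1, t1⟩ := w1.run hs hB hR
  refine Runs.seq (Runs.block (Q := fun t => t = run E _ s) rfl) ?_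
  rintro s1 rfl
  set s1 := run E [.arith .add (.const 13) (.cell 4) (.const 0)] s with hs1
  have m1 : s1.mem = Function.update s.mem 13 (2 ^ E.d) := by
    simp [hs1, p4]
  have c1 : s1.coins = s.coins := by simp [hs1]
  have q1 : s1.truthQueries = s.truthQueries := by simp [hs1]
  clear_value s1
  refine Runs.seq (ask_runs hE (s := s1) (by simp [m1, p1])
    (by simpa [m1, Trust, Caught] using ht) b1 (by simp [m1])) ?_
  rintro s2 ⟨kp2, b2, f2, hon, lt28, lt29, agr, t2⟩
  have m2 : ∀ a, a ≠ 14 → a ≠ 15 → a ≠ 28 → a ≠ 29 → a ≠ 13 → s2.mem a = s.mem a := by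
    intro a h1 h2 h3 h4 h5
    rw [kp2.2.2 a (by simp [h1, h2, h3, h4]), m1]
    simp [h5]
  have hon' : cond b (s2.mem 29) (s2.mem 28) = F (2 ^ E.d) := by
    rw [hon, m1]; simp
  have agr' : s.mem 16 = s.mem 17 → s2.mem 28 = s2.mem 29 := by
    simpa [m1] using agr
  have e1 := m2 1 (by simp) (by simp) (by simp) (by simp) (by simp)
  have e2 := m2 2 (by simp) (by simp) (by simp) (by simp) (by simp)
  have e5 := m2 5 (by simp) (by simp) (by simp) (by simp) (by simp)
  have e6 := m2 6 (by simp) (by simp) (by simp) (by simp) (by simp)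
  have e16 := m2 16 (by simp) (by simp) (by simp) (by simp) (by simp)
  have e17 := m2 17 (by simp) (by simp) (by simp) (by simp) (by simp)
  have hmul := mul_two_pow_lt hr lt28
  have hdiv : s.mem 6 * s2.mem 28 / 2 ^ n ≤ s.mem 6 * s2.mem 28 := Nat.div_le_self _ _
  have w3 : BlockWithin E 32 (2 * n + 3) [
      .arith .add (.const 11) (.cell 28) (.const 0), .arith .add (.const 12) (.cell 29) (.const 0),
      .arith .sub (.const 19) (.cell 28) (.cell 29), .arith .sub (.const 22) (.cell 29) (.cell 28),
      .arith .add (.const 25) (.cell 19) (.cell 22), .arith .mul (.const 7) (.cell 6) (.cell 28),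
      .arith .div (.const 7) (.cell 7) (.cell 2), .arith .add (.const 8) (.cell 5) (.const 0),
      .arith .add (.const 9) (.const 0) (.const 0), .arith .add (.const 10) (.const 0) (.const 0)]
      s2 := by
    simp [BlockWithin, Instr.Within, Operand.Within, e6, e2, e5, p5, p2]
    omega
  obtain ⟨b3, f3, t3⟩ := w3.run b2 hB hR
  refine Runs.seq (Runs.block (Q := fun t => t = run E _ s2) rfl) ?_
  rintro s3 rfl
  generalize hs3 : run E _ s2 = s3 at *
  have c3 : s3.coins = s.coins := by
    rw [← c1, ← kp2.1, ← hs3]; simp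
  have q3 : s3.truthQueries = s.truthQueries := by
    rw [← q1, ← kp2.2.1, ← hs3]; simp
  have fr3 : ∀ a, 32 ≤ a → s3.mem a = s.mem a := fun a ha => by
    rw [f3 a ha, f2 a ha, f1 a ha]
  have n3 : ∀ a ∉ scratch, s3.mem a = s.mem a := by
    intro a ha
    simp only [scratch, List.mem_cons, List.not_mem_nil, or_false, not_or] at ha
    rw [← hs3]
    simp [ha]
    exact m2 a (by omega) (by omega) (by omega) (by omega) (by omega)
  have hxF : s2.mem 28 = s2.mem 29 → s2.mem 28 = F (2 ^ E.d) := by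
    intro h; rw [← hon', ← h]; cases b <;> rfl
  have g25 : s3.mem 25 = s2.mem 28 - s2.mem 29 + (s2.mem 29 - s2.mem 28) := by simp [← hs3]
  have hbis : Bisecting E b n F (s.mem 6 * s2.mem 28 / 2 ^ n) E.d s3 := by
    refine ⟨by simp [← hs3, e1, p1], ?_, b3, by simp [← hs3, e6, e2, p2],
      by simp [← hs3, e5, p5], by simp [← hs3], by simp [← hs3, hE.zero],
      by simpa [← hs3] using hon', by simpa [← hs3], by simpa [← hs3], ?_, ?_, ?_, ?_⟩
    · simpa [← hs3, Trust, Caught, e16, e17] using ht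
    · simp [← hs3]; omega
    · simp only [g25]
      intro h
      have := agr' (by simpa [← hs3, e16, e17] using h)
      omega
    · intro _
      simp [← hs3, hE.zero]
    · intro _
      right
      simp [← hs3]
  refine (bisect_loop_runs hE E.d s3 hbis).mono ?_
  rintro t ⟨k1, kz, k2, k3, k4⟩
  refine ⟨_, k1, fun h25 => ?_, Keeps.trans ⟨c3, q3, n3⟩ k2,
    fun a ha => (k3 a ha).trans (fr3 a ha), ?_⟩
  · have := kz h25
    rw [g25] at this
    rw [hxF (by omega)]
  · simp only [List.length_cons, List.length_nil] at *
    have : 329 * (2 * n + 3) * (E.d + 1) = 329 * (2 * n + 3) * E.d + 329 * (2 * n + 3) := by ring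
    omega

/-- Settle a dispute about the weight of a single point. -/
def settle : List Instr :=
  [.queryPmf (.const 20) (.const 21) (.cell 9), .arith .mul (.const 20) (.cell 3) (.cell 20),
   .arith .div (.const 20) (.cell 20) (.cell 21),
   .queryLabel (.hyp false) (.const 0) (.cell 9), .queryLabel (.hyp true) (.const 1) (.cell 9),
   .eqLabel (.const 22) (.const 0) (.const 1), .arith .sub (.const 22) (.const 1) (.cell 22),
   .arith .mul (.const 20) (.cell 20) (.cell 22), .arith .add (.const 23) (.cell 10) (.cell 20),
   .arith .sub (.const 24) (.cell 11) (.cell 23), .arith .sub (.const 19) (.cell 23) (.cell 11),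
   .arith .add (.const 24) (.cell 24) (.cell 19), .arith .sub (.const 24) (.const 1) (.cell 24),
   .arith .sub (.const 16) (.const 15) (.cell 24),
   .arith .sub (.const 24) (.cell 12) (.cell 23), .arith .sub (.const 19) (.cell 23) (.cell 12),
   .arith .add (.const 24) (.cell 24) (.cell 19), .arith .sub (.const 24) (.const 1) (.cell 24),
   .arith .add (.const 17) (.const 14) (.cell 24)]

/-- The prefix sum at the left end is agreed upon, hence correct, so adding the weight computed from
the oracles gives the true value at the right end. The two claims there differ, so only that of
prover `b` is true. With correctness counted as `0` or `1`, cell `16` becomes `15` minus the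
correctness of the first claim and cell `17` becomes `14` plus that of the second; both equal `14 +
b.toNat`. -/
theorem settle_runs (hE : Reports E b n F) {v : ℕ} (h : Bisecting E b n F v 0 s)
    (h3 : s.mem 3 = 2 ^ n - 1) (h25 : s.mem 25 ≠ 0) :
    Runs E (.block settle) s fun t => Caught b t.mem ∧ Bounded 32 (2 * n + 3) t ∧
      Keeps (16 :: 17 :: scratch) s t ∧ (∀ a, 32 ≤ a → t.mem a = s.mem a) ∧
      t.time ≤ s.time + 13 * (2 * n + 3) * 20 := by
  have hd := hE.prefix_lt
  have hd' := hE.dim_lt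
  have h5 := two_pow_five_le hE.five_le
  have h4 := four_mul_two_pow_lt n
  have hB : 1 ≤ 2 * n + 3 := by omega
  have hR : 32 ≤ 2 ^ (2 * n + 3) := by omega
  have hle := h.le
  have hright := h.right
  have hleft := h.left
  have hlt0 := h.lt0
  have hlt1 := h.lt1
  have hne : s.mem 11 ≠ s.mem 12 := fun hh => h25 (h.dispute.2 hh)
  rw [pow_zero] at hle hright
  have hnum := hE.num_lt (Cube.ofNat E.d (s.mem 9))
  have hden := hE.den_lt (Cube.ofNat E.d (s.mem 9))
  have hmul := mul_two_pow_lt (by omega : 2 ^ n - 1 < 2 ^ n) hnum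
  have hdiv := Nat.div_le_self ((2 ^ n - 1) * (E.pmf (Cube.ofNat E.d (s.mem 9))).num.toNat)
    (E.pmf (Cube.ofNat E.d (s.mem 9))).den
  have hF := hE.lt _ (by omega : s.mem 9 ≤ 2 ^ E.d)
  have hF' := hE.lt _ hle
  have hS1 := hE.succ_eq (s.mem 9)
  have hS2 := hE.succ_ne (s.mem 9)
  generalize hw : (2 ^ n - 1) * (E.pmf (Cube.ofNat E.d (s.mem 9))).num.toNat /
    (E.pmf (Cube.ofNat E.d (s.mem 9))).den = w at *
  generalize hnume : (E.pmf (Cube.ofNat E.d (s.mem 9))).num.toNat = num at *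
  generalize hdene : (E.pmf (Cube.ofNat E.d (s.mem 9))).den = den at *
  have oh : ∀ c x, E.oracle (.hyp c) x = E.hyp c x := fun _ _ => rfl
  have key : BlockWithin E 32 (2 * n + 3) settle s ∧ (run E settle s).mem 16 =
      15 - (1 - (s.mem 11 - F (s.mem 9 + 1) + (F (s.mem 9 + 1) - s.mem 11))) ∧
      (run E settle s).mem 17 =
      14 + (1 - (s.mem 12 - F (s.mem 9 + 1) + (F (s.mem 9 + 1) - s.mem 12))) := by
    by_cases hh : E.hyp false (Cube.ofNat E.d (s.mem 9)) = E.hyp true (Cube.ofNat E.d (s.mem 9))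
    · have hS := hS1 hh
      rw [hS]
      refine ⟨?_, ?_, ?_⟩
      · simp [settle, BlockWithin, Instr.Within, Operand.Within, oh, hh, h3, hnume, hdene, hw, hleft]
        omega
      · simp [settle, oh, hh, h3, hnume, hdene, hw, hleft]
      · simp [settle, oh, hh, h3, hnume, hdene, hw, hleft]
    · have hS := hS2 hh
      rw [hS]
      refine ⟨?_, ?_, ?_⟩
      · simp [settle, BlockWithin, Instr.Within, Operand.Within, oh, hh, h3, hnume, hdene, hw, hleft]
        omega
      · simp [settle, oh, hh, h3, hnume, hdene, hw, hleft]
      · simp [settle, oh, hh, h3, hnume, hdene, hw, hleft]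
  obtain ⟨key, k16, k17⟩ := key
  obtain ⟨k1, k2, k3⟩ := key.run h.bounded hB hR
  refine Runs.block ⟨?_, k1, ⟨?_, ?_, ?_⟩, k2, k3⟩
  · rw [Caught, k16, k17]
    cases b
    · simp only [cond_false] at hright
      simp only [Bool.toNat_false]
      omega
    · simp only [cond_true] at hright
      simp only [Bool.toNat_true]
      omega
  · simp [settle]
  · simp [settle]
  · intro a ha
    simp only [scratch, List.mem_cons, List.not_mem_nil, or_false, not_or] at ha
    simp [settle, ha]

theorem test_skip_time (s : State Y) : (s.test (.const 0)).time = s.time + 2 := by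
  simp [test_time, Operand.cost, len]

/-- Find the point of the cube selected by the random number in cell `6`, whatever the dishonest
prover does. -/
def locate : Program := .seq descend (.ite (.cell 25) (.seq (.block settle) descend) .skip)

/-- After a dispute has been settled both pointers lead to the honest answers, so the second descent
is free of disputes and two descents always suffice. The alternative `t.mem 9 + 1 = 2 ^ E.d` is
there for total weight zero, when no prefix sum exceeds the target. -/
theorem locate_runs (hE : Reports E b n F) (hp : HasParams n E.d s.mem) (ht : Trust b s.mem)
    (hs : Bounded 32 (2 * n + 3) s) (hr : s.mem 6 < 2 ^ n) :
    Runs E locate s fun t =>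
      (t.mem 9 < 2 ^ E.d ∧ F (t.mem 9) ≤ s.mem 6 * F (2 ^ E.d) / 2 ^ n ∧
        (s.mem 6 * F (2 ^ E.d) / 2 ^ n < F (t.mem 9 + 1) ∨ t.mem 9 + 1 = 2 ^ E.d)) ∧
      Trust b t.mem ∧ Bounded 32 (2 * n + 3) t ∧ Keeps (16 :: 17 :: scratch) s t ∧
      (∀ a, 32 ≤ a → t.mem a = s.mem a) ∧ t.time ≤ s.time + 1000 * (2 * n + 3) * (E.d + 1) := by
  have h5 := two_pow_five_le hE.five_le
  have h4 := four_mul_two_pow_lt n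
  have hB : 1 ≤ 2 * n + 3 := by omega
  have hR : 32 ≤ 2 ^ (2 * n + 3) := by omega
  have fin : ∀ {v : ℕ} {t : State Y}, Bisecting E b n F v 0 t → t.mem 25 = 0 →
      (t.mem 25 = 0 → v = s.mem 6 * F (2 ^ E.d) / 2 ^ n) →
      (t.mem 9 < 2 ^ E.d ∧ F (t.mem 9) ≤ s.mem 6 * F (2 ^ E.d) / 2 ^ n ∧
        (s.mem 6 * F (2 ^ E.d) / 2 ^ n < F (t.mem 9 + 1) ∨ t.mem 9 + 1 = 2 ^ E.d)) := by
    intro v t h h25 hv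
    have hle := h.le
    have h1 := h.mem_left h25
    have h2 := h.mem_right h25
    rw [pow_zero] at hle h2
    rw [hv h25] at h1 h2
    exact ⟨by omega, h1, h2⟩
  have hmul := Nat.zero_le ((2 * n + 3) * E.d)
  refine Runs.seq (descend_runs hE hp ht hs hr) ?_
  rintro t ⟨v, h1, h2, h3, h4, h5⟩
  have tt := test_time_le (a := .cell 25) h1.bounded (by simp [Operand.Within]) hB hR
  refine Runs.ite (fun hne => ?_) (fun heq => ?_)
  · have h1' : Bisecting E b n F v 0 (t.test (.cell 25)) :=
      ⟨h1.one, h1.trust, h1.bounded, h1.target, h1.half, h1.le, h1.left, h1.right, h1.lt0, h1.lt1,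
      h1.dispute, h1.agree, h1.mem_left, h1.mem_right⟩
    have hp1 := hp.of_keeps h3 (by simp [scratch])
    have h6 := h3.2.2 6 (by simp [scratch])
    refine Runs.seq (settle_runs hE h1' hp1.2.2.1 hne) ?_
    rintro u ⟨k1, k2, k3, k4, k5⟩
    have h6' : u.mem 6 = s.mem 6 := (k3.2.2 6 (by simp [scratch])).trans h6
    refine (descend_runs hE (hp1.of_keeps k3 (by simp [scratch])) (.inr k1) k2
      (by rwa [h6'])).mono ?_
    rintro w ⟨v', l1, l2, l3, l4, l5⟩
    rw [h6'] at l2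
    have e16 := l3.2.2 16 (by simp [scratch])
    have e17 := l3.2.2 17 (by simp [scratch])
    refine ⟨fin l1 (l1.agree ?_) l2, l1.trust, l1.bounded,
      (h3.mono (by simp [scratch])).trans (Keeps.trans k3 (l3.mono (by simp [scratch]))),
      fun a ha => (l4 a ha).trans ((k4 a ha).trans (h4 a ha)), ?_⟩
    · rw [e16, e17, k1.1, k1.2]
    · linarith
  · have hfin := fin h1 heq h2
    refine Runs.skip ⟨hfin, h1.trust, h1.bounded, h3.mono (by simp [scratch]), h4, ?_⟩
    rw [test_skip_time]
    linarith

end Locate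

/-! ### One sample and its vote. -/

section Sampling

variable {Y : Type*} {E : Env Y} {b : Bool} {n : ℕ} {F : ℕ → ℕ} {s : State Y}

theorem Bounded.congr {R B : ℕ} {s t : State Y} (h : Bounded R B s)
    (hst : ∀ a < R, t.mem a = s.mem a) : Bounded R B t := fun a ha => by
  rw [hst a ha]; exact h a ha

/-- The counter with offset `off` changes from `c` to `c'`, and nothing else does. -/
def Updates (off c c' : ℕ) (s t : State Y) : Prop :=
  t.coins = s.coins ∧ t.truthQueries = s.truthQueries ∧
    (∀ a, a ≠ 40 → (∀ i, a ≠ 48 + 3 * i + off) → t.mem a = s.mem a) ∧ IsCounter off c' t.mem ∧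
    t.time + potential 0 c' ≤ s.time + potential 0 c + 6000

theorem incr_updates {off c : ℕ} (hoff : off ≤ 2) (s : State Y) (hc : IsCounter off c s.mem)
    {a : ℕ} (ha : a < 32) (hs : s.mem a ≤ 1) :
    Runs E (incr off) (s.test (.cell a)) (Updates off c (c + 1) s) := by
  refine (incr_runs hoff (s.test (.cell a)) hc).mono ?_
  rintro t ⟨h1, h2, h3, h4, h5, h6, h7⟩
  refine ⟨h2, h3, h4, h5, ?_⟩
  have l1 := len_le_succ a
  have l2 := len_le_succ (s.mem a)
  simp only [test_time, Operand.cost] at h7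
  omega

theorem skip_updates {off c : ℕ} (s : State Y) (hc : IsCounter off c s.mem)
    {a : ℕ} (ha : a < 32) (hs : s.mem a ≤ 1) :
    Runs E .skip (s.test (.cell a)) (Updates off c c s) := by
  refine Runs.skip ⟨rfl, rfl, fun _ _ _ => rfl, hc, ?_⟩
  have l1 := len_le_succ a
  have l2 := len_le_succ (s.mem a)
  rw [test_skip_time]
  simp only [test_time, Operand.cost]
  omega

open Classical in
/-- Twice the vote of the label of `x` in favour of the hypothesis `true`, where a label that neither
hypothesis predicts is half a vote. -/
noncomputable def vote {X : Type*} (f : X → Y) (h : Bool → X → Y) (x : X) : ℕ :=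
  (if h false x = f x then 0 else 1) + (if h true x = f x then 1 else 0)

/-- The point below `N` selected by the target `v`. -/
def selected (F : ℕ → ℕ) (N v : ℕ) : ℕ := Nat.findGreatest (fun x => F x ≤ v) (N - 1)

/-- Describes the result of the search without reference to its course, so that it is seen not to
depend on the dishonest prover. -/
theorem selected_eq {N v x : ℕ} (hF : Monotone F) (hx : x < N) (h1 : F x ≤ v)
    (h2 : v < F (x + 1) ∨ x + 1 = N) : selected F N v = x := by
  rw [selected, Nat.findGreatest_eq_iff]
  refine ⟨by omega, fun _ => h1, fun y hy hy' => ?_⟩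
  rcases h2 with h2 | h2
  · have := hF (show x + 1 ≤ y by omega)
    omega
  · omega

theorem Reports.monotone (hE : Reports E b n F) : Monotone F := by
  refine monotone_nat_of_le_succ fun y => ?_
  by_cases h : E.hyp false (Cube.ofNat E.d y) = E.hyp true (Cube.ofNat E.d y)
  · rw [hE.succ_eq y h]
  · rw [hE.succ_ne y h]; exact Nat.le_add_right _ _

/-- The vote of the sample selected by the random number `r`. -/
noncomputable def sampleVote {d : ℕ} (n : ℕ) (F : ℕ → ℕ) (f : Cube d → Y) (h : Bool → Cube d → Y)
    (r : ℕ) : ℕ :=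
  vote f h (Cube.ofNat d (selected F (2 ^ d) (r * F (2 ^ d) / 2 ^ n)))

/-- Draw a sample and count its vote. -/
def sample : Program :=
  .seq (.block [.coin (.const 6) (.cell 1)])
  (.seq locate
  (.seq (.block [.queryLabel (.hyp false) (.const 0) (.cell 9),
      .queryLabel (.hyp true) (.const 1) (.cell 9), .queryLabel .truth (.const 2) (.cell 9),
      .eqLabel (.const 22) (.const 0) (.const 2), .eqLabel (.const 24) (.const 1) (.const 2)])
  (.seq (.ite (.cell 22) .skip (incr 1))
  (.seq (.ite (.cell 24) (incr 1) .skip)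
  (.seq (incr 0)
  (.seq (.instr (.arith .add (.const 40) (.cell 40) (.const 2)))
    (.instr (.arith .sub (.const 18) (.const 1) (.ind 40)))))))))

/-- The state of the verifier after `c` of `2 ^ e` samples, with tally `τ`. -/
structure Sampling (E : Env Y) (b : Bool) (n e c τ : ℕ) (s : State Y) : Prop where
  params : HasParams n E.d s.mem
  trust : Trust b s.mem
  bounded : Bounded 32 (2 * n + 3) s
  counter : IsCounter 0 c s.mem
  tally : IsCounter 1 τ s.mem
  mark : ∀ i, s.mem (48 + 3 * i + 2) = if i = e then 1 else 0

-- By `selected_eq` the vote is a function of the coins. The digits of the sample counter, those of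
-- the tally and the mark are interleaved with period three, so the cell two places after the one
-- where the carry of the sample counter stopped is the mark cell of the same digit. By
-- `carry_eq_iff` it contains `1` exactly when the counter has just reached `2 ^ e`. The end of the
-- loop is thus detected without reading the whole counter.
open Classical in
theorem sample_runs (hE : Reports E b n F) {e c τ : ℕ} (hc : c < 2 ^ e)
    (h : Sampling E b n e c τ s) :
    Runs E sample s fun t =>
      Sampling E b n e (c + 1) (τ + sampleVote n F E.truth E.hyp (E.toss s.coins n)) t ∧
      t.coins = s.coins + n ∧ t.truthQueries = s.truthQueries + 1 ∧
      t.mem 18 = (if c + 1 = 2 ^ e then 0 else 1) ∧ (∀ a, 32 ≤ a → a < 40 → t.mem a = s.mem a) ∧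
      t.time + potential 0 (c + 1) +
        potential 0 (τ + sampleVote n F E.truth E.hyp (E.toss s.coins n)) ≤
      s.time + potential 0 c + potential 0 τ + 3000 * (2 * n + 3) * (E.d + 1) := by
  have hd := hE.prefix_lt
  have hd' := hE.dim_lt
  have h5 := two_pow_five_le hE.five_le
  have h4 := four_mul_two_pow_lt n
  have hB : 1 ≤ 2 * n + 3 := by omega
  have hR : 32 ≤ 2 ^ (2 * n + 3) := by omega
  have hn := h.params.1
  set r := E.toss s.coins n with hr
  have hrn : r < 2 ^ n := toss_lt E _ _
  have w1 : BlockWithin E 32 (2 * n + 3) [.coin (.const 6) (.cell 1)] s := by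
    simp [BlockWithin, Instr.Within, Operand.Within, hn]
    omega
  obtain ⟨b1, f1, t1⟩ := w1.run h.bounded hB hR
  refine Runs.seq (Runs.block (Q := fun t => t = run E _ s) rfl) ?_
  rintro s1 rfl
  set s1 := run E [.coin (.const 6) (.cell 1)] s with hs1
  have m1 : s1.mem = Function.update s.mem 6 r := by
    simp [hs1, hn, hr]
  have c1 : s1.coins = s.coins + n := by simp [hs1, hn]
  have q1 : s1.truthQueries = s.truthQueries := by simp [hs1]
  clear_value s1
  have hp1 : HasParams n E.d s1.mem := by simpa [HasParams, m1] using h.params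
  refine Runs.seq (locate_runs hE hp1 (by simpa [m1, Trust, Caught] using h.trust) b1
    (by simpa [m1])) ?_
  rintro s2 ⟨loc, tr2, b2, kp2, f2, t2⟩
  have m16 : s1.mem 6 = r := by simp [m1]
  rw [m16] at loc
  have hsel := selected_eq hE.monotone loc.1 loc.2.1 loc.2.2
  have hp2 : HasParams n E.d s2.mem := hp1.of_keeps kp2 (by simp [scratch])
  have w3 : BlockWithin E 32 (2 * n + 3) [.queryLabel (.hyp false) (.const 0) (.cell 9),
      .queryLabel (.hyp true) (.const 1) (.cell 9), .queryLabel .truth (.const 2) (.cell 9),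
      .eqLabel (.const 22) (.const 0) (.const 2), .eqLabel (.const 24) (.const 1) (.const 2)]
      s2 := by
    simp [BlockWithin, Instr.Within, Operand.Within]
    omega
  obtain ⟨b3, f3, t3⟩ := w3.run b2 hB hR
  refine Runs.seq (Runs.block (Q := fun t => t = run E _ s2) rfl) ?_
  rintro s3 rfl
  generalize hs3 : run E _ s2 = s3 at *
  set x := Cube.ofNat E.d (s2.mem 9) with hx
  have hvote : sampleVote n F E.truth E.hyp r = vote E.truth E.hyp x := by
    rw [sampleVote, hsel]
  have m3 : ∀ a, a ≠ 22 → a ≠ 24 → s3.mem a = s2.mem a := by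
    intro a h1 h2; simp [← hs3, h1, h2]
  have c3 : s3.coins = s.coins + n := by rw [← c1, ← kp2.1, ← hs3]; simp
  have q3 : s3.truthQueries = s.truthQueries + 1 := by rw [← q1, ← kp2.2.1, ← hs3]; simp
  have oh : ∀ c y, E.oracle (.hyp c) y = E.hyp c y := fun _ _ => rfl
  have ot : ∀ y, E.oracle .truth y = E.truth y := fun _ => rfl
  have e1 : s3.mem 22 = if E.hyp false x = E.truth x then 1 else 0 := by
    simp [← hs3, oh, ot, hx]
  have e2 : s3.mem 24 = if E.hyp true x = E.truth x then 1 else 0 := by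
    simp [← hs3, oh, ot, hx]
  have g22 : s3.mem 22 ≤ 1 := by rw [e1]; split_ifs <;> simp
  have g24 : s3.mem 24 ≤ 1 := by rw [e2]; split_ifs <;> simp
  have hv : vote E.truth E.hyp x = (1 - s3.mem 22) + s3.mem 24 := by
    rw [vote, e1, e2]
    congr 1
    split_ifs <;> rfl
  have hi3 : ∀ a, 32 ≤ a → s3.mem a = s.mem a := fun a ha => by
    rw [f3 a ha, f2 a ha, f1 a ha]
  have ctr3 : IsCounter 0 c s3.mem := fun i => by rw [hi3 _ (by omega)]; exact h.counter i
  have tal3 : IsCounter 1 τ s3.mem := fun i => by rw [hi3 _ (by omega)]; exact h.tally i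
  have mark3 : ∀ i, s3.mem (48 + 3 * i + 2) = if i = e then 1 else 0 := fun i => by
    rw [hi3 _ (by omega)]; exact h.mark i
  clear hs3 w3 w1
  refine Runs.seq (Q := Updates 1 τ (τ + (1 - s3.mem 22)) s3) (Runs.ite (fun hne => ?_)
    (fun heq => ?_)) ?_
  · have : 1 - s3.mem 22 = 0 := by rw [val_cell] at hne; omega
    rw [this]
    exact skip_updates s3 tal3 (by simp) g22
  · have : 1 - s3.mem 22 = 1 := by rw [val_cell] at heq; omega
    rw [this]
    exact incr_updates (by simp) s3 tal3 (by simp) g22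
  rintro s4 ⟨c4, q4, f4, k4, t4⟩
  have e24 : s4.mem 24 = s3.mem 24 := f4 24 (by simp) (fun i => by omega)
  refine Runs.seq (Q := Updates 1 (τ + (1 - s3.mem 22)) (τ + vote E.truth E.hyp x) s4)
    (Runs.ite (fun hne => ?_) (fun heq => ?_)) ?_
  · have : τ + vote E.truth E.hyp x = τ + (1 - s3.mem 22) + 1 := by
      rw [val_cell] at hne; omega
    rw [this]
    exact incr_updates (by simp) s4 k4 (by simp) (by omega)
  · have : τ + vote E.truth E.hyp x = τ + (1 - s3.mem 22) := by
      rw [val_cell] at heq; omega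
    rw [this]
    exact skip_updates s4 k4 (by simp) (by omega)
  rintro s5 ⟨c5, q5, f5, k5, t5⟩
  have ctr5 : IsCounter 0 c s5.mem := fun i => by
    rw [f5 _ (by omega) (fun i => by omega), f4 _ (by omega) (fun i => by omega)]; exact ctr3 i
  refine Runs.seq (incr_runs (by simp) s5 ctr5) ?_
  rintro s6 ⟨-, c6, q6, f6, k6, ⟨z, p6, hz, hz'⟩, t6⟩
  have hm : ∀ a, a ≠ 40 → (∀ i, a ≠ 48 + 3 * i) → (∀ i, a ≠ 48 + 3 * i + 1) →
      s6.mem a = s3.mem a := fun a h1 h2 h3 => by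
    rw [f6 a h1 h2, f5 a h1 h3, f4 a h1 h3]
  have mark6 : ∀ i, s6.mem (48 + 3 * i + 2) = if i = e then 1 else 0 := fun i => by
    rw [hm _ (by omega) (fun i => by omega) (fun i => by omega)]; exact mark3 i
  have low6 : ∀ a < 32, s6.mem a = s3.mem a := fun a ha =>
    hm a (by omega) (fun i => by omega) (fun i => by omega)
  have tal6 : IsCounter 1 (τ + vote E.truth E.hyp x) s6.mem := fun i => by
    rw [f6 _ (by omega) (fun i => by omega)]; exact k5 i
  refine Runs.seq (Runs.instr (Q := fun t => t = Instr.exec E _ s6) rfl) ?_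
  rintro s7 rfl
  have p8 : 48 + 3 * z + 0 + 2 = 48 + 3 * z + 2 := rfl
  have hne : 48 + 3 * z + 2 ≠ 40 := by omega
  rw [hvote]
  refine Runs.instr ⟨⟨?_, ?_, ?_, ?_, ?_, ?_⟩, ?_, ?_, ?_, ?_, ?_⟩
  · have h0 : ∀ a ≤ 5, s6.mem a = s2.mem a := fun a ha =>
      (low6 a (by omega)).trans (m3 a (by omega) (by omega))
    simpa [HasParams, h0] using hp2
  · have h16 : s6.mem 16 = s2.mem 16 := (low6 16 (by simp)).trans (m3 16 (by simp) (by simp))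
    have h17 : s6.mem 17 = s2.mem 17 := (low6 17 (by simp)).trans (m3 17 (by simp) (by simp))
    simpa [Trust, Caught, h16, h17] using tr2
  · have b6 : Bounded 32 (2 * n + 3) s6 := b3.congr low6
    have hb7 : ∀ a < 32, (Instr.exec E (.arith .add (.const 40) (.cell 40) (.const 2)) s6).mem a
        < 2 ^ (2 * n + 3) := fun a ha => by
      simp only [exec_arith_mem, val_const]
      rw [Function.update_of_ne (by omega)]
      exact b6 a ha
    refine Bounded.update hb7 ?_
    simp only [val_const, eval_sub]
    omega
  · intro i
    have := k6 i
    simp only [exec_arith_mem, val_const]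
    rw [Function.update_of_ne (by omega), Function.update_of_ne (by omega)]
    exact this
  · intro i
    have := tal6 i
    simp only [exec_arith_mem, val_const]
    rw [Function.update_of_ne (by omega), Function.update_of_ne (by omega)]
    exact this
  · intro i
    have := mark6 i
    simp only [exec_arith_mem, val_const]
    rw [Function.update_of_ne (by omega), Function.update_of_ne (by omega)]
    exact this
  · simp only [exec_arith_coins]
    omega
  · simp only [exec_arith_truthQueries]
    omega
  · have := carry_eq_iff hz hz' hc
    simp only [exec_arith_mem, val_const, val_cell, val_ind, eval_add, eval_sub,
      Function.update_self, p6, p8]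
    rw [Function.update_of_ne hne, mark6]
    by_cases hze : z = e
    · simp [hze, ← this]
    · simp [hze, ← this]
  · intro a ha ha'
    simp only [exec_arith_mem, val_const]
    rw [Function.update_of_ne (by omega), Function.update_of_ne (by omega),
      hm a (by omega) (fun i => by omega) (fun i => by omega), hi3 a ha]
  · have hmark := mark6 z
    have hm1 : s6.mem (48 + 3 * z + 2) ≤ 1 := by rw [hmark]; split_ifs <;> simp
    have l40 := len_le_succ 40
    have l18 := len_le_succ 18
    have l1 := len_le_succ 1
    have l2 := len_le_succ 2
    have l3 := len_le_succ (48 + 3 * z)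
    have l4 := len_le_succ (48 + 3 * z + 2)
    have l5 := len_le_succ (s6.mem (48 + 3 * z + 2))
    have l6 := len_le_succ (1 - s6.mem (48 + 3 * z + 2))
    simp only [Instr.exec, Operand.cost, val_const, val_cell, val_ind, eval_add, eval_sub,
      Function.update_self, p6, add_zero, Function.update_of_ne hne] at *
    simp only [List.length_cons, List.length_nil] at *
    have hE5 := hE.five_le
    have hX : 2 * n + 3 ≤ (2 * n + 3) * (E.d + 1) := Nat.le_mul_of_pos_right _ (by omega)
    rw [mul_assoc] at t2 ⊢
    generalize (2 * n + 3) * (E.d + 1) = X at *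
    clear hx hvote m3 loc hsel hr
    omega

end Sampling

/-! ### The sampling loop, and reading the real parameters. -/

section Setup

variable {Y : Type*} {E : Env Y} {b : Bool} {n : ℕ} {F : ℕ → ℕ} {s : State Y}

/-- The tally after `c` samples. -/
noncomputable def tally {d : ℕ} (n e : ℕ) (F : ℕ → ℕ) (f : Cube d → Y) (h : Bool → Cube d → Y)
    (toss : ℕ → ℕ) (c : ℕ) : ℕ :=
  2 ^ e + ∑ i ∈ Finset.range c, sampleVote n F f h (toss (i * n))

/-- The potentials telescope over the samples, so only those at the start remain in the time bound.
Each sample tosses exactly `n` coins, so sample `i` uses the block that begins at coin `i * n`. -/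
theorem sample_loop_runs (hE : Reports E b n F) {e : ℕ} (k : ℕ) : ∀ (c : ℕ) (s : State Y),
    c + k = 2 ^ e →
    Sampling E b n e c (tally n e F E.truth E.hyp (E.toss · n) c) s → s.coins = c * n →
    s.mem 18 = (if c = 2 ^ e then 0 else 1) →
    Runs E (.loop (.cell 18) sample) s fun t =>
      Sampling E b n e (2 ^ e) (tally n e F E.truth E.hyp (E.toss · n) (2 ^ e)) t ∧
      t.truthQueries = s.truthQueries + k ∧ (∀ a, 32 ≤ a → a < 40 → t.mem a = s.mem a) ∧
      t.time ≤ s.time + potential 0 c +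
        potential 0 (tally n e F E.truth E.hyp (E.toss · n) c) +
        3100 * (2 * n + 3) * (E.d + 1) * (k + 1) := by
  have h5 := two_pow_five_le hE.five_le
  have h4 := four_mul_two_pow_lt n
  have hB : 1 ≤ 2 * n + 3 := by omega
  have hR : 32 ≤ 2 ^ (2 * n + 3) := by omega
  have hX : 2 * n + 3 ≤ (2 * n + 3) * (E.d + 1) := Nat.le_mul_of_pos_right _ (by omega)
  induction k with
  | zero =>
    intro c s hc h hcoins h18
    rw [add_zero] at hc
    subst hc
    have tt := test_time_le (a := .cell 18) h.bounded (by simp [Operand.Within]) hB hR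
    refine Runs.loop_false (by simpa using h18) ⟨⟨h.params, h.trust, h.bounded, h.counter, h.tally,
      h.mark⟩, rfl, fun _ _ _ => rfl, ?_⟩
    rw [mul_assoc 3100]
    omega
  | succ k ih =>
    intro c s hc h hcoins h18
    have tt := test_time_le (a := .cell 18) h.bounded (by simp [Operand.Within]) hB hR
    have h' : Sampling E b n e c (tally n e F E.truth E.hyp (E.toss · n) c)
        (s.test (.cell 18)) :=
      ⟨h.params, h.trust, h.bounded, h.counter, h.tally, h.mark⟩
    refine Runs.loop_true ?_ (sample_runs hE (by omega) h') ?_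
    · rw [val_cell, h18, if_neg (by omega)]; simp
    rintro t ⟨t1, t2, t3, t4, t5, t6⟩
    have htal : tally n e F E.truth E.hyp (E.toss · n) c +
        sampleVote n F E.truth E.hyp (E.toss (s.test (.cell 18)).coins n) =
        tally n e F E.truth E.hyp (E.toss · n) (c + 1) := by
      rw [tally, tally, Finset.sum_range_succ, test_coins, hcoins, add_assoc]
    rw [htal] at t1 t6
    refine (ih (c + 1) t (by omega) t1 (by rw [t2, test_coins, hcoins]; ring) t4).mono ?_
    rintro u ⟨u1, u2, u3, u4⟩
    refine ⟨u1, by rw [u2, t3, test_truthQueries]; ring,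
      fun a h1 h2 => (u3 a h1 h2).trans (t5 a h1 h2), ?_⟩
    linarith

/-- Find the least `l ≥ 1` with `1 ≤ ε (2 ^ l - 1)`; it goes to cell `26`, and `2 ^ l - 1` to cell
`27`. -/
def findPrecision : Program :=
  .seq (.block [.arith .add (.const 26) (.const 1) (.const 0),
    .arith .add (.const 27) (.const 1) (.const 0),
    .cut .eps (.const 24) (.const 1) (.cell 27), .arith .sub (.const 24) (.const 1) (.cell 24)])
  (.loop (.cell 24) (.block [.arith .mul (.const 27) (.cell 27) (.const 2),
    .arith .add (.const 27) (.cell 27) (.const 1), .arith .add (.const 26) (.cell 26) (.const 1),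
    .cut .eps (.const 24) (.const 1) (.cell 27), .arith .sub (.const 24) (.const 1) (.cell 24)]))

/-- A round costs `4 * B` for the test and `13 * B * 6` for a block of five instructions, hence the
factor `82`. -/
theorem findPrecision_loop_runs {l B : ℕ} (hB : 5 ≤ B) (hlB : l < B)
    (hl : ∀ i, 1 ≤ i → i ≤ l → ((1 : ℝ) ≤ E.eps * ((2 ^ i - 1 : ℕ) : ℝ) ↔ i = l)) (k : ℕ) :
    ∀ (i : ℕ) (s : State Y), i + k = l → 1 ≤ i → Bounded 32 B s → s.mem 26 = i →
    s.mem 27 = 2 ^ i - 1 → s.mem 24 = (if i = l then 0 else 1) →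
    Runs E (.loop (.cell 24) (.block [.arith .mul (.const 27) (.cell 27) (.const 2),
      .arith .add (.const 27) (.cell 27) (.const 1), .arith .add (.const 26) (.cell 26) (.const 1),
      .cut .eps (.const 24) (.const 1) (.cell 27),
      .arith .sub (.const 24) (.const 1) (.cell 24)])) s fun t =>
      t.mem 26 = l ∧ t.mem 27 = 2 ^ l - 1 ∧ Bounded 32 B t ∧ Keeps [24, 26, 27] s t ∧
      t.time ≤ s.time + 82 * B * (k + 1) := by
  have hR : 32 ≤ 2 ^ B := two_pow_five_le hB
  induction k with
  | zero =>
    intro i s hi h1 hs h26 h27 h24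
    rw [add_zero] at hi
    subst hi
    have tt := test_time_le (a := .cell 24) hs (by simp [Operand.Within]) (by omega) hR
    exact Runs.loop_false (by simpa using h24) ⟨h26, h27, hs, ⟨rfl, rfl, fun _ _ => rfl⟩, by omega⟩
  | succ k ih =>
    intro i s hi h1 hs h26 h27 h24
    have tt := test_time_le (a := .cell 24) hs (by simp [Operand.Within]) (by omega) hR
    have h2 : 2 ^ (i + 1) = 2 * 2 ^ i := by ring
    have hp : 1 ≤ 2 ^ i := Nat.one_le_two_pow
    have h2B : 2 ^ (i + 1) < 2 ^ B := Nat.pow_lt_pow_right (by omega) (by omega)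
    have hval : (2 ^ i - 1) * 2 + 1 = 2 ^ (i + 1) - 1 := by omega
    have hlB' : B < 2 ^ B := Nat.lt_two_pow_self
    have hli := hl (i + 1) (by omega) (by omega)
    have w : BlockWithin E 32 B [.arith .mul (.const 27) (.cell 27) (.const 2),
      .arith .add (.const 27) (.cell 27) (.const 1), .arith .add (.const 26) (.cell 26) (.const 1),
      .cut .eps (.const 24) (.const 1) (.cell 27),
      .arith .sub (.const 24) (.const 1) (.cell 24)] (s.test (.cell 24)) := by
      simp [BlockWithin, Instr.Within, Operand.Within, h26, h27]
      omega
    obtain ⟨b1, f1, t1⟩ := w.run (hs.test _) (by omega) hR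
    refine Runs.loop_true (by rw [val_cell, h24, if_neg (by omega)]; simp)
      (Runs.block (Q := fun t => t = run E _ (s.test (.cell 24))) rfl) ?_
    rintro t rfl
    refine (ih (i + 1) _ (by omega) (by omega) b1 (by simp [h26]) ?_ ?_).mono ?_
    · simp only [run_cons, run_nil, exec_arith_mem, exec_cut_mem, test_mem, val_const, val_cell,
        eval_mul, eval_add, eval_sub]
      simp [h27, hval]
    · have hp : E.param .eps = E.eps := rfl
      simp only [run_cons, run_nil, exec_arith_mem, exec_cut_mem, test_mem, val_const, val_cell,
        eval_mul, eval_add, eval_sub]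
      simp only [Function.update_self, ne_eq, Nat.reduceEqDiff, not_false_eq_true,
        Function.update_of_ne, h27, hval, Nat.cast_one, hli, hp]
      split_ifs <;> rfl
    · rintro u ⟨u1, u2, u3, u4, u5⟩
      refine ⟨u1, u2, u3, Keeps.trans ⟨by simp, by simp, fun a ha => ?_⟩ u4, ?_⟩
      · simp only [List.mem_cons, List.not_mem_nil, or_false, not_or] at ha
        simp [ha]
      · simp only [List.length_cons, List.length_nil] at t1
        rw [mul_add _ (k + 1) 1, mul_one]
        omega

theorem findPrecision_runs {l B : ℕ} (hB : 5 ≤ B) (hlB : l < B) (hl1 : 1 ≤ l)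
    (hl : ∀ i, 1 ≤ i → i ≤ l → ((1 : ℝ) ≤ E.eps * ((2 ^ i - 1 : ℕ) : ℝ) ↔ i = l))
    (hs : Bounded 32 B s) :
    Runs E findPrecision s fun t =>
      t.mem 26 = l ∧ t.mem 27 = 2 ^ l - 1 ∧ Bounded 32 B t ∧ Keeps [24, 26, 27] s t ∧
      t.time ≤ s.time + 82 * B * (l + 1) := by
  have hR : 32 ≤ 2 ^ B := two_pow_five_le hB
  have hli := hl 1 le_rfl hl1
  have w : BlockWithin E 32 B [.arith .add (.const 26) (.const 1) (.const 0),
    .arith .add (.const 27) (.const 1) (.const 0),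
    .cut .eps (.const 24) (.const 1) (.cell 27), .arith .sub (.const 24) (.const 1) (.cell 24)]
    s := by
    simp [BlockWithin, Instr.Within, Operand.Within]
    omega
  obtain ⟨b1, f1, t1⟩ := w.run hs (by omega) hR
  refine Runs.seq (Runs.block (Q := fun t => t = run E _ s) rfl) ?_
  rintro t rfl
  refine (findPrecision_loop_runs hB hlB hl (l - 1) 1 _ (by omega) le_rfl b1 (by simp) (by simp)
    ?_).mono ?_
  · have hp : E.param .eps = E.eps := rfl
    simp only [run_cons, run_nil, exec_arith_mem, exec_cut_mem, test_mem, val_const, val_cell,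
      eval_add, eval_sub]
    simp only [Function.update_self, Nat.cast_one, hp, add_zero]
    norm_num at hli
    norm_num
    simp only [hli]
    split_ifs <;> rfl
  · rintro u ⟨u1, u2, u3, u4, u5⟩
    refine ⟨u1, u2, u3, Keeps.trans ⟨by simp, by simp, fun a ha => ?_⟩ u4, ?_⟩
    · simp only [List.mem_cons, List.not_mem_nil, or_false, not_or] at ha
      simp [ha]
    · simp only [List.length_cons, List.length_nil] at t1
      rw [Nat.sub_add_cancel hl1] at u5
      rw [mul_add _ l 1, mul_one]
      omega

/-- Double cell `4` as many times as cell `0` says. -/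
def powerLoop : Program :=
  .loop (.cell 0) (.block [.arith .mul (.const 4) (.cell 4) (.const 2),
    .arith .sub (.const 0) (.cell 0) (.const 1)])

theorem powerLoop_runs {B : ℕ} (hB : 5 ≤ B) (k : ℕ) :
    ∀ (i : ℕ) (s : State Y), i + k < B → Bounded 32 B s → s.mem 0 = k → s.mem 4 = 2 ^ i →
    Runs E powerLoop s fun t =>
      t.mem 4 = 2 ^ (i + k) ∧ Bounded 32 B t ∧ Keeps [0, 4] s t ∧
      t.time ≤ s.time + 43 * B * (k + 1) := by
  have hR : 32 ≤ 2 ^ B := two_pow_five_le hB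
  induction k with
  | zero =>
    intro i s hi hs h0 h4
    have tt := test_time_le (a := .cell 0) hs (by simp [Operand.Within]) (by omega) hR
    exact Runs.loop_false (by simpa using h0) ⟨h4, hs, ⟨rfl, rfl, fun _ _ => rfl⟩, by omega⟩
  | succ k ih =>
    intro i s hi hs h0 h4
    have tt := test_time_le (a := .cell 0) hs (by simp [Operand.Within]) (by omega) hR
    have h2 : 2 ^ (i + 1) = 2 ^ i * 2 := by ring
    have h2B : 2 ^ (i + 1) < 2 ^ B := Nat.pow_lt_pow_right (by omega) (by omega)
    have hlB' : B < 2 ^ B := Nat.lt_two_pow_self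
    have w : BlockWithin E 32 B [.arith .mul (.const 4) (.cell 4) (.const 2),
      .arith .sub (.const 0) (.cell 0) (.const 1)] (s.test (.cell 0)) := by
      simp [BlockWithin, Instr.Within, Operand.Within, h0, h4]
      omega
    obtain ⟨b1, f1, t1⟩ := w.run (hs.test _) (by omega) hR
    refine Runs.loop_true (by rw [val_cell, h0]; omega)
      (Runs.block (Q := fun t => t = run E _ (s.test (.cell 0))) rfl) ?_
    rintro t rfl
    refine (ih (i + 1) _ (by omega) b1 (by simp [h0]) (by simp [h4, h2])).mono ?_
    rintro u ⟨u2, u3, u4, u5⟩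
    refine ⟨by rw [u2]; congr 1; ring, u3, Keeps.trans ⟨by simp, by simp, fun a ha => ?_⟩ u4, ?_⟩
    · simp only [List.mem_cons, List.not_mem_nil, or_false, not_or] at ha
      simp [ha]
    · simp only [List.length_cons, List.length_nil] at t1
      rw [mul_add _ (k + 1) 1, mul_one]
      omega

/-- Find the least `j` with `1 ≤ β 2 ^ (2 ^ j)`; it goes to cell `33`. -/
def findConfidence : Program :=
  .seq (.block [.arith .add (.const 32) (.const 2) (.const 0),
    .cut .beta (.const 24) (.const 1) (.cell 32), .arith .sub (.const 24) (.const 1) (.cell 24)])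
  (.loop (.cell 24) (.block [.arith .mul (.const 32) (.cell 32) (.cell 32),
    .arith .add (.const 33) (.cell 33) (.const 1),
    .cut .beta (.const 24) (.const 1) (.cell 32), .arith .sub (.const 24) (.const 1) (.cell 24)]))

/-- Repeated squaring reads `β` in `j` rounds, and round `i` costs at most `69 * (B + 2 ^ (i + 2))`.
The sum is geometric, of order `2 ^ j`; the term `69 * 2 ^ (i + 2)` on the left makes it telescope.
Cell `32` is exempt from the bound `2 ^ B` because the squares outgrow it. -/
theorem findConfidence_loop_runs {j B : ℕ} (hB : 6 ≤ B)
    (hj : ∀ i, i ≤ j → ((1 : ℝ) ≤ E.beta * ((2 ^ 2 ^ i : ℕ) : ℝ) ↔ i = j)) (k : ℕ) :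
    ∀ (i : ℕ) (s : State Y), i + k = j → (∀ a < 40, a ≠ 32 → a ≠ 33 → s.mem a < 2 ^ B) →
    s.mem 32 = 2 ^ 2 ^ i → s.mem 33 = i → s.mem 24 = (if i = j then 0 else 1) →
    Runs E (.loop (.cell 24) (.block [.arith .mul (.const 32) (.cell 32) (.cell 32),
      .arith .add (.const 33) (.cell 33) (.const 1),
      .cut .beta (.const 24) (.const 1) (.cell 32),
      .arith .sub (.const 24) (.const 1) (.cell 24)])) s fun t =>
      t.mem 32 = 2 ^ 2 ^ j ∧ t.mem 33 = j ∧ t.mem 24 = 0 ∧ Keeps [24, 32, 33] s t ∧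
      t.time + 69 * 2 ^ (i + 2) ≤ s.time + 69 * B * (k + 1) + 70 * 2 ^ (j + 2) := by
  have hR : 40 ≤ 2 ^ B :=
    (by norm_num : 40 ≤ 2 ^ 6).trans (Nat.pow_le_pow_right (by omega) hB)
  induction k with
  | zero =>
    intro i s hi hs h32 h33 h24
    rw [add_zero] at hi
    subst hi
    rw [if_pos rfl] at h24
    refine Runs.loop_false h24 ⟨h32, h33, h24, ⟨rfl, rfl, fun _ _ => rfl⟩, ?_⟩
    have := len_le (by omega) (hs 24 (by simp) (by simp) (by simp))
    have := len_le_succ 24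
    simp only [test_time, Operand.cost]
    omega
  | succ k ih =>
    intro i s hi hs h32 h33 h24
    have hpow : 2 ^ (i + 1) = 2 * 2 ^ i := by ring
    have hpow' : 2 ^ (i + 2) = 4 * 2 ^ i := by ring
    have hpow3 : 2 ^ (i + 1 + 2) = 8 * 2 ^ i := by ring
    have hli := hj (i + 1) (by omega)
    have hii : i < 2 ^ i := Nat.lt_two_pow_self
    have hB' : B ≤ B + 2 ^ (i + 2) := by omega
    have hmono : 2 ^ B ≤ 2 ^ (B + 2 ^ (i + 2)) := Nat.pow_le_pow_right (by omega) hB'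
    have hlin : i + 1 < 2 ^ (B + 2 ^ (i + 2)) :=
      lt_of_lt_of_le (by omega : i + 1 < B + 2 ^ (i + 2)) Nat.lt_two_pow_self.le
    have hsq : 2 ^ 2 ^ i * 2 ^ 2 ^ i = 2 ^ 2 ^ (i + 1) := by rw [← pow_add]; congr 1; ring
    have hsq' : 2 ^ 2 ^ (i + 1) < 2 ^ (B + 2 ^ (i + 2)) :=
      Nat.pow_lt_pow_right (by omega) (by omega)
    have hsq'' : 2 ^ 2 ^ i < 2 ^ (B + 2 ^ (i + 2)) :=
      Nat.pow_lt_pow_right (by omega) (by omega)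
    have hbd : Bounded 40 (B + 2 ^ (i + 2)) s := by
      intro a ha
      by_cases h1 : a = 32
      · rw [h1, h32]; exact hsq''
      · by_cases h2 : a = 33
        · rw [h2, h33]; omega
        · exact (hs a ha h1 h2).trans_le hmono
    have tt := test_time_le (a := .cell 24) hbd (by simp [Operand.Within]) (by omega) (by omega)
    have hz : ∀ z, 1 - z < 2 ^ (B + 2 ^ (i + 2)) := fun z => by omega
    have w : BlockWithin E 40 (B + 2 ^ (i + 2)) [.arith .mul (.const 32) (.cell 32) (.cell 32),
      .arith .add (.const 33) (.cell 33) (.const 1),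
      .cut .beta (.const 24) (.const 1) (.cell 32),
      .arith .sub (.const 24) (.const 1) (.cell 24)] (s.test (.cell 24)) := by
      simp only [BlockWithin, Instr.Within, Operand.Within, exec_arith_mem, exec_cut_mem, test_mem,
        val_const, val_cell, eval_mul, eval_add, eval_sub]
      simp only [Function.update_self, ne_eq, Nat.reduceEqDiff, not_false_eq_true,
        Function.update_of_ne, h32, h33, hsq, hz, and_true]
      omega
    obtain ⟨b1, f1, t1⟩ := w.run (hbd.test _) (by omega) (by omega)
    refine Runs.loop_true (by rw [val_cell, h24, if_neg (by omega)]; simp)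
      (Runs.block (Q := fun t => t = run E _ (s.test (.cell 24))) rfl) ?_
    rintro t rfl
    refine (ih (i + 1) _ (by omega) (fun a h1 h2 h3 => ?_) ?_ (by simp [h33]) ?_).mono ?_
    · simp only [run_cons, run_nil, exec_arith_mem, exec_cut_mem, test_mem, val_const, val_cell,
        eval_mul, eval_add, eval_sub, Function.update_apply]
      simp only [h2, h3, if_false]
      split_ifs <;> first | exact hs a h1 h2 h3 | omega
    · simp only [run_cons, run_nil, exec_arith_mem, exec_cut_mem, test_mem, val_const, val_cell,
        eval_mul, eval_add, eval_sub]
      simp only [Function.update_self, ne_eq, Nat.reduceEqDiff, not_false_eq_true,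
        Function.update_of_ne, h32, hsq]
    · have hp : E.param .beta = E.beta := rfl
      simp only [run_cons, run_nil, exec_arith_mem, exec_cut_mem, test_mem, val_const, val_cell,
        eval_mul, eval_add, eval_sub]
      simp only [Function.update_self, ne_eq, Nat.reduceEqDiff, not_false_eq_true,
        Function.update_of_ne, h32, hsq, Nat.cast_one, hli, hp]
      split_ifs <;> rfl
    · rintro u ⟨u1, u2, u3, u4, u5⟩
      refine ⟨u1, u2, u3, Keeps.trans ⟨by simp, by simp, fun a ha => ?_⟩ u4, ?_⟩
      · simp only [List.mem_cons, List.not_mem_nil, or_false, not_or] at ha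
        simp [ha]
      · simp only [List.length_cons, List.length_nil] at t1
        rw [mul_add _ (k + 1) 1, mul_one]
        omega

end Setup

/-! ### Preparation of the main loop. -/

section Verifier

variable {Y : Type*} {E : Env Y} {b : Bool} {n : ℕ} {F : ℕ → ℕ} {s : State Y}

theorem findConfidence_runs {j B : ℕ} (hB : 6 ≤ B)
    (hj : ∀ i, i ≤ j → ((1 : ℝ) ≤ E.beta * ((2 ^ 2 ^ i : ℕ) : ℝ) ↔ i = j))
    (hs : Bounded 40 B s) (h33 : s.mem 33 = 0) :
    Runs E findConfidence s fun t =>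
      t.mem 32 = 2 ^ 2 ^ j ∧ t.mem 33 = j ∧ t.mem 24 = 0 ∧ Keeps [24, 32, 33] s t ∧
      t.time ≤ s.time + 69 * B * (j + 2) + 70 * 2 ^ (j + 2) := by
  have hR : 40 ≤ 2 ^ B :=
    (by norm_num : 40 ≤ 2 ^ 6).trans (Nat.pow_le_pow_right (by omega) hB)
  have hz : ∀ z, 1 - z < 2 ^ B := fun z => by omega
  have w : BlockWithin E 40 B [.arith .add (.const 32) (.const 2) (.const 0),
    .cut .beta (.const 24) (.const 1) (.cell 32), .arith .sub (.const 24) (.const 1) (.cell 24)]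
    s := by
    simp only [BlockWithin, Instr.Within, Operand.Within, exec_arith_mem, exec_cut_mem, val_const,
      val_cell, eval_add, eval_sub, hz, and_true]
    omega
  have hji := hj 0 (by omega)
  obtain ⟨b1, f1, t1⟩ := w.run hs (by omega) hR
  refine Runs.seq (Runs.block (Q := fun t => t = run E _ s) rfl) ?_
  rintro t rfl
  refine (findConfidence_loop_runs hB hj j 0 _ (by omega) (fun a h1 h2 h3 => b1 a h1) (by simp)
    (by simp [h33]) ?_).mono ?_
  · have hp : E.param .beta = E.beta := rfl
    simp only [run_cons, run_nil, exec_arith_mem, exec_cut_mem, test_mem, val_const, val_cell,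
      eval_add, eval_sub]
    simp only [Function.update_self, Nat.cast_one, hp, add_zero]
    norm_num at hji
    norm_num
    simp only [hji]
    split_ifs <;> rfl
  · rintro u ⟨u1, u2, u3, u4, u5⟩
    refine ⟨u1, u2, u3, Keeps.trans ⟨by simp, by simp, fun a ha => ?_⟩ u4, ?_⟩
    · simp only [List.mem_cons, List.not_mem_nil, or_false, not_or] at ha
      simp [ha]
    · simp only [List.length_cons, List.length_nil] at t1
      have : 69 * B * (j + 2) = 69 * B * (j + 1) + 69 * B := by ring
      omega

/-- Initialise the counters of the main loop, whose number of samples has the exponent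
`M[33] + 2 * M[26] + 5`, and leave the address of the decisive digit of the tally in cell `33`. -/
def setCounters : List Instr :=
  [.arith .add (.const 33) (.cell 33) (.cell 26),
    .arith .add (.const 33) (.cell 33) (.cell 26), .arith .add (.const 33) (.cell 33) (.const 5),
    .arith .mul (.const 33) (.cell 33) (.const 3), .arith .add (.const 33) (.cell 33) (.const 49),
    .arith .add (.cell 33) (.const 1) (.const 0), .arith .add (.const 34) (.cell 33) (.const 1),
    .arith .add (.cell 34) (.const 1) (.const 0), .arith .add (.const 33) (.cell 33) (.const 3),
    .arith .add (.const 16) (.const 14) (.const 0), .arith .add (.const 17) (.const 15) (.const 0),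
    .arith .add (.const 18) (.const 1) (.const 0)]

/-- Compute the parameters of the main loop. -/
def prepare (lam : ℕ) : Program :=
  .seq findPrecision
  (.seq (.block [.arith .add (.const 1) (.cell 0) (.cell 26),
    .arith .add (.const 1) (.cell 1) (.const (lam + 4)),
    .arith .add (.const 27) (.cell 27) (.const 1), .arith .add (.const 4) (.const 1) (.const 0)])
  (.seq powerLoop
  (.seq (.block [.arith .mul (.const 2) (.cell 4) (.cell 27),
    .arith .mul (.const 2) (.cell 2) (.const (2 ^ (lam + 4))),
    .arith .sub (.const 3) (.cell 2) (.const 1), .arith .div (.const 5) (.cell 4) (.const 2)])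
  (.seq findConfidence
  (.block setCounters)))))

/-- With `e = 2 * l + j + 5`, the tally starts at `2 ^ e` instead of zero, so that the final
comparison of the votes with `2 ^ e` becomes the inspection of the single digit `e + 1`, whose
address is left in cell `33`. -/
theorem prepare_runs {lam l j : ℕ} (b : Bool) (hn : n = E.d + l + lam + 4) (hl1 : 1 ≤ l)
    (hl : ∀ i, 1 ≤ i → i ≤ l → ((1 : ℝ) ≤ E.eps * ((2 ^ i - 1 : ℕ) : ℝ) ↔ i = l))
    (hj : ∀ i, i ≤ j → ((1 : ℝ) ≤ E.beta * ((2 ^ 2 ^ i : ℕ) : ℝ) ↔ i = j))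
    (h0 : s.mem 0 = E.d) (h24 : s.mem 24 ≤ 1) (hz : ∀ a, a ≠ 0 → a ≠ 24 → s.mem a = 0) :
    Runs E (prepare lam) s fun t =>
      Sampling E b n (2 * l + j + 5) 0 (2 ^ (2 * l + j + 5)) t ∧ t.coins = s.coins ∧
      t.truthQueries = s.truthQueries ∧ t.mem 18 = 1 ∧
      t.mem 33 = 48 + 3 * (2 * l + j + 6) + 1 ∧
      t.time ≤ s.time + 2000 * (2 * n + 3) * (E.d + l + j + 1) + 2000 * 2 ^ j := by
  obtain ⟨B, hBn⟩ : ∃ B, B = 2 * n + 3 := ⟨_, rfl⟩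
  rw [← hBn]
  have hBB : B < 2 ^ B := Nat.lt_two_pow_self
  have hR : 64 ≤ 2 ^ B :=
    (by norm_num : 64 ≤ 2 ^ 6).trans (Nat.pow_le_pow_right (by omega) (by omega))
  have hs : Bounded 32 B s := by
    intro a ha
    by_cases h1 : a = 0
    · rw [h1, h0]; omega
    · by_cases h2 : a = 24
      · rw [h2]; omega
      · rw [hz a h1 h2]; omega
  refine Runs.seq (findPrecision_runs (by omega) (by omega) hl1 hl hs) ?_
  rintro s1 ⟨h26, h27, b1, k1, t1⟩
  have h01 : s1.mem 0 = E.d := by rw [k1.2.2 0 (by simp), h0]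
  have hpl : 1 ≤ 2 ^ l := Nat.one_le_two_pow
  have hplB : 2 ^ l < 2 ^ B := Nat.pow_lt_pow_right (by omega) (by omega)
  have hsub : 2 ^ l - 1 + 1 = 2 ^ l := by omega
  have w2 : BlockWithin E 32 B [.arith .add (.const 1) (.cell 0) (.cell 26),
      .arith .add (.const 1) (.cell 1) (.const (lam + 4)),
      .arith .add (.const 27) (.cell 27) (.const 1), .arith .add (.const 4) (.const 1) (.const 0)]
      s1 := by
    simp [BlockWithin, Instr.Within, Operand.Within, h01, h26, h27]
    omega
  obtain ⟨b2, f2, t2⟩ := w2.run b1 (by omega) (by omega)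
  refine Runs.seq (Runs.block (Q := fun t => t = run E _ s1) rfl) ?_
  rintro s2 rfl
  generalize hs2 : run E _ s1 = s2 at *
  have g1 : s2.mem 1 = n := by simp [← hs2, h01, h26]; omega
  have g27 : s2.mem 27 = 2 ^ l := by simp [← hs2, h27, hsub]
  have g26 : s2.mem 26 = l := by simp [← hs2, h26]
  have g4 : s2.mem 4 = 2 ^ 0 := by simp [← hs2]
  have g0 : s2.mem 0 = E.d := by simp [← hs2, h01]
  have k2 : Keeps [1, 27, 4] s1 s2 := by
    refine ⟨by simp [← hs2], by simp [← hs2], fun a ha => ?_⟩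
    simp only [List.mem_cons, List.not_mem_nil, or_false, not_or] at ha
    simp [← hs2, ha]
  clear hs2 w2
  refine Runs.seq (powerLoop_runs (by omega) E.d 0 s2 (by omega) b2 g0 g4) ?_
  rintro s3 ⟨h4, b3, k3, t3⟩
  rw [zero_add] at h4
  have g1 : s3.mem 1 = n := by rw [k3.2.2 1 (by simp), g1]
  have g27 : s3.mem 27 = 2 ^ l := by rw [k3.2.2 27 (by simp), g27]
  have g26 : s3.mem 26 = l := by rw [k3.2.2 26 (by simp), g26]
  have hdl : 2 ^ E.d * 2 ^ l = 2 ^ (E.d + l) := by rw [pow_add]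
  have hdl' : 2 ^ (E.d + l) * 2 ^ (lam + 4) = 2 ^ n := by rw [← pow_add, hn]; congr 1
  have hdlB : 2 ^ (E.d + l) < 2 ^ B := Nat.pow_lt_pow_right (by omega) (by omega)
  have hdB : 2 ^ E.d < 2 ^ B := Nat.pow_lt_pow_right (by omega) (by omega)
  have hlamB : 2 ^ (lam + 4) < 2 ^ B := Nat.pow_lt_pow_right (by omega) (by omega)
  have hnB : 2 ^ n < 2 ^ B := Nat.pow_lt_pow_right (by omega) (by omega)
  have w4 : BlockWithin E 32 B [.arith .mul (.const 2) (.cell 4) (.cell 27),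
      .arith .mul (.const 2) (.cell 2) (.const (2 ^ (lam + 4))),
      .arith .sub (.const 3) (.cell 2) (.const 1), .arith .div (.const 5) (.cell 4) (.const 2)]
      s3 := by
    simp [BlockWithin, Instr.Within, Operand.Within, h4, g27, hdl, hdl']
    omega
  obtain ⟨b4, f4, t4⟩ := w4.run b3 (by omega) (by omega)
  refine Runs.seq (Runs.block (Q := fun t => t = run E _ s3) rfl) ?_
  rintro s4 rfl
  generalize hs4 : run E _ s3 = s4 at *
  have p4 : HasParams n E.d s4.mem := by
    refine ⟨?_, ?_, ?_, ?_, ?_⟩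
    · simp [← hs4, g1]
    · simp [← hs4, h4, g27, hdl, hdl']
    · simp [← hs4, h4, g27, hdl, hdl']
    · simp [← hs4, h4]
    · simp [← hs4, h4]
  have g26 : s4.mem 26 = l := by simp [← hs4, g26]
  have k4 : Keeps [2, 3, 5] s3 s4 := by
    refine ⟨by simp [← hs4], by simp [← hs4], fun a ha => ?_⟩
    simp only [List.mem_cons, List.not_mem_nil, or_false, not_or] at ha
    simp [← hs4, ha]
  clear hs4 w4
  have kk : Keeps [0, 1, 2, 3, 4, 5, 24, 26, 27] s s4 :=
    (k1.mono (by simp)).trans ((k2.mono (by simp)).trans ((k3.mono (by simp)).trans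
      (k4.mono (by simp))))
  have z4 : ∀ a, 32 ≤ a → s4.mem a = 0 := fun a ha => by
    rw [kk.2.2 a (by simp; omega), hz a (by omega) (by omega)]
  have b4' : Bounded 40 B s4 := fun a ha => by
    by_cases h : a < 32
    · exact b4 a h
    · rw [z4 a (by omega)]; omega
  refine Runs.seq (findConfidence_runs (by omega) hj b4' (z4 33 (by simp))) ?_
  rintro s5 ⟨h32, h33, h24', k5, t5⟩
  have hjj : j < 2 ^ j := Nat.lt_two_pow_self
  have hj2 : 2 ^ (j + 2) = 4 * 2 ^ j := by ring
  -- Cell `32` still contains `2 ^ 2 ^ j`, and the next block writes to cells whose addresses grow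
  -- with `l` and `j`. This block alone is therefore analysed with the larger length `C` and range
  -- `R`.
  obtain ⟨C, hC⟩ : ∃ C, C = B + 2 ^ (j + 2) + 6 * l + 3 * j + 80 := ⟨_, rfl⟩
  obtain ⟨R, hRR⟩ : ∃ R, R = 6 * l + 3 * j + 80 := ⟨_, rfl⟩
  have hCC : C < 2 ^ C := Nat.lt_two_pow_self
  have hBC : 2 ^ B ≤ 2 ^ C := Nat.pow_le_pow_right (by omega) (by omega)
  have b5 : Bounded R C s5 := by
    intro a ha
    by_cases h1 : a = 24
    · rw [h1, h24']; omega
    by_cases h2 : a = 32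
    · rw [h2, h32]; exact Nat.pow_lt_pow_right (by omega) (by omega)
    by_cases h3 : a = 33
    · rw [h3, h33]; omega
    rw [k5.2.2 a (by simp [h1, h2, h3])]
    by_cases h4 : a < 32
    · exact (b4 a h4).trans_le hBC
    · rw [z4 a (by omega)]; omega
  have g26 : s5.mem 26 = l := by rw [k5.2.2 26 (by simp), g26]
  have z5 : ∀ a, 34 ≤ a → s5.mem a = 0 := fun a ha => by
    rw [k5.2.2 a (by simp; omega), z4 a (by omega)]
  have p5 : HasParams n E.d s5.mem := p4.of_keeps k5 (by simp)
  have b5' : Bounded 32 B s5 := fun a ha => by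
    by_cases h1 : a = 24
    · rw [h1, h24']; omega
    · rw [k5.2.2 a (by simp; omega)]; exact b4 a ha
  -- The address of digit `2 * l + j + 5` of the tally; the mark of the same digit is at `q + 1`.
  obtain ⟨q, hq⟩ : ∃ q, q = (j + l + l + 5) * 3 + 49 := ⟨_, rfl⟩
  have e1 : 33 ≠ q := by omega
  have e1' : q ≠ 33 := by omega
  have e2 : 34 ≠ q := by omega
  have e3 : 33 ≠ q + 1 := by omega
  have e4 : 34 ≠ q + 1 := by omega
  have w6 : BlockWithin E R C setCounters s5 := by
    simp [setCounters, BlockWithin, Instr.Within, Operand.Within, h33, g26, ← hq,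
      Function.update_of_ne e1, Function.update_of_ne e3]
    omega
  obtain ⟨b6, f6, t6⟩ := w6.run b5 (by omega) (by omega)
  have m6 : (run E setCounters s5).mem 16 = 14 ∧ (run E setCounters s5).mem 17 = 15 ∧
      (run E setCounters s5).mem 18 = 1 ∧ (run E setCounters s5).mem 33 = q + 3 := by
    simp [setCounters, h33, g26, ← hq, Function.update_of_ne e1, Function.update_of_ne e3]
  have m6q : (run E setCounters s5).mem q = 1 := by
    simp only [setCounters, run_cons, run_nil, test_mem, exec_arith_mem, val_const, val_cell,
      eval_add, eval_mul, Function.update_self, add_zero, h33, ne_eq,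
      Nat.reduceEqDiff, not_false_eq_true, Function.update_of_ne, g26, ← hq,
      Function.update_of_ne e1, Function.update_of_ne e3, Function.update_apply]
    repeat rw [if_neg (by omega)]
  have m6q' : (run E setCounters s5).mem (q + 1) = 1 := by
    simp only [setCounters, run_cons, run_nil, test_mem, exec_arith_mem, val_const, val_cell,
      eval_add, eval_mul, Function.update_self, add_zero, h33, ne_eq,
      Nat.reduceEqDiff, not_false_eq_true, Function.update_of_ne, g26, ← hq,
      Function.update_of_ne e1, Function.update_of_ne e3, Function.update_apply]
    repeat rw [if_neg (by omega)]
  have m6' : ∀ a, a ∉ [16, 17, 18, 33, 34, q, q + 1] →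
      (run E setCounters s5).mem a = s5.mem a := by
    intro a ha
    simp only [List.mem_cons, List.not_mem_nil, or_false, not_or] at ha
    simp [setCounters, h33, g26, ← hq, Function.update_of_ne e1, Function.update_of_ne e3, ha]
  have c6 : (run E setCounters s5).coins = s5.coins := by simp [setCounters]
  have q6 : (run E setCounters s5).truthQueries = s5.truthQueries := by simp [setCounters]
  generalize hrun : run E setCounters s5 = s6 at *
  obtain ⟨m16, m17, m18, m33⟩ := m6
  clear w6
  refine Runs.block ?_
  rw [hrun]
  refine ⟨⟨?_, .inl ⟨m16, m17⟩, ?_, ?_, ?_, ?_⟩, ?_, ?_, m18, by omega, ?_⟩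
  · have : ∀ a ≤ 5, s6.mem a = s5.mem a := fun a ha => m6' a (by simp; omega)
    simpa [HasParams, this] using p5
  · rw [← hBn]
    intro a ha
    by_cases h1 : a = 16
    · rw [h1, m16]; omega
    by_cases h2 : a = 17
    · rw [h2, m17]; omega
    by_cases h3 : a = 18
    · rw [h3, m18]; omega
    rw [m6' a (by simp; omega)]
    exact b5' a ha
  · intro i
    rw [m6' _ (by simp; omega), z5 _ (by omega)]
    simp
  · intro i
    rw [Nat.testBit_two_pow]
    by_cases hi : i = 2 * l + j + 5
    · rw [show 48 + 3 * i + 1 = q by omega, m6q]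
      simp [hi]
    · rw [m6' _ (by simp; omega), z5 _ (by omega)]
      simp [Ne.symm hi]
  · intro i
    by_cases hi : i = 2 * l + j + 5
    · rw [show 48 + 3 * i + 2 = q + 1 by omega, m6q']
      simp [hi]
    · rw [m6' _ (by simp; omega), z5 _ (by omega)]
      simp [hi]
  · rw [c6, k5.1, kk.1]
  · rw [q6, k5.2.1, kk.2.1]
  · simp only [List.length_cons, List.length_nil, setCounters] at t2 t4 t6
    have hBl : 13 * l ≤ B * l := Nat.mul_le_mul_right _ (by omega)
    have hBj : 13 * j ≤ B * j := Nat.mul_le_mul_right _ (by omega)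
    have hB13 : 13 ≤ B := by omega
    have hBd := Nat.zero_le (B * E.d)
    rw [hC] at t6
    rw [hj2] at t5 t6
    linarith

end Verifier

/-! ### Complete runs of the verifier. -/

section Execution

variable {Y : Type*} {E : Env Y} {b : Bool} {n : ℕ} {F : ℕ → ℕ}

/-- The verifier for `lam`-precise distributions. -/
def verifier (lam : ℕ) : Program :=
  .seq (.instr (.cut .beta (.const 24) (.const 1) (.const 2)))
  (.ite (.cell 24) (.instr (.coin (.const 0) (.const 1)))
    (.seq (prepare lam) (.seq (.loop (.cell 18) sample)
      (.instr (.arith .add (.const 0) (.ind 33) (.const 0))))))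

theorem vote_le {X : Type*} (f : X → Y) (h : Bool → X → Y) (x : X) : vote f h x ≤ 2 := by
  unfold vote; split_ifs <;> simp

theorem tally_le {d : ℕ} (n e : ℕ) (F : ℕ → ℕ) (f : Cube d → Y) (h : Bool → Cube d → Y)
    (toss : ℕ → ℕ) (c : ℕ) : tally n e F f h toss c ≤ 2 ^ e + 2 * c := by
  rw [tally]
  have := Finset.sum_le_card_nsmul (Finset.range c)
    (fun i => sampleVote n F f h (toss (i * n))) 2 (fun i _ => vote_le _ _ _)
  simp at this
  omega

/-- The tally is at most `3 * 2 ^ e`, so its digit `e + 1` alone decides the majority. -/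
theorem testBit_toNat_ne_zero {t e : ℕ} (h : t < 2 ^ (e + 2)) :
    (t.testBit (e + 1)).toNat ≠ 0 ↔ 2 ^ (e + 1) ≤ t := by
  have h2 : 2 ^ (e + 2) = 2 * 2 ^ (e + 1) := by ring
  constructor
  · intro hb
    by_contra hlt
    rw [Nat.testBit_lt_two_pow (by omega)] at hb
    simp at hb
  · intro hle
    rw [Nat.testBit_eq_decide_div_mod_eq]
    have : t / 2 ^ (e + 1) = 1 := by
      rw [Nat.div_eq_iff (by positivity)]; omega
    simp [this]

theorem verifier_runs_of_one_le (lam : ℕ) (h : 1 ≤ E.beta * 2) :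
    Runs E (verifier lam) (State.init Y E.d) fun t =>
      t.output = decide (E.toss 0 1 ≠ 0) ∧ t.truthQueries = 0 ∧ t.time ≤ 100 := by
  have hp : E.param .beta = E.beta := rfl
  refine Runs.seq (Runs.instr (Q := fun t => t = Instr.exec E _ (State.init Y E.d)) rfl) ?_
  rintro t rfl
  have h24 : (Instr.exec E (.cut .beta (.const 24) (.const 1) (.const 2))
      (State.init Y E.d)).mem 24 = 1 := by
    simp [hp, h]
  refine Runs.ite (fun hne => ?_) (fun heq => ?_)
  · refine Runs.instr ⟨?_, ?_, ?_⟩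
    · simp [State.output, State.init]
    · simp [State.init]
    · have l0 := len_le_succ 0
      have l1 := len_le_succ 1
      have l2 := len_le_succ 2
      have l24 : len 24 ≤ 5 := len_le (by simp) (by simp)
      have ht : (Instr.exec E (.cut .beta (.const 24) (.const 1) (.const 2))
        (State.init Y E.d)).time = 0 + 1 + len 24 + len 1 + len 2 := rfl
      have ht' : ∀ s : State Y, (Instr.exec E (.coin (.const 0) (.const 1)) s).time =
        s.time + 1 + len 0 + len 1 + 1 := fun _ => rfl
      rw [ht', test_time, ht]
      simp only [Operand.cost, h24]
      omega
  · rw [val_cell, h24] at heq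
    omega

theorem verifier_runs (hE : Reports E b n F) {lam l j : ℕ} (hβ : ¬ 1 ≤ E.beta * 2)
    (hn : n = E.d + l + lam + 4) (hl1 : 1 ≤ l)
    (hl : ∀ i, 1 ≤ i → i ≤ l → ((1 : ℝ) ≤ E.eps * ((2 ^ i - 1 : ℕ) : ℝ) ↔ i = l))
    (hj : ∀ i, i ≤ j → ((1 : ℝ) ≤ E.beta * ((2 ^ 2 ^ i : ℕ) : ℝ) ↔ i = j)) :
    Runs E (verifier lam) (State.init Y E.d) fun t =>
      t.output = decide (2 * 2 ^ (2 * l + j + 5) ≤ tally n (2 * l + j + 5) F E.truth E.hyp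
        (E.toss · n) (2 ^ (2 * l + j + 5))) ∧ t.truthQueries = 2 ^ (2 * l + j + 5) ∧
      t.time ≤ 20000 * (2 * n + 3) * (E.d + 1) * 2 ^ (2 * l + j + 5) := by
  have hp : E.param .beta = E.beta := rfl
  refine Runs.seq (Runs.instr (Q := fun t => t = Instr.exec E _ (State.init Y E.d)) rfl) ?_
  rintro s1 rfl
  have m1 : (Instr.exec E (.cut .beta (.const 24) (.const 1) (.const 2)) (State.init Y E.d)).mem =
      Function.update (fun i => if i = 0 then E.d else 0) 24 0 := by
    simp [hp, hβ, State.init]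
  have ht1 : (Instr.exec E (.cut .beta (.const 24) (.const 1) (.const 2))
      (State.init Y E.d)).time = 0 + 1 + len 24 + len 1 + len 2 := rfl
  have hc1 : (Instr.exec E (.cut .beta (.const 24) (.const 1) (.const 2))
      (State.init Y E.d)).coins = 0 := rfl
  have hq1 : (Instr.exec E (.cut .beta (.const 24) (.const 1) (.const 2))
      (State.init Y E.d)).truthQueries = 0 := rfl
  generalize Instr.exec E (.cut .beta (.const 24) (.const 1) (.const 2)) (State.init Y E.d) = s1
    at *
  refine Runs.ite (fun hne => absurd ?_ hne) (fun heq => ?_)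
  · simp [m1]
  have l1 := len_le_succ 1
  have l2 := len_le_succ 2
  have l24 : len 24 ≤ 5 := len_le (by simp) (by simp)
  have ht2 : (s1.test (.cell 24)).time ≤ 100 := by
    have l0 := len_le_succ 0
    have : s1.mem 24 = 0 := heq
    rw [test_time, ht1]
    simp only [Operand.cost, this]
    omega
  refine Runs.seq (prepare_runs b hn hl1 hl hj (by simp [m1]) (by simp [m1]) ?_) ?_
  · intro a h1 h2
    simp [m1, h1, h2]
  rintro s2 ⟨k1, k2, k3, k4, k5, k6⟩
  generalize he : 2 * l + j + 5 = e at *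
  have tal0 : tally n e F E.truth E.hyp (E.toss · n) 0 = 2 ^ e := by simp [tally]
  have hpos : 0 < 2 ^ e := by positivity
  refine Runs.seq (sample_loop_runs hE (e := e) (2 ^ e) 0 s2 (by omega) (by rwa [tal0])
    (by rw [k2, test_coins, hc1, zero_mul]) (by rw [k4, if_neg (by omega)])) ?_
  rintro s3 ⟨p1, p2, p3, p4⟩
  have h33 : s3.mem 33 = 48 + 3 * (e + 1) + 1 := by
    rw [p3 33 (by simp) (by simp), k5]
    omega
  have hdig := p1.tally (e + 1)
  have htl := tally_le n e F E.truth E.hyp (E.toss · n) (2 ^ e)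
  have hp4 : 2 ^ (e + 2) = 4 * 2 ^ e := by ring
  have hp2 : 2 ^ (e + 1) = 2 * 2 ^ e := by ring
  have hbit := testBit_toNat_ne_zero (t := tally n e F E.truth E.hyp (E.toss · n) (2 ^ e))
    (e := e) (by omega)
  refine Runs.instr ⟨?_, ?_, ?_⟩
  · simp only [State.output, exec_arith_mem, val_const, val_ind, eval_add, add_zero,
      Function.update_self, h33, hdig, hbit, hp2]
  · rw [exec_arith_truthQueries, p2, k3, test_truthQueries, hq1, zero_add]
  · have hpj : 2 ^ j ≤ 2 ^ e := Nat.pow_le_pow_right (by omega) (by omega)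
    have hee : e < 2 ^ e := Nat.lt_two_pow_self
    have hb1 : s3.mem (48 + 3 * (e + 1) + 1) ≤ 1 := by
      rw [hdig]; exact Bool.toNat_le _
    have l0 := len_le_succ 0
    have l33 := len_le_succ 33
    have lp := len_le_succ (48 + 3 * (e + 1) + 1)
    have lb := len_le_succ (s3.mem (48 + 3 * (e + 1) + 1))
    have ht3 : (Instr.exec E (.arith .add (.const 0) (.ind 33) (.const 0)) s3).time = s3.time + 1 +
        len 0 + (len 33 + len (s3.mem 33) + len (s3.mem (s3.mem 33))) + len 0 +
        len (s3.mem (s3.mem 33)) := rfl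
    rw [ht3, h33]
    rw [tal0, potential_zero, potential_two_pow] at p4
    -- The preparation is dominated by the samples, since `e + 1 ≤ 2 ^ e` and `e` is larger than `l
    -- + j`.
    have hX1 : (2 * n + 3) * (E.d + l + j + 1) ≤ (2 * n + 3) * (E.d + 1) * 2 ^ e := by
      rw [mul_assoc]
      refine Nat.mul_le_mul_left _ ?_
      have : E.d + l + j + 1 ≤ (E.d + 1) * (e + 1) := by
        have : (E.d + 1) * (e + 1) = E.d * e + E.d + e + 1 := by ring
        omega
      exact this.trans (Nat.mul_le_mul_left _ hee)
    have hX2 : 13 * 2 ^ e ≤ (2 * n + 3) * (E.d + 1) * 2 ^ e := by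
      refine Nat.mul_le_mul_right _ ?_
      have := hE.five_le
      exact (by omega : 13 ≤ 2 * n + 3).trans (Nat.le_mul_of_pos_right _ (by omega))
    have hX3 : (2 * n + 3) * (E.d + 1) ≤ (2 * n + 3) * (E.d + 1) * 2 ^ e :=
      Nat.le_mul_of_pos_right _ hpos
    generalize hXX : (2 * n + 3) * (E.d + 1) * 2 ^ e = X at *
    have e1 : 2000 * (2 * n + 3) * (E.d + l + j + 1) =
      2000 * ((2 * n + 3) * (E.d + l + j + 1)) := by ring
    have e2 : 3100 * (2 * n + 3) * (E.d + 1) * (2 ^ e + 1) =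
      3100 * X + 3100 * ((2 * n + 3) * (E.d + 1)) := by rw [← hXX]; ring
    have e3 : 20000 * (2 * n + 3) * (E.d + 1) * 2 ^ e = 20000 * X := by rw [← hXX]; ring
    rw [e1] at k6
    rw [e2] at p4
    rw [e3]
    omega

end Execution

/-! ### Integer weights, prefix sums and the protocol. -/

section Weights

variable {Y : Type*} {d lam : ℕ} {D : PMF (Cube d)}

/-- The rational number equal to the probability of `x` (if that probability is rational). -/
noncomputable def pmfValue (D : PMF (Cube d)) (x : Cube d) : ℚ :=
  Function.invFun (fun r : ℚ => (r : ℝ)) (D x).toReal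

theorem exists_pmfValue (hD : D ∈ preciseDistributions d lam) (x : Cube d) :
    ((pmfValue D x : ℚ) : ℝ) = (D x).toReal ∧ pmfValue D x ∈ rationalsOfPrecision lam := by
  obtain ⟨r, hr, hrx⟩ := hD x
  have h1 : ((pmfValue D x : ℚ) : ℝ) = (D x).toReal :=
    Function.invFun_eq (f := fun r : ℚ => (r : ℝ)) ⟨r, hrx.symm⟩
  have h2 : pmfValue D x = r := by
    have := h1.trans hrx
    exact_mod_cast this
  exact ⟨h1, h2 ▸ hr⟩

theorem den_le_of_mem {k : ℕ} {r : ℚ} (h : r ∈ rationalsOfPrecision k) : r.den ≤ 2 ^ k := by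
  obtain ⟨p, q, hq, hp, hq', rfl⟩ := h
  have h1 : (((p : ℚ) / q).den : ℤ) ∣ q := by
    rw [← Rat.divInt_eq_div]; exact Rat.den_dvd p q
  have h2 := Int.le_of_dvd (abs_pos.2 hq) ((dvd_abs _ _).2 h1)
  exact_mod_cast h2.trans hq'

theorem num_le_of_mem {k : ℕ} {r : ℚ} (h : r ∈ rationalsOfPrecision k) : r.num.toNat ≤ 2 ^ k := by
  obtain ⟨p, q, hq, hp, hq', rfl⟩ := h
  have h1 : ((p : ℚ) / q).num ∣ p := by
    rw [← Rat.divInt_eq_div]; exact Rat.num_dvd p hq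
  rcases eq_or_ne p 0 with rfl | hp0
  · simp
  · have h2 := Int.le_of_dvd (abs_pos.2 hp0) ((dvd_abs _ _).2 h1)
    have := h2.trans hp
    rw [Int.toNat_le]
    exact_mod_cast this

/-- A probability that does not vanish is not too small. -/
theorem one_le_mul_of_ne_zero (hD : D ∈ preciseDistributions d lam) {x : Cube d}
    (hx : (D x).toReal ≠ 0) : 1 ≤ 2 ^ lam * (D x).toReal := by
  obtain ⟨h1, h2⟩ := exists_pmfValue hD x
  have hpos : 0 < (D x).toReal := lt_of_le_of_ne ENNReal.toReal_nonneg hx.symm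
  rw [← h1] at hpos ⊢
  have hpos' : 0 < pmfValue D x := by exact_mod_cast hpos
  have hnum : 1 ≤ (pmfValue D x).num := Rat.num_pos.2 hpos'
  have hden := den_le_of_mem h2
  have hd0 : 0 < ((pmfValue D x).den : ℝ) := by exact_mod_cast (pmfValue D x).den_pos
  rw [Rat.cast_def, ← mul_div_assoc, le_div_iff₀ hd0, one_mul]
  have h3 : ((pmfValue D x).den : ℝ) ≤ 2 ^ lam := by exact_mod_cast hden
  have h4 : (1 : ℝ) ≤ ((pmfValue D x).num : ℝ) := by exact_mod_cast hnum
  have h5 : (0 : ℝ) < 2 ^ lam := by positivity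
  nlinarith

/-- The weight of a point: its probability, in units of `1 / (2 ^ n - 1)` and rounded down. -/
noncomputable def pointWeight (D : PMF (Cube d)) (n : ℕ) (x : Cube d) : ℕ :=
  (2 ^ n - 1) * (pmfValue D x).num.toNat / (pmfValue D x).den

theorem pointWeight_bounds (hD : D ∈ preciseDistributions d lam) (n : ℕ) (x : Cube d) :
    (pointWeight D n x : ℝ) ≤ (2 ^ n - 1) * (D x).toReal ∧
      (2 ^ n - 1) * (D x).toReal ≤ pointWeight D n x + 1 := by
  obtain ⟨h1, h2⟩ := exists_pmfValue hD x
  have h0 : 0 ≤ pmfValue D x := by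
    have : (0 : ℝ) ≤ (pmfValue D x : ℚ) := h1 ▸ ENNReal.toReal_nonneg
    exact_mod_cast this
  have hnum : (((pmfValue D x).num.toNat : ℕ) : ℝ) = ((pmfValue D x).num : ℝ) := by
    have : (((pmfValue D x).num.toNat : ℕ) : ℤ) = (pmfValue D x).num :=
      Int.toNat_of_nonneg (Rat.num_nonneg.2 h0)
    exact_mod_cast this
  have hd0 : 0 < ((pmfValue D x).den : ℝ) := by exact_mod_cast (pmfValue D x).den_pos
  have hcast : ((2 ^ n - 1 : ℕ) : ℝ) = 2 ^ n - 1 := by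
    rw [Nat.cast_sub Nat.one_le_two_pow]; simp
  have hval : (2 ^ n - 1 : ℝ) * (D x).toReal =
      (((2 ^ n - 1) * (pmfValue D x).num.toNat : ℕ) : ℝ) / ((pmfValue D x).den : ℝ) := by
    rw [← h1, Rat.cast_def, Nat.cast_mul, hcast, hnum, mul_div_assoc]
  rw [hval, pointWeight]
  refine ⟨Nat.cast_div_le, ?_⟩
  rw [div_le_iff₀ hd0]
  have := Nat.lt_div_mul_add (a := (2 ^ n - 1) * (pmfValue D x).num.toNat) (pmfValue D x).den_pos
  have h3 : (2 ^ n - 1) * (pmfValue D x).num.toNat ≤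
      ((2 ^ n - 1) * (pmfValue D x).num.toNat / (pmfValue D x).den + 1) * (pmfValue D x).den := by
    rw [add_mul, one_mul]; exact this.le
  exact_mod_cast h3

open Classical in
/-- The weight of a point if the hypotheses disagree there, and `0` otherwise. -/
noncomputable def weight (D : PMF (Cube d)) (h : Bool → Cube d → Y) (n : ℕ) (x : Cube d) : ℕ :=
  if h false x = h true x then 0 else pointWeight D n x

/-- The total weight of the first `k` points. -/
noncomputable def prefixWeight (D : PMF (Cube d)) (h : Bool → Cube d → Y) (n k : ℕ) : ℕ :=
  ∑ y ∈ Finset.range k, weight D h n (Cube.ofNat d y)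

theorem Cube.ofNat_injOn : Set.InjOn (Cube.ofNat d) (Finset.range (2 ^ d) : Set ℕ) := by
  intro m hm k hk hmk
  simp only [Finset.coe_range, Set.mem_Iio] at hm hk
  refine Nat.eq_of_testBit_eq fun i => ?_
  by_cases hi : i < d
  · exact congrFun hmk ⟨i, hi⟩
  · have := Nat.pow_le_pow_right (n := 2) (by omega) (not_lt.1 hi)
    rw [Nat.testBit_lt_two_pow (by omega), Nat.testBit_lt_two_pow (by omega)]

theorem image_ofNat : (Finset.range (2 ^ d)).image (Cube.ofNat d) = Finset.univ := by
  refine Finset.eq_univ_of_card _ ?_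
  rw [Finset.card_image_of_injOn Cube.ofNat_injOn, Finset.card_range]
  simp

theorem sum_ofNat {M : Type*} [AddCommMonoid M] (g : Cube d → M) :
    ∑ y ∈ Finset.range (2 ^ d), g (Cube.ofNat d y) = ∑ x, g x := by
  rw [← image_ofNat, Finset.sum_image Cube.ofNat_injOn]

theorem sum_toReal (D : PMF (Cube d)) : ∑ x, (D x).toReal = 1 := by
  have h := D.tsum_coe
  rw [tsum_fintype] at h
  rw [← ENNReal.toReal_sum fun x _ => D.apply_ne_top x, h, ENNReal.toReal_one]

theorem prefixWeight_mono (D : PMF (Cube d)) (h : Bool → Cube d → Y) (n : ℕ) :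
    Monotone (prefixWeight D h n) := fun a b hab =>
  Finset.sum_le_sum_of_subset (by simpa using hab)

/-- This is why probabilities are scaled by `2 ^ n - 1` and not by `2 ^ n`: even the total weight
fits in `n` bits. -/
theorem prefixWeight_lt (hD : D ∈ preciseDistributions d lam) (h : Bool → Cube d → Y) (n : ℕ)
    {k : ℕ} (hk : k ≤ 2 ^ d) : prefixWeight D h n k < 2 ^ n := by
  refine (prefixWeight_mono D h n hk).trans_lt ?_
  have h1 : (prefixWeight D h n (2 ^ d) : ℝ) ≤ 2 ^ n - 1 := by
    rw [prefixWeight, sum_ofNat, Nat.cast_sum]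
    calc ∑ x, (weight D h n x : ℝ) ≤ ∑ x, (2 ^ n - 1) * (D x).toReal := by
          refine Finset.sum_le_sum fun x _ => le_trans ?_ (pointWeight_bounds hD n x).1
          rw [weight]
          split_ifs <;> simp
      _ = 2 ^ n - 1 := by rw [← Finset.mul_sum, sum_toReal, mul_one]
  have h2 : (prefixWeight D h n (2 ^ d) : ℝ) < ((2 ^ n : ℕ) : ℝ) := by
    push_cast
    linarith
  exact_mod_cast h2

/-- The protocol for `lam`-precise distributions. The honest prover answers with the prefix sum at
the number sent by the verifier, for the precision given by the number of bits sent. -/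
noncomputable def protocol (Y : Type*) (lam : ℕ) : Protocol Y where
  verifier := verifier lam
  prover := fun _ _ _ _ h D t =>
    match t with
    | [] => 0
    | m :: _ => prefixWeight D h m.bits m.value

/-- Only the most recent message matters to the honest prover: its contents are the argument and its
length is the precision. Numerators and denominators are at most `2 ^ lam`, so they too have fewer
than `n` bits. -/
theorem protocol_reports (hD : D ∈ preciseDistributions d lam) (eps beta : ℝ) (f : Cube d → Y)
    (h : Bool → Cube d → Y) (b : Bool) (adv : Adversary) (coin : ℕ → Bool) {n : ℕ}
    (hn : d + lam + 5 ≤ n) :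
    Reports ((protocol Y lam).env eps beta D f h b adv coin) b n (prefixWeight D h n) where
  dim_lt := show d < n by omega
  five_le := by omega
  zero := by simp [prefixWeight]
  succ_eq := fun y hy => by
    have hy' : h false (Cube.ofNat d y) = h true (Cube.ofNat d y) := hy
    rw [prefixWeight, Finset.sum_range_succ, weight, if_pos hy', add_zero, prefixWeight]
  succ_ne := fun y hy => by
    have hy' : h false (Cube.ofNat d y) ≠ h true (Cube.ofNat d y) := hy
    rw [prefixWeight, Finset.sum_range_succ, weight, if_neg hy', prefixWeight]
    rfl
  lt := fun x hx => prefixWeight_lt hD h n hx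
  honest := fun x hx tr => by simp [Protocol.env, protocol]
  num_lt := fun x => (num_le_of_mem (exists_pmfValue hD x).2).trans_lt
    (Nat.pow_lt_pow_right (by omega) (by omega))
  den_lt := fun x => (den_le_of_mem (exists_pmfValue hD x).2).trans_lt
    (Nat.pow_lt_pow_right (by omega) (by omega))

end Weights

/-! ### Blocks of coins: uniformity, independence, concentration. -/

section Coins

/-- The number whose binary digits are the coins `k, …, k + n - 1`. -/
def tossOf (coin : ℕ → Bool) (k n : ℕ) : ℕ :=
  ∑ i ∈ Finset.range n, if coin (k + i) then 2 ^ i else 0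

theorem tossOf_lt (coin : ℕ → Bool) (k n : ℕ) : tossOf coin k n < 2 ^ n := by
  unfold tossOf
  induction n with
  | zero => simp
  | succ n ih =>
    rw [Finset.sum_range_succ, pow_succ]
    split_ifs <;> omega

theorem testBit_tossOf (coin : ℕ → Bool) (k n : ℕ) {i : ℕ} (hi : i < n) :
    (tossOf coin k n).testBit i = coin (k + i) := by
  induction n with
  | zero => omega
  | succ n ih =>
    have hs : tossOf coin k (n + 1) = tossOf coin k n + if coin (k + n) then 2 ^ n else 0 := by
      rw [tossOf, Finset.sum_range_succ]; rfl
    rw [hs]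
    have hlt := tossOf_lt coin k n
    rcases Nat.lt_succ_iff_lt_or_eq.1 hi with h | rfl
    · rw [← ih h]
      split_ifs
      · rw [add_comm, Nat.testBit_two_pow_add_gt h]
      · rfl
    · cases hc : coin (k + i)
      · simpa using Nat.testBit_lt_two_pow hlt
      · rw [if_pos rfl, add_comm, Nat.testBit_two_pow_add_eq, Nat.testBit_lt_two_pow hlt]
        rfl

theorem tossOf_eq_iff (coin : ℕ → Bool) (k n : ℕ) {v : ℕ} (hv : v < 2 ^ n) :
    tossOf coin k n = v ↔ ∀ i < n, coin (k + i) = v.testBit i := by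
  constructor
  · rintro rfl i hi
    exact (testBit_tossOf coin k n hi).symm
  · intro h
    refine Nat.eq_of_testBit_eq fun i => ?_
    by_cases hi : i < n
    · rw [testBit_tossOf coin k n hi, h i hi]
    · have h2 := Nat.pow_le_pow_right (n := 2) (by omega) (not_lt.1 hi)
      rw [Nat.testBit_lt_two_pow ((tossOf_lt coin k n).trans_le h2),
        Nat.testBit_lt_two_pow (hv.trans_le h2)]

instance : IsProbabilityMeasure coinMeasure := by
  unfold coinMeasure; infer_instance

theorem measurable_tossOf (k n : ℕ) : Measurable fun coin => tossOf coin k n := by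
  unfold tossOf
  refine Finset.measurable_sum _ fun i _ => ?_
  exact (measurable_of_countable (fun c : Bool => if c then 2 ^ i else 0)).comp
    (measurable_pi_apply (k + i))

/-- The event is a cylinder that prescribes `n` coins, namely the binary digits of `v`. -/
theorem coinMeasure_tossOf_eq (k n : ℕ) {v : ℕ} (hv : v < 2 ^ n) :
    coinMeasure.real {coin | tossOf coin k n = v} = 1 / 2 ^ n := by
  have hset : {coin | tossOf coin k n = v} =
      Set.pi ((Finset.range n).image (k + ·)) (fun i => {v.testBit (i - k)}) := by
    ext coin
    simp only [Set.mem_ofPred_eq, tossOf_eq_iff coin k n hv, Set.mem_pi, Finset.coe_image,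
      Finset.coe_range, Set.mem_image, Set.mem_Iio, Set.mem_singleton_iff]
    constructor
    · rintro h i ⟨j, hj, rfl⟩
      rw [h j hj, Nat.add_sub_cancel_left]
    · intro h i hi
      rw [h (k + i) ⟨i, hi, rfl⟩, Nat.add_sub_cancel_left]
  rw [measureReal_def, hset, coinMeasure, Measure.infinitePi_pi _ (fun _ _ => by measurability)]
  have hb : ∀ c : Bool, (PMF.uniformOfFintype Bool).toMeasure {c} = 2⁻¹ := fun c => by
    rw [PMF.toMeasure_apply_singleton _ _ (by measurability)]
    simp
  simp_rw [hb]
  rw [Finset.prod_const, Finset.card_image_of_injective _ (add_right_injective k),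
    Finset.card_range]
  simp

theorem integral_tossOf (k n : ℕ) (φ : ℕ → ℝ) :
    ∫ coin, φ (tossOf coin k n) ∂coinMeasure = (∑ v ∈ Finset.range (2 ^ n), φ v) / 2 ^ n := by
  have h : ∀ coin, φ (tossOf coin k n) = ∑ v ∈ Finset.range (2 ^ n),
      {coin | tossOf coin k n = v}.indicator (fun _ => φ v) coin := by
    intro coin
    rw [Finset.sum_eq_single (tossOf coin k n)]
    · simp
    · intro v _ hv
      simp [Ne.symm hv]
    · intro hn
      simp [tossOf_lt] at hn
  have hm : ∀ v, MeasurableSet {coin | tossOf coin k n = v} := fun v =>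
    measurable_tossOf k n (measurableSet_singleton v)
  simp_rw [h]
  rw [integral_finsetSum _ fun v _ => (integrable_const _).indicator (hm v), Finset.sum_div]
  refine Finset.sum_congr rfl fun v hv => ?_
  rw [integral_indicator_const _ (hm v), coinMeasure_tossOf_eq k n (Finset.mem_range.1 hv)]
  simp [div_eq_inv_mul]

/-- The map `(i, j) ↦ i * n + j` with `j < n` is injective. Reindexing the coins along it and
currying gives a product over `i` of product measures over `j`, in which the blocks are the
coordinates. -/
theorem iIndepFun_tossOf {n : ℕ} (hn : 0 < n) :
    iIndepFun (fun (i : ℕ) coin => tossOf coin (i * n) n) coinMeasure := by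
  have hinj : Function.Injective fun p : ℕ × Fin n => p.1 * n + p.2 := by
    rintro ⟨i, a⟩ ⟨j, c⟩ h
    have h : i * n + a = j * n + c := h
    have h1 : i = j := by
      have hi : (i * n + a) / n = i := by
        rw [mul_comm, Nat.mul_add_div hn, Nat.div_eq_of_lt a.2, add_zero]
      have hj : (j * n + c) / n = j := by
        rw [mul_comm, Nat.mul_add_div hn, Nat.div_eq_of_lt c.2, add_zero]
      rw [← hi, ← hj, h]
    subst h1
    simp only [Prod.mk.injEq, true_and]
    exact Fin.ext (by omega)
  have hlaw : coinMeasure.map (fun coin (i : ℕ) (j : Fin n) => coin (i * n + j)) =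
      Measure.infinitePi fun _ : ℕ => Measure.infinitePi fun _ : Fin n =>
        (PMF.uniformOfFintype Bool).toMeasure := by
    rw [← Measure.infinitePi_map_curry (fun _ _ => (PMF.uniformOfFintype Bool).toMeasure),
      ← Measure.map_infinitePi_infinitePi_of_inj
        (P := fun _ : ℕ => (PMF.uniformOfFintype Bool).toMeasure) hinj,
      Measure.map_map (by fun_prop) (by fun_prop)]
    rfl
  have hblock : iIndepFun (fun (i : ℕ) (coin : ℕ → Bool) (j : Fin n) => coin (i * n + j))
      coinMeasure := by
    rw [iIndepFun_iff_map_fun_eq_infinitePi_map (by fun_prop), hlaw]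
    congr 1
    funext i
    have hi : Function.Injective fun j : Fin n => i * n + (j : ℕ) := fun a c h =>
      Fin.ext (by simpa using h)
    exact (Measure.map_infinitePi_infinitePi_of_inj
      (P := fun _ : ℕ => (PMF.uniformOfFintype Bool).toMeasure) hi).symm
  convert! hblock.comp (fun _ b => ∑ j : Fin n, if b j then 2 ^ (j : ℕ) else 0)
    fun _ => measurable_of_countable _ using 2 with i
  funext coin
  simp [tossOf, Finset.sum_range]

/-- Hoeffding's inequality for functions of consecutive blocks of coins. -/
theorem coinMeasure_le_sum_tossOf {n : ℕ} (hn : 0 < n) (m : ℕ) (ψ : ℕ → ℝ)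
    (hψ : ∀ v, ψ v ∈ Set.Icc (0 : ℝ) 2) {γ : ℝ} (hγ : 0 ≤ γ)
    (hmean : (∑ v ∈ Finset.range (2 ^ n), ψ v) / 2 ^ n ≤ 1 - γ) :
    coinMeasure.real {coin | (m : ℝ) ≤ ∑ i ∈ Finset.range m, ψ (tossOf coin (i * n) n)} ≤
      Real.exp (-(m * γ ^ 2 / 2)) := by
  have hmeas : Measurable ψ := measurable_of_countable ψ
  have hsub : ∀ i, HasSubgaussianMGF (fun coin => ψ (tossOf coin (i * n) n) -
      (∑ v ∈ Finset.range (2 ^ n), ψ v) / 2 ^ n) 1 coinMeasure := fun i => by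
    have h := hasSubgaussianMGF_of_mem_Icc (μ := coinMeasure) (a := 0) (b := 2)
      (hmeas.comp (measurable_tossOf (i * n) n)).aemeasurable
      (Filter.Eventually.of_forall fun coin => hψ (tossOf coin (i * n) n))
    -- The variance proxy of a variable with values in an interval is the square of half its length,
    -- here `1`.
    have hc : (‖(2 : ℝ) - 0‖₊ / 2) ^ 2 = 1 := by
      rw [sub_zero]; ext; simp
    rw [hc] at h
    simpa only [Function.comp_def, integral_tossOf] using h
  have hind : iIndepFun (fun (i : ℕ) coin => ψ (tossOf coin (i * n) n) -
      (∑ v ∈ Finset.range (2 ^ n), ψ v) / 2 ^ n) coinMeasure :=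
    (iIndepFun_tossOf hn).comp (fun _ v => ψ v - (∑ v ∈ Finset.range (2 ^ n), ψ v) / 2 ^ n)
      fun _ => measurable_of_countable _
  have h := HasSubgaussianMGF.measure_sum_range_ge_le_of_iIndepFun hind (n := m)
    (fun i _ => hsub i) (ε := m * γ) (by positivity)
  refine (measureReal_mono fun coin hcoin => ?_).trans (h.trans (Real.exp_le_exp.2 (le_of_eq ?_)))
  · simp only [Set.mem_ofPred_eq, Finset.sum_sub_distrib, Finset.sum_const, Finset.card_range,
      nsmul_eq_mul] at hcoin ⊢
    have := mul_le_mul_of_nonneg_left hmean (Nat.cast_nonneg (α := ℝ) m)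
    linarith
  · rcases Nat.eq_zero_or_pos m with rfl | hm
    · simp
    · have : (m : ℝ) ≠ 0 := by positivity
      simp
      field_simp

end Coins

/-! ### How many random numbers select a given point. -/

section Counting

/-- The condition says `r * W < a * K`, so the count is `a * K / W` rounded up; `a ≤ W` ensures that
every such `r` is below `K`. -/
theorem card_filter_mul_div_lt {K W a : ℕ} (hW : 0 < W) (hK : 0 < K) (ha : a ≤ W) :
    a * K ≤ ((Finset.range K).filter fun r => r * W / K < a).card * W ∧
      ((Finset.range K).filter fun r => r * W / K < a).card * W ≤ a * K + W := by
  have h : ((Finset.range K).filter fun r => r * W / K < a) =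
      Finset.range ((a * K + (W - 1)) / W) := by
    ext r
    rw [Finset.mem_filter, Finset.mem_range, Finset.mem_range, Nat.div_lt_iff_lt_mul hK,
      ← Nat.succ_le_iff (m := r) (n := (a * K + (W - 1)) / W), Nat.le_div_iff_mul_le hW,
      Nat.succ_mul]
    constructor
    · rintro ⟨_, h⟩
      omega
    · intro h
      have h1 : r * W < a * K := by omega
      have h2 : a * K ≤ K * W := by rw [mul_comm K]; exact Nat.mul_le_mul_right K ha
      exact ⟨Nat.lt_of_mul_lt_mul_right (h1.trans_le h2), h1⟩
  rw [h, Finset.card_range]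
  have h1 := Nat.div_mul_le_self (a * K + (W - 1)) W
  have h2 := Nat.lt_div_mul_add (a := a * K + (W - 1)) hW
  omega

/-- Up to rounding, the point selected by a uniformly random number has the law given by the
increments of the prefix sums. -/
theorem le_sum_selected {F : ℕ → ℕ} (hF : Monotone F) (h0 : F 0 = 0) {N K : ℕ} (hW : 0 < F N)
    (hK : 0 < K) {z : ℕ → ℝ} (hz : ∀ y, |z y| ≤ 1) :
    K * ∑ y ∈ Finset.range N, z y * ((F (y + 1) : ℝ) - F y) - F N * N ≤
      F N * ∑ r ∈ Finset.range K, z (selected F N (r * F N / K)) := by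
  set c : ℕ → ℕ := fun a => ((Finset.range K).filter fun r => r * F N / K < a).card with hc
  -- The difference of the two indicators is `1` at the selected point and `0` elsewhere. In this
  -- form the sums over `r` and `y` can be exchanged, leaving counts of threshold events.
  have hpoint : ∀ r ∈ Finset.range K, z (selected F N (r * F N / K)) =
      ∑ y ∈ Finset.range N, z y * ((if r * F N / K < F (y + 1) then (1 : ℝ) else 0) -
        if r * F N / K < F y then 1 else 0) := by
    intro r hr
    have hv : r * F N / K < F N := by
      rw [Nat.div_lt_iff_lt_mul hK, mul_comm]
      exact Nat.mul_lt_mul_of_pos_left (Finset.mem_range.1 hr) hW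
    generalize r * F N / K = v at hv
    have hN : N ≠ 0 := by rintro rfl; omega
    have hspec : F (selected F N v) ≤ v :=
      Nat.findGreatest_spec (P := fun x => F x ≤ v) (Nat.zero_le _) (by omega)
    have hle : selected F N v ≤ N - 1 := Nat.findGreatest_le _
    have hlt : v < F (selected F N v + 1) := by
      rcases Nat.lt_or_eq_of_le hle with h | h
      · exact not_le.1 (Nat.findGreatest_is_greatest (P := fun x => F x ≤ v) (Nat.lt_succ_self _)
          (Nat.succ_le_of_lt h))
      · rw [h, Nat.sub_add_cancel (by omega)]; exact hv
    rw [Finset.sum_eq_single (selected F N v)]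
    · rw [if_pos hlt, if_neg (not_lt.2 hspec)]; ring
    · intro y _ hy
      rcases Nat.lt_or_gt_of_ne hy with h | h
      · have h1 : F (y + 1) ≤ v := (hF h).trans hspec
        have h2 : F y ≤ v := (hF (Nat.le_succ y)).trans h1
        rw [if_neg (not_lt.2 h1), if_neg (not_lt.2 h2)]; ring
      · have h1 : v < F y := hlt.trans_le (hF h)
        have h2 : v < F (y + 1) := h1.trans_le (hF (Nat.le_succ y))
        rw [if_pos h1, if_pos h2]; ring
    · intro h
      exact absurd (Finset.mem_range.2 (by omega)) h
  rw [Finset.sum_congr rfl hpoint, Finset.sum_comm]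
  have hinner : ∀ y, ∑ r ∈ Finset.range K, z y * ((if r * F N / K < F (y + 1) then (1 : ℝ) else 0) -
        if r * F N / K < F y then 1 else 0) = z y * ((c (F (y + 1)) : ℝ) - c (F y)) := by
    intro y
    rw [← Finset.mul_sum, Finset.sum_sub_distrib, Finset.sum_boole, Finset.sum_boole]
  simp_rw [hinner]
  -- After multiplication by `F N`, each count exceeds its ideal value by an amount between `0` and
  -- `F N`, so a difference of two counts is off by at most `F N`.
  have hterm : ∀ y ∈ Finset.range N, K * (z y * ((F (y + 1) : ℝ) - F y)) - F N ≤
      F N * (z y * ((c (F (y + 1)) : ℝ) - c (F y))) := by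
    intro y hy
    have hy := Finset.mem_range.1 hy
    obtain ⟨h1, h2⟩ := card_filter_mul_div_lt hW hK (hF hy : F (y + 1) ≤ F N)
    obtain ⟨h3, h4⟩ := card_filter_mul_div_lt hW hK (hF hy.le : F y ≤ F N)
    change F (y + 1) * K ≤ c (F (y + 1)) * F N at h1
    change c (F (y + 1)) * F N ≤ F (y + 1) * K + F N at h2
    change F y * K ≤ c (F y) * F N at h3
    change c (F y) * F N ≤ F y * K + F N at h4
    have h1 : (F (y + 1) : ℝ) * K ≤ c (F (y + 1)) * F N := by exact_mod_cast h1
    have h2 : (c (F (y + 1)) : ℝ) * F N ≤ F (y + 1) * K + F N := by exact_mod_cast h2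
    have h3 : (F y : ℝ) * K ≤ c (F y) * F N := by exact_mod_cast h3
    have h4 : (c (F y) : ℝ) * F N ≤ F y * K + F N := by exact_mod_cast h4
    set δ : ℝ := F N * ((c (F (y + 1)) : ℝ) - c (F y)) - K * ((F (y + 1) : ℝ) - F y) with hδ
    have hδ1 : |δ| ≤ F N := abs_le.2 ⟨by rw [hδ]; linarith, by rw [hδ]; linarith⟩
    have h5 : |z y * δ| ≤ 1 * F N := by
      rw [abs_mul]; exact mul_le_mul (hz y) hδ1 (abs_nonneg _) zero_le_one
    have h6 := (abs_le.1 h5).1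
    have h7 : z y * δ = F N * (z y * ((c (F (y + 1)) : ℝ) - c (F y))) -
      K * (z y * ((F (y + 1) : ℝ) - F y)) := by rw [hδ]; ring
    linarith
  have hsum := Finset.sum_le_sum hterm
  rw [Finset.sum_sub_distrib, ← Finset.mul_sum, ← Finset.mul_sum, Finset.sum_const,
    Finset.card_range, nsmul_eq_mul] at hsum
  linarith

end Counting

/-! ### The bias of a sample after rounding. -/

section Gap

variable {Y : Type*} {d lam n : ℕ} {D : PMF (Cube d)} {h : Bool → Cube d → Y}

open Classical in
/-- The probability that the hypotheses disagree. -/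
noncomputable def disagreement (D : PMF (Cube d)) (h : Bool → Cube d → Y) : ℝ :=
  ∑ x, if h false x = h true x then 0 else (D x).toReal

theorem disagreement_nonneg : 0 ≤ disagreement D h :=
  Finset.sum_nonneg fun x _ => by split_ifs <;> simp

/-- A nonzero sum has a nonzero term, and precision bounds that term below by `2 ^ (-lam)`. -/
theorem one_le_mul_disagreement (hD : D ∈ preciseDistributions d lam)
    (hp : disagreement D h ≠ 0) : 1 ≤ 2 ^ lam * disagreement D h := by
  classical
  obtain ⟨x, _, hx⟩ := Finset.exists_ne_zero_of_sum_ne_zero hp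
  have hne : h false x ≠ h true x := fun he => hx (if_pos he)
  rw [if_neg hne] at hx
  refine (one_le_mul_of_ne_zero hD hx).trans (mul_le_mul_of_nonneg_left ?_ (by positivity))
  have := Finset.single_le_sum (f := fun x => if h false x = h true x then 0 else (D x).toReal)
    (fun x _ => by split_ifs <;> simp) (Finset.mem_univ x)
  simpa [hne, disagreement] using this

theorem prefixWeight_total_le (hD : D ∈ preciseDistributions d lam) :
    (prefixWeight D h n (2 ^ d) : ℝ) ≤ (2 ^ n - 1) * disagreement D h := by
  rw [prefixWeight, sum_ofNat, Nat.cast_sum, disagreement, Finset.mul_sum]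
  refine Finset.sum_le_sum fun x _ => ?_
  rw [weight]
  split_ifs
  · simp
  · exact (pointWeight_bounds hD n x).1

/-- Rounding down changes each term by at most one, and there are `2 ^ d` terms. -/
theorem le_sum_mul_weight (hD : D ∈ preciseDistributions d lam) {z : Cube d → ℝ}
    (hz : ∀ x, |z x| ≤ 1) (hz0 : ∀ x, h false x = h true x → z x = 0) :
    (2 ^ n - 1) * ∑ x, (D x).toReal * z x - 2 ^ d ≤ ∑ x, z x * (weight D h n x : ℝ) := by
  have hterm : ∀ x ∈ (Finset.univ : Finset (Cube d)),
      (2 ^ n - 1) * ((D x).toReal * z x) - 1 ≤ z x * (weight D h n x : ℝ) := by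
    intro x _
    by_cases hx : h false x = h true x
    · simp [hz0 x hx]
    · rw [weight, if_neg hx]
      obtain ⟨h1, h2⟩ := pointWeight_bounds hD n x
      have h3 : |(2 ^ n - 1) * (D x).toReal - (pointWeight D n x : ℝ)| ≤ 1 :=
        abs_le.2 ⟨by linarith, by linarith⟩
      have h4 : |z x * ((2 ^ n - 1) * (D x).toReal - (pointWeight D n x : ℝ))| ≤ 1 * 1 := by
        rw [abs_mul]; exact mul_le_mul (hz x) h3 (abs_nonneg _) zero_le_one
      have h5 := (abs_le.1 h4).2
      linarith
  have hsum := Finset.sum_le_sum hterm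
  rw [Finset.sum_sub_distrib, ← Finset.mul_sum] at hsum
  simpa using hsum

/-- Let `K = 2 ^ n`, let `W` be the total weight, `p` the disagreement and `T` the sum on the right.
Rounding the weights loses `2 ^ d` and rounding the selection loses `W * 2 ^ d ≤ K * 2 ^ d`, so `W *
T ≥ K * ((K - 1) * g * p - 2 * 2 ^ d)`. Because `p ≥ 2 ^ (-lam)`, the hypothesis `hn` gives `4 * 2 ^
d ≤ (K - 1) * g * p`, so at least half of the main term survives. Finally `W ≤ (K - 1) * p`, and `W`
is cancelled. -/
theorem le_sum_selected_prefixWeight (hD : D ∈ preciseDistributions d lam) {z : Cube d → ℝ}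
    (hz : ∀ x, |z x| ≤ 1) (hz0 : ∀ x, h false x = h true x → z x = 0) {g : ℝ} (hg : g ≤ 1)
    (hp : disagreement D h ≠ 0) (hgap : g * disagreement D h ≤ ∑ x, (D x).toReal * z x)
    (hn : 8 * 2 ^ (d + lam) ≤ 2 ^ n * g) :
    2 ^ n * g / 2 ≤ ∑ r ∈ Finset.range (2 ^ n), z (Cube.ofNat d
      (selected (prefixWeight D h n) (2 ^ d) (r * prefixWeight D h n (2 ^ d) / 2 ^ n))) := by
  have hlow := one_le_mul_disagreement hD hp
  have hWle := prefixWeight_total_le (h := h) (n := n) hD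
  have hWK : (prefixWeight D h n (2 ^ d) : ℝ) ≤ 2 ^ n := by
    exact_mod_cast (prefixWeight_lt hD h n le_rfl).le
  have hcube := le_sum_mul_weight (n := n) hD hz hz0
  set p := disagreement D h
  have hp0 : 0 ≤ p := disagreement_nonneg
  have hd1 : (1 : ℝ) ≤ 2 ^ d := one_le_pow₀ one_le_two
  have hl1 : (1 : ℝ) ≤ 2 ^ lam := one_le_pow₀ one_le_two
  have hn1 : (1 : ℝ) ≤ 2 ^ n := one_le_pow₀ one_le_two
  rw [pow_add] at hn
  have hg0 : 0 < g := by
    refine pos_of_mul_pos_right (lt_of_lt_of_le ?_ hn) (by positivity)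
    positivity
  have hn2 : (2 : ℝ) ≤ 2 ^ n := by
    have h1 : (2 : ℝ) ^ n * g ≤ 2 ^ n := mul_le_of_le_one_right (by positivity) hg
    have h2 : (1 : ℝ) ≤ 2 ^ d * 2 ^ lam := one_le_mul_of_one_le_of_one_le hd1 hl1
    linarith
  have hmain : 4 * 2 ^ d ≤ (2 ^ n - 1) * (g * p) := by
    have h1 : 8 * 2 ^ d * (2 ^ lam * p) ≤ 2 ^ n * g * p := by
      have := mul_le_mul_of_nonneg_right hn hp0
      linarith
    have h2 : 8 * (2 : ℝ) ^ d * 1 ≤ 8 * 2 ^ d * (2 ^ lam * p) :=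
      mul_le_mul_of_nonneg_left hlow (by positivity)
    have h3 : 2 * (g * p) ≤ 2 ^ n * (g * p) := mul_le_mul_of_nonneg_right hn2 (by positivity)
    linarith
  have hsumW : ∑ x, z x * (weight D h n x : ℝ) ≤ prefixWeight D h n (2 ^ d) := by
    rw [prefixWeight, sum_ofNat, Nat.cast_sum]
    exact Finset.sum_le_sum fun x _ =>
      mul_le_of_le_one_left (Nat.cast_nonneg _) (abs_le.1 (hz x)).2
  have hJgap := mul_le_mul_of_nonneg_left hgap (by linarith : (0 : ℝ) ≤ 2 ^ n - 1)
  have hW0 : 0 < (prefixWeight D h n (2 ^ d) : ℝ) := by linarith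
  have hcount := le_sum_selected (prefixWeight_mono D h n) (by simp [prefixWeight])
    (N := 2 ^ d) (K := 2 ^ n) (by exact_mod_cast hW0) (by positivity)
    (z := fun y => z (Cube.ofNat d y)) (fun y => hz _)
  have hinc : ∀ y, (prefixWeight D h n (y + 1) : ℝ) - prefixWeight D h n y =
      weight D h n (Cube.ofNat d y) := fun y => by
    rw [prefixWeight, Finset.sum_range_succ, Nat.cast_add, ← prefixWeight]; ring
  simp_rw [hinc] at hcount
  rw [sum_ofNat (fun x => z x * (weight D h n x : ℝ))] at hcount
  push_cast at hcount
  generalize ∑ r ∈ Finset.range (2 ^ n), z (Cube.ofNat d (selected (prefixWeight D h n) (2 ^ d)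
    (r * prefixWeight D h n (2 ^ d) / 2 ^ n))) = T at hcount ⊢
  generalize (prefixWeight D h n (2 ^ d) : ℝ) = W at *
  refine le_of_mul_le_mul_left ?_ hW0
  have e1 := mul_le_mul_of_nonneg_left (hcube.trans' (sub_le_sub_right hJgap _))
    (by positivity : (0 : ℝ) ≤ 2 ^ n)
  have e2 := mul_le_mul_of_nonneg_right hWle (by positivity : (0 : ℝ) ≤ 2 ^ n * g / 2)
  have e3 := mul_le_mul_of_nonneg_right hWK (by positivity : (0 : ℝ) ≤ 2 ^ d)
  have e4 := mul_le_mul_of_nonneg_left hmain (by positivity : (0 : ℝ) ≤ 2 ^ n)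
  linarith

end Gap

/-! ### The majority vote errs rarely. -/

section Majority

variable {Y : Type*} {d lam n : ℕ} {D : PMF (Cube d)} {h : Bool → Cube d → Y} {f : Cube d → Y}

/-- Hoeffding's inequality applied to `1 - z`, which lies in `[0, 2]` and whose mean over a sample
is at most `1 - g / 2`. -/
theorem coinMeasure_sum_selected_nonpos_le (hD : D ∈ preciseDistributions d lam) {z : Cube d → ℝ}
    (hz : ∀ x, |z x| ≤ 1) (hz0 : ∀ x, h false x = h true x → z x = 0) {g : ℝ} (hg0 : 0 ≤ g)
    (hg : g ≤ 1) (hp : disagreement D h ≠ 0)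
    (hgap : g * disagreement D h ≤ ∑ x, (D x).toReal * z x)
    (hn : 8 * 2 ^ (d + lam) ≤ 2 ^ n * g) (hn0 : 0 < n) (m : ℕ) :
    coinMeasure.real {coin | ∑ i ∈ Finset.range m, z (Cube.ofNat d
      (selected (prefixWeight D h n) (2 ^ d)
        (tossOf coin (i * n) n * prefixWeight D h n (2 ^ d) / 2 ^ n))) ≤ 0} ≤
      Real.exp (-(m * (g / 2) ^ 2 / 2)) := by
  set ψ : ℕ → ℝ := fun r => 1 - z (Cube.ofNat d (selected (prefixWeight D h n) (2 ^ d)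
    (r * prefixWeight D h n (2 ^ d) / 2 ^ n))) with hψ
  refine (measureReal_mono fun coin hcoin => ?_).trans
    (coinMeasure_le_sum_tossOf hn0 m ψ (fun r => ?_) (by positivity : 0 ≤ g / 2) ?_)
  · simp only [Set.mem_ofPred_eq, hψ, Finset.sum_sub_distrib, Finset.sum_const, Finset.card_range,
      nsmul_eq_mul, mul_one] at hcoin ⊢
    linarith
  · have := abs_le.1 (hz (Cube.ofNat d (selected (prefixWeight D h n) (2 ^ d)
      (r * prefixWeight D h n (2 ^ d) / 2 ^ n))))
    exact ⟨by simp only [hψ]; linarith [this.2], by simp only [hψ]; linarith [this.1]⟩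
  · have hsum := le_sum_selected_prefixWeight hD hz hz0 hg hp hgap hn
    rw [div_le_iff₀ (by positivity)]
    simp only [hψ, Finset.sum_sub_distrib, Finset.sum_const, Finset.card_range,
      nsmul_eq_mul, mul_one]
    push_cast
    linarith

theorem vote_sub_one (x : Cube d) :
    (vote f h x : ℝ) - 1 = zeroOne (h false x) (f x) - zeroOne (h true x) (f x) := by
  unfold vote zeroOne
  split_ifs <;> norm_num

theorem zeroOne_nonneg (y y' : Y) : 0 ≤ zeroOne y y' := by
  unfold zeroOne; split_ifs <;> norm_num

theorem abs_zeroOne_sub_le (x : Cube d) :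
    |zeroOne (h false x) (f x) - zeroOne (h true x) (f x)| ≤ 1 := by
  unfold zeroOne
  split_ifs <;> norm_num

theorem loss_nonneg (D : PMF (Cube d)) (f g : Cube d → Y) : 0 ≤ loss zeroOne D f g :=
  Finset.sum_nonneg fun _ _ => mul_nonneg ENNReal.toReal_nonneg (zeroOne_nonneg _ _)

theorem sum_mul_zeroOne_sub :
    ∑ x, (D x).toReal * (zeroOne (h false x) (f x) - zeroOne (h true x) (f x)) =
      loss zeroOne D (h false) f - loss zeroOne D (h true) f := by
  simp only [loss, mul_sub, Finset.sum_sub_distrib]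

/-- Where the hypotheses disagree, at least one of them is wrong. -/
theorem disagreement_le : disagreement D h ≤
    loss zeroOne D (h false) f + loss zeroOne D (h true) f := by
  classical
  rw [disagreement, loss, loss, ← Finset.sum_add_distrib]
  refine Finset.sum_le_sum fun x _ => ?_
  have h0 : 0 ≤ (D x).toReal := ENNReal.toReal_nonneg
  unfold zeroOne
  split_ifs with h1 h2 h3 <;> simp_all

/-- Used to see that the disagreement is nonzero as soon as the losses differ. -/
theorem abs_loss_sub_le : |loss zeroOne D (h false) f - loss zeroOne D (h true) f| ≤
    disagreement D h := by
  classical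
  rw [← sum_mul_zeroOne_sub, disagreement]
  refine (Finset.abs_sum_le_sum_abs _ _).trans (Finset.sum_le_sum fun x _ => ?_)
  split_ifs with hx
  · simp [hx]
  · rw [abs_mul, abs_of_nonneg ENNReal.toReal_nonneg]
    exact mul_le_of_le_one_right ENNReal.toReal_nonneg (abs_zeroOne_sub_le x)

/-- If the losses `a` and `b` differ by more than the factor `1 + ε`, then they differ by a
constant fraction of their sum. -/
theorem mul_le_sub_of_lt {ε a b p : ℝ} (hε : 0 < ε) (ha : 0 ≤ a) (hab : (1 + ε) * a < b)
    (hp : p ≤ a + b) : ε / (2 * (1 + ε)) * p ≤ b - a := by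
  rw [div_mul_eq_mul_div, div_le_iff₀ (by positivity)]
  -- With `p` replaced by `a + b` the claim reads `(2 + 3 * ε) * a ≤ (2 + ε) * b`, and `(2 + ε) * (1
  -- + ε) * a` exceeds the left side by `ε ^ 2 * a`.
  have h1 : 0 ≤ ε * a := by positivity
  have h2 := mul_le_mul_of_nonneg_left hp hε.le
  nlinarith

/-- The vote minus one is the difference of the pointwise losses, and its mean under `D` is the
difference of the losses. If `h false` is unacceptable, the concentration bound is applied to this
function, and if `h true` is, to its negative; ties do no harm, since the bound covers sums equal to
zero. If both are acceptable, the bad event is empty. -/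
theorem coinMeasure_bad_le (hD : D ∈ preciseDistributions d lam) {ε : ℝ} (hε : 0 < ε)
    (hn : 8 * 2 ^ (d + lam) ≤ 2 ^ n * (ε / (2 * (1 + ε)))) (hn0 : 0 < n) (m : ℕ) :
    coinMeasure.real {coin | ¬ loss zeroOne D (h (decide (m ≤ ∑ i ∈ Finset.range m,
          sampleVote n (prefixWeight D h n) f h (tossOf coin (i * n) n)))) f ≤
        (1 + ε) * min (loss zeroOne D (h false) f) (loss zeroOne D (h true) f)} ≤
      Real.exp (-(m * (ε / (2 * (1 + ε)) / 2) ^ 2 / 2)) := by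
  have hg0 : 0 ≤ ε / (2 * (1 + ε)) := by positivity
  have hg1 : ε / (2 * (1 + ε)) ≤ 1 := by
    rw [div_le_one (by positivity)]; linarith
  have hA := loss_nonneg D (h false) f
  have hB := loss_nonneg D (h true) f
  have hAB := disagreement_le (D := D) (h := h) (f := f)
  have habs := abs_le.1 (abs_loss_sub_le (D := D) (h := h) (f := f))
  have hsum := sum_mul_zeroOne_sub (D := D) (h := h) (f := f)
  have hz : ∀ x, |(vote f h x : ℝ) - 1| ≤ 1 := fun x => by
    rw [vote_sub_one]; exact abs_zeroOne_sub_le x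
  have hz0 : ∀ x, h false x = h true x → (vote f h x : ℝ) - 1 = 0 := fun x hx => by
    rw [vote_sub_one, hx, sub_self]
  simp_rw [← vote_sub_one] at hsum
  have hεA := mul_nonneg hε.le hA
  have hεB := mul_nonneg hε.le hB
  by_cases h0 : (1 + ε) * loss zeroOne D (h true) f < loss zeroOne D (h false) f
  · have hlt : loss zeroOne D (h true) f < loss zeroOne D (h false) f := by linarith
    refine (measureReal_mono fun coin hcoin => ?_).trans
      (coinMeasure_sum_selected_nonpos_le hD hz hz0 hg0 hg1 (fun hp => by linarith)
        ((mul_le_sub_of_lt hε hB h0 (by linarith)).trans hsum.ge) hn hn0 m)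
    simp only [Set.mem_ofPred_eq, min_eq_right hlt.le, Finset.sum_sub_distrib, Finset.sum_const,
      Finset.card_range, nsmul_eq_mul, mul_one] at hcoin ⊢
    by_cases hm : m ≤ ∑ i ∈ Finset.range m,
        sampleVote n (prefixWeight D h n) f h (tossOf coin (i * n) n)
    · rw [decide_eq_true hm] at hcoin
      exact absurd (by linarith) hcoin
    · have hm : ((∑ i ∈ Finset.range m, sampleVote n (prefixWeight D h n) f h
        (tossOf coin (i * n) n) : ℕ) : ℝ) ≤ m := by exact_mod_cast (not_le.1 hm).le
      rw [Nat.cast_sum] at hm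
      exact sub_nonpos.2 hm
  by_cases h1 : (1 + ε) * loss zeroOne D (h false) f < loss zeroOne D (h true) f
  · have hlt : loss zeroOne D (h false) f < loss zeroOne D (h true) f := by linarith
    have hgap := mul_le_sub_of_lt hε hA h1 hAB
    refine (measureReal_mono fun coin hcoin => ?_).trans
      (coinMeasure_sum_selected_nonpos_le (h := h) hD (z := fun x => -((vote f h x : ℝ) - 1))
        (fun x => by rw [abs_neg]; exact hz x) (fun x hx => by rw [hz0 x hx, neg_zero]) hg0 hg1
        (fun hp => by linarith) ?_ hn hn0 m)
    · simp only [Set.mem_ofPred_eq, min_eq_left hlt.le, Finset.sum_neg_distrib,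
        Finset.sum_sub_distrib, Finset.sum_const, Finset.card_range, nsmul_eq_mul,
        mul_one] at hcoin ⊢
      by_cases hm : m ≤ ∑ i ∈ Finset.range m,
          sampleVote n (prefixWeight D h n) f h (tossOf coin (i * n) n)
      · have hm : (m : ℝ) ≤ ((∑ i ∈ Finset.range m, sampleVote n (prefixWeight D h n) f h
          (tossOf coin (i * n) n) : ℕ) : ℝ) := by exact_mod_cast hm
        rw [Nat.cast_sum] at hm
        exact neg_nonpos.2 (sub_nonneg.2 hm)
      · rw [decide_eq_false hm] at hcoin
        exact absurd (by linarith) hcoin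
    · simp_rw [mul_neg, Finset.sum_neg_distrib, hsum]
      linarith
  · refine le_trans (le_of_eq ?_) (Real.exp_pos _).le
    convert measureReal_empty
    refine Set.eq_empty_of_forall_notMem fun coin hcoin => hcoin ?_
    rw [mul_min_of_nonneg _ _ (by positivity)]
    cases decide (m ≤ ∑ i ∈ Finset.range m,
          sampleVote n (prefixWeight D h n) f h (tossOf coin (i * n) n))
    · exact le_min (by linarith) (not_lt.1 h0)
    · exact le_min (not_lt.1 h1) (by linarith)

end Majority

/-! ### Sizes of the parameters read from `ε` and `β`. -/

section Parameters

/-- The test `1 ≤ ε * (2 ^ i - 1)` is the same as `1 + 1 / ε ≤ 2 ^ i`. The upper bound comes from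
minimality for `l > 1` and is trivial for `l = 1`. -/
theorem exists_scale {ε : ℝ} (hε : 0 < ε) : ∃ l, 1 ≤ l ∧
    (∀ i, 1 ≤ i → i ≤ l → ((1 : ℝ) ≤ ε * ((2 ^ i - 1 : ℕ) : ℝ) ↔ i = l)) ∧
    1 + 1 / ε ≤ 2 ^ l ∧ 2 ^ l ≤ 2 * (1 + 1 / ε) := by
  classical
  have hcast : ∀ i : ℕ, ((2 ^ i - 1 : ℕ) : ℝ) = 2 ^ i - 1 := fun i => by
    rw [Nat.cast_sub Nat.one_le_two_pow]; simp
  have hiff : ∀ i : ℕ, (1 : ℝ) ≤ ε * ((2 ^ i - 1 : ℕ) : ℝ) ↔ 1 + 1 / ε ≤ 2 ^ i := fun i => by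
    rw [hcast, ← div_le_iff₀' hε]
    exact ⟨fun h => by linarith, fun h => by linarith⟩
  have hex : ∃ i : ℕ, 1 ≤ i ∧ 1 + 1 / ε ≤ 2 ^ i := by
    obtain ⟨i, hi⟩ := pow_unbounded_of_one_lt (1 + 1 / ε) (one_lt_two (α := ℝ))
    exact ⟨i + 1, by omega, hi.le.trans (pow_le_pow_right₀ one_le_two (by omega))⟩
  obtain ⟨h1, h2⟩ := Nat.find_spec hex
  refine ⟨Nat.find hex, h1, fun i hi hil => ?_, h2, ?_⟩
  · rw [hiff]
    refine ⟨fun h => le_antisymm hil (Nat.find_min' hex ⟨hi, h⟩), ?_⟩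
    rintro rfl
    exact h2
  · have hpos : 0 < 1 / ε := by positivity
    rcases Nat.lt_or_eq_of_le h1 with h | h
    · have hmin := Nat.find_min hex (Nat.sub_one_lt (by omega : Nat.find hex ≠ 0))
      have hlt : (2 : ℝ) ^ (Nat.find hex - 1) < 1 + 1 / ε := by
        by_contra hc
        exact hmin ⟨by omega, not_lt.1 hc⟩
      have hsucc : (2 : ℝ) ^ Nat.find hex = 2 * 2 ^ (Nat.find hex - 1) := by
        rw [← pow_succ', Nat.sub_add_cancel h1]
      rw [hsucc]
      linarith
    · rw [← h]
      linarith

/-- The test says `log (1 / β) ≤ 2 ^ i * log 2`. For `β < 1 / 2` it fails at `i = 0`, so the least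
solution `j` has a predecessor, where failure gives `2 ^ j < (2 / log 2) * log (1 / β)`; and `2 /
log 2 < 3`. -/
theorem exists_confidence {β : ℝ} (hβ : 0 < β) : ∃ j,
    (∀ i, i ≤ j → ((1 : ℝ) ≤ β * ((2 ^ 2 ^ i : ℕ) : ℝ) ↔ i = j)) ∧
    Real.exp (-2 ^ j) ≤ β ∧ (β * 2 < 1 → 2 ^ j ≤ 3 * Real.log (1 / β)) := by
  classical
  have hiff : ∀ i : ℕ, (1 : ℝ) ≤ β * ((2 ^ 2 ^ i : ℕ) : ℝ) ↔
      Real.log (1 / β) ≤ 2 ^ i * Real.log 2 := fun i => by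
    rw [← div_le_iff₀' hβ, ← Real.log_le_log_iff (by positivity) (by positivity)]
    push_cast
    rw [Real.log_pow]
    push_cast
    rfl
  have hl2 := Real.log_two_gt_d9
  have hl2' := Real.log_two_lt_d9
  have hex : ∃ i : ℕ, Real.log (1 / β) ≤ 2 ^ i * Real.log 2 := by
    obtain ⟨i, hi⟩ := pow_unbounded_of_one_lt (Real.log (1 / β) / Real.log 2) (one_lt_two (α := ℝ))
    rw [div_lt_iff₀ (by linarith)] at hi
    exact ⟨i, hi.le⟩
  refine ⟨Nat.find hex, fun i hi => ?_, ?_, fun hlt => ?_⟩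
  · rw [hiff]
    refine ⟨fun h => le_antisymm hi (Nat.find_min' hex h), ?_⟩
    rintro rfl
    exact Nat.find_spec hex
  · have h1 := Nat.find_spec hex
    have h2 : (0 : ℝ) ≤ 2 ^ Nat.find hex := by positivity
    have h3 : Real.log (1 / β) ≤ 2 ^ Nat.find hex :=
      h1.trans (mul_le_of_le_one_right h2 (by linarith))
    have h4 : Real.log (1 / β) = -Real.log β := by rw [one_div, Real.log_inv]
    rw [← Real.le_log_iff_exp_le hβ]
    linarith
  · have hlog : Real.log 2 < Real.log (1 / β) := by
      refine Real.log_lt_log (by norm_num) ?_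
      rw [lt_div_iff₀ hβ]
      linarith
    have hne : Nat.find hex ≠ 0 := by
      intro h0
      have h1 := Nat.find_spec hex
      rw [h0] at h1
      linarith
    have hmin := not_le.1 (Nat.find_min hex (Nat.sub_one_lt hne))
    have hsucc : (2 : ℝ) ^ Nat.find hex = 2 * 2 ^ (Nat.find hex - 1) := by
      rw [← pow_succ', Nat.sub_add_cancel (Nat.one_le_iff_ne_zero.2 hne)]
    have hpos : (0 : ℝ) < 2 ^ (Nat.find hex - 1) := by positivity
    have h4 : (2 : ℝ) ^ (Nat.find hex - 1) * (2 / 3) ≤ 2 ^ (Nat.find hex - 1) * Real.log 2 :=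
      mul_le_mul_of_nonneg_left (by linarith) hpos.le
    rw [hsucc]
    linarith

theorem le_mul_log_of_two_pow_le {ε : ℝ} (hε : 0 < ε) {l : ℕ} (hl : 2 ^ l ≤ 2 * (1 + 1 / ε)) :
    (l : ℝ) ≤ 3 * max 1 (Real.log (1 + 1 / ε)) := by
  have hl2 := Real.log_two_gt_d9
  have hpos : 0 < 1 + 1 / ε := by positivity
  have h1 := Real.log_le_log (by positivity) hl
  rw [Real.log_pow, Real.log_mul two_ne_zero hpos.ne'] at h1
  have h2 := le_max_left 1 (Real.log (1 + 1 / ε))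
  have h3 := le_max_right 1 (Real.log (1 + 1 / ε))
  have h4 : ((l : ℝ) - 1) * Real.log 2 ≤ max 1 (Real.log (1 + 1 / ε)) := by linarith
  rcases Nat.eq_zero_or_pos l with rfl | hl0
  · simp only [Nat.cast_zero]; linarith
  · have hl0 : (1 : ℝ) ≤ l := by exact_mod_cast hl0
    have h5 : ((l : ℝ) - 1) * (2 / 3) ≤ ((l : ℝ) - 1) * Real.log 2 :=
      mul_le_mul_of_nonneg_left (by linarith) (by linarith)
    linarith

theorem one_le_two_pow_mul_div {ε : ℝ} (hε : 0 < ε) {l : ℕ} (hl : 1 + 1 / ε ≤ 2 ^ l) :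
    1 ≤ 2 ^ l * (ε / (1 + ε)) := by
  refine le_trans (le_of_eq ?_) (mul_le_mul_of_nonneg_right hl (by positivity))
  field_simp
  ring

end Parameters

/-! ### Halting and output of the protocol. -/

section Protocol

variable {Y : Type*} {d lam : ℕ} {D : PMF (Cube d)}

theorem haltsIn_of_runs {P : Protocol Y} {eps beta : ℝ} {f : Cube d → Y} {h : Bool → Cube d → Y}
    {b : Bool} {adv : Adversary} {coin : ℕ → Bool} {Q : State Y → Prop}
    (hr : Runs (P.env eps beta D f h b adv coin) P.verifier (State.init Y d) Q) :
    ∃ s, P.HaltsIn eps beta D f h b adv coin s ∧ totalBits s.transcript ≤ s.time ∧ Q s := by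
  obtain ⟨s, hs, hQ⟩ := hr
  refine ⟨s, hs, ?_, hQ⟩
  simpa [State.init, totalBits] using hs.totalBits_le

/-- For trivial confidence the verifier outputs a coin. -/
theorem protocol_halts_of_one_le {eps beta : ℝ} (hβ : 1 ≤ beta * 2) (f : Cube d → Y)
    (h : Bool → Cube d → Y) (b : Bool) (adv : Adversary) (coin : ℕ → Bool) :
    ∃ s, (protocol Y lam).HaltsIn eps beta D f h b adv coin s ∧
      totalBits s.transcript ≤ s.time ∧ s.output = decide (tossOf coin 0 1 ≠ 0) ∧
      s.truthQueries = 0 ∧ s.time ≤ 100 :=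
  haltsIn_of_runs (verifier_runs_of_one_le (E := (protocol Y lam).env eps beta D f h b adv coin)
    lam hβ)

/-- For nontrivial confidence the verifier outputs the majority vote of its samples. -/
theorem protocol_halts (hD : D ∈ preciseDistributions d lam) {eps beta : ℝ}
    (hβ : beta * 2 < 1) {l j : ℕ} (hl1 : 1 ≤ l)
    (hl : ∀ i, 1 ≤ i → i ≤ l → ((1 : ℝ) ≤ eps * ((2 ^ i - 1 : ℕ) : ℝ) ↔ i = l))
    (hj : ∀ i, i ≤ j → ((1 : ℝ) ≤ beta * ((2 ^ 2 ^ i : ℕ) : ℝ) ↔ i = j)) (f : Cube d → Y)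
    (h : Bool → Cube d → Y) (b : Bool) (adv : Adversary) (coin : ℕ → Bool) :
    ∃ s, (protocol Y lam).HaltsIn eps beta D f h b adv coin s ∧
      totalBits s.transcript ≤ s.time ∧
      s.output = decide (2 ^ (2 * l + j + 5) ≤ ∑ i ∈ Finset.range (2 ^ (2 * l + j + 5)),
        sampleVote (d + l + lam + 4) (prefixWeight D h (d + l + lam + 4)) f h
          (tossOf coin (i * (d + l + lam + 4)) (d + l + lam + 4))) ∧
      s.truthQueries = 2 ^ (2 * l + j + 5) ∧
      s.time ≤ 20000 * (2 * (d + l + lam + 4) + 3) * (d + 1) * 2 ^ (2 * l + j + 5) := by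
  obtain ⟨s, h1, h2, h3, h4, h5⟩ := haltsIn_of_runs (verifier_runs
    (protocol_reports hD eps beta f h b adv coin (n := d + l + lam + 4) (by omega))
    (lam := lam) (l := l) (j := j) (not_le.2 hβ) rfl hl1 hl hj)
  refine ⟨s, h1, h2, h3.trans ?_, h4, h5⟩
  -- The initial value `2 ^ e` of the tally cancels one half of the threshold `2 * 2 ^ e`.
  rw [decide_eq_decide, tally, two_mul, Nat.add_le_add_iff_left]
  rfl

end Protocol

/-! ### Correctness and cost. -/

section Guarantees

variable {Y : Type*} {d lam : ℕ} {ε β : ℝ}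

theorem protocol_isRefereedLearning (hε : 0 < ε) (hβ : 0 < β) :
    (protocol Y lam).IsRefereedLearning d ε β Set.univ (preciseDistributions d lam) zeroOne
      (1 + ε) β := by
  intro D hD f h _ b adv
  by_cases hβ' : 1 ≤ β * 2
  · obtain ⟨s₀, hs₀⟩ : ∃ s₀, loss zeroOne D (h s₀) f =
        min (loss zeroOne D (h false) f) (loss zeroOne D (h true) f) := by
      rcases min_choice (loss zeroOne D (h false) f) (loss zeroOne D (h true) f) with hm | hm
      · exact ⟨false, hm.symm⟩
      · exact ⟨true, hm.symm⟩
    have hv : (if s₀ then 1 else 0) < 2 ^ 1 := by split_ifs <;> omega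
    -- One fair coin names a best hypothesis with probability `1 / 2 ≥ 1 - β`.
    have hhalf : 1 - β ≤ coinMeasure.real {coin | tossOf coin 0 1 = if s₀ then 1 else 0} := by
      rw [coinMeasure_tossOf_eq 0 1 hv]
      linarith
    refine hhalf.trans (measureReal_mono fun coin hcoin => ?_)
    obtain ⟨s, h1, -, h3, -, -⟩ := protocol_halts_of_one_le (D := D) (eps := ε) (lam := lam)
      hβ' f h b adv coin
    have hs : s.output = s₀ := by
      rw [h3, show tossOf coin 0 1 = _ from hcoin]
      cases s₀ <;> rfl
    refine ⟨s, h1, ?_⟩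
    rw [hs, ← hs₀]
    have := mul_nonneg hε.le (loss_nonneg D (h s₀) f)
    linarith
  · obtain ⟨l, hl1, hl, hle, -⟩ := exists_scale hε
    obtain ⟨j, hj, hexp, -⟩ := exists_confidence hβ
    have hgap := one_le_two_pow_mul_div hε hle
    -- The summand `4` in the precision provides the factor `8` and the `2` in the denominator of
    -- the bias; the summand `l` makes up for `ε / (1 + ε)`.
    have hn : 8 * 2 ^ (d + lam) ≤ 2 ^ (d + l + lam + 4) * (ε / (2 * (1 + ε))) := by
      have he : (2 : ℝ) ^ (d + l + lam + 4) * (ε / (2 * (1 + ε))) =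
          8 * 2 ^ (d + lam) * (2 ^ l * (ε / (1 + ε))) := by
        rw [show d + l + lam + 4 = d + lam + l + 4 by omega, pow_add, pow_add _ _ l]
        field_simp
        norm_num
      rw [he]
      exact le_mul_of_one_le_right (by positivity) hgap
    have hbad := coinMeasure_bad_le (f := f) (h := h) hD hε hn (by omega) (2 ^ (2 * l + j + 5))
    -- The Hoeffding exponent carries the denominator `32 * ((1 + ε) / ε) ^ 2`. The summand `5` of
    -- the sample exponent cancels `32`, the summand `2 * l` covers the square, and `2 ^ j` is left.
    have hm : (2 : ℝ) ^ j ≤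
        ((2 ^ (2 * l + j + 5) : ℕ) : ℝ) * (ε / (2 * (1 + ε)) / 2) ^ 2 / 2 := by
      have he : ((2 ^ (2 * l + j + 5) : ℕ) : ℝ) * (ε / (2 * (1 + ε)) / 2) ^ 2 / 2 =
          2 ^ j * (2 ^ l * (ε / (1 + ε))) ^ 2 := by
        push_cast
        rw [pow_add, pow_add, pow_mul']
        field_simp
      rw [he]
      exact le_mul_of_one_le_right (by positivity) (one_le_pow₀ hgap)
    have hbad := (hbad.trans (Real.exp_le_exp.2 (neg_le_neg hm))).trans hexp
    set S := {coin | ∃ s, (protocol Y lam).HaltsIn ε β D f h b adv coin s ∧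
      loss zeroOne D (h s.output) f ≤
        (1 + ε) * min (loss zeroOne D (h false) f) (loss zeroOne D (h true) f)} with hS
    set B := {coin | ¬ loss zeroOne D (h (decide (2 ^ (2 * l + j + 5) ≤
      ∑ i ∈ Finset.range (2 ^ (2 * l + j + 5)), sampleVote (d + l + lam + 4)
        (prefixWeight D h (d + l + lam + 4)) f h
          (tossOf coin (i * (d + l + lam + 4)) (d + l + lam + 4))))) f ≤
        (1 + ε) * min (loss zeroOne D (h false) f) (loss zeroOne D (h true) f)} with hB
    -- Only subadditivity is applied to this cover, so `S` need not be shown to be measurable.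
    have hcover : S ∪ B = Set.univ := by
      refine Set.eq_univ_of_forall fun coin => ?_
      by_cases hc : coin ∈ B
      · exact Or.inr hc
      · obtain ⟨s, h1, -, h3, -, -⟩ := protocol_halts hD (not_le.1 hβ') hl1 hl hj f h b adv coin
        refine Or.inl ⟨s, h1, ?_⟩
        rw [h3]
        exact not_not.1 hc
    have hone := measureReal_union_le (μ := coinMeasure) S B
    rw [hcover, probReal_univ] at hone
    linarith

theorem protocol_cost {D : PMF (Cube d)} (hD : D ∈ preciseDistributions d lam) (hlam : 1 ≤ lam)
    (hε : 0 < ε) (hβ : 0 < β) (f : Cube d → Y) (h : Bool → Cube d → Y) (b : Bool)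
    (adv : Adversary) (coin : ℕ → Bool) :
    ∃ s, (protocol Y lam).HaltsIn ε β D f h b adv coin s ∧ totalBits s.transcript ≤ s.time ∧
      (s.time : ℝ) ≤ lam * (1 + 1 / ε) ^ 2 * max 1 (Real.log (1 + 1 / ε)) *
        max 1 (Real.log (1 / β)) * (7680000 * (2 * d + 19) * (d + 1)) ∧
      (s.truthQueries : ℝ) ≤ 768 * (1 + 1 / ε ^ 2) * max 0 (Real.log (1 / β)) := by
  have hlam : (1 : ℝ) ≤ lam := by exact_mod_cast hlam
  have hε1 : 0 < 1 / ε := by positivity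
  have hM := le_max_left 1 (Real.log (1 + 1 / ε))
  have hL := le_max_left 1 (Real.log (1 / β))
  by_cases hβ' : 1 ≤ β * 2
  · obtain ⟨s, h1, h2, -, h4, h5⟩ := protocol_halts_of_one_le (D := D) (eps := ε) (lam := lam)
      hβ' f h b adv coin
    refine ⟨s, h1, h2, ?_, ?_⟩
    · have h5 : (s.time : ℝ) ≤ 100 := by exact_mod_cast h5
      refine h5.trans ?_
      have hsq : 1 ≤ (1 + 1 / ε) ^ 2 := one_le_pow₀ (by linarith)
      have h6 := one_le_mul_of_one_le_of_one_le (one_le_mul_of_one_le_of_one_le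
        (one_le_mul_of_one_le_of_one_le hlam hsq) hM) hL
      have hd : (0 : ℝ) ≤ d := Nat.cast_nonneg d
      have h7 : (100 : ℝ) ≤ 7680000 * (2 * d + 19) * (d + 1) := by nlinarith
      exact h7.trans (le_mul_of_one_le_left (by linarith) h6)
    · rw [h4, Nat.cast_zero]
      exact mul_nonneg (by positivity) (le_max_left _ _)
  · obtain ⟨l, hl1, hl, -, hle⟩ := exists_scale hε
    obtain ⟨j, hj, -, hj3⟩ := exists_confidence hβ
    have hj3 := hj3 (not_le.1 hβ')
    obtain ⟨s, h1, h2, -, h4, h5⟩ := protocol_halts hD (not_le.1 hβ') hl1 hl hj f h b adv coin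
    have hlM := le_mul_log_of_two_pow_le hε hle
    -- Here `384 = 2 ^ 2 * 3 * 2 ^ 5`, from `2 ^ l ≤ 2 * (1 + 1 / ε)`, `2 ^ j ≤ 3 * log (1 / β)` and
    -- the summand `5`.
    have hm : (2 : ℝ) ^ (2 * l + j + 5) ≤ 384 * (1 + 1 / ε) ^ 2 * Real.log (1 / β) := by
      have h6 : ((2 : ℝ) ^ l) ^ 2 ≤ (2 * (1 + 1 / ε)) ^ 2 := pow_le_pow_left₀ (by positivity) hle 2
      have h7 := mul_le_mul h6 hj3 (by positivity) (by positivity)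
      calc (2 : ℝ) ^ (2 * l + j + 5) = ((2 : ℝ) ^ l) ^ 2 * 2 ^ j * 32 := by
            rw [pow_add, pow_add, pow_mul']; norm_num
        _ ≤ (2 * (1 + 1 / ε)) ^ 2 * (3 * Real.log (1 / β)) * 32 := by linarith
        _ = _ := by ring
    refine ⟨s, h1, h2, ?_, ?_⟩
    · have h5 : (s.time : ℝ) ≤
          20000 * (2 * (d + l + lam + 4) + 3) * (d + 1) * 2 ^ (2 * l + j + 5) := by
        exact_mod_cast h5
      refine h5.trans ?_
      set M := max 1 (Real.log (1 + 1 / ε))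
      -- With `l ≤ 3 * M`, the constant is `19 = 6 + 2 + 11`, collecting `2 * l`, `2 * lam` and the
      -- additive `11`.
      have hsize : (2 * (d + l + lam + 4) + 3 : ℝ) ≤ (2 * d + 19) * (lam * M) := by
        have h6 : (1 : ℝ) ≤ lam * M := one_le_mul_of_one_le_of_one_le hlam hM
        have h7 : (lam : ℝ) ≤ lam * M := le_mul_of_one_le_right (by linarith) hM
        have h8 : M ≤ lam * M := le_mul_of_one_le_left (by linarith) hlam
        have h9 : (d : ℝ) ≤ d * (lam * M) := le_mul_of_one_le_right (Nat.cast_nonneg d) h6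
        linarith
      have hm' : (2 : ℝ) ^ (2 * l + j + 5) ≤
          384 * (1 + 1 / ε) ^ 2 * max 1 (Real.log (1 / β)) :=
        hm.trans (mul_le_mul_of_nonneg_left (le_max_right _ _) (by positivity))
      calc (20000 * (2 * (d + l + lam + 4) + 3) * (d + 1) * 2 ^ (2 * l + j + 5) : ℝ)
          ≤ 20000 * ((2 * d + 19) * (lam * M)) * (d + 1) *
              (384 * (1 + 1 / ε) ^ 2 * max 1 (Real.log (1 / β))) := by gcongr
        _ = _ := by ring
    · rw [h4]
      push_cast
      have hsq : (1 + 1 / ε) ^ 2 ≤ 2 * (1 + 1 / ε ^ 2) := by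
        have := sq_nonneg (1 - 1 / ε)
        rw [← one_div_pow]
        linarith
      calc (2 : ℝ) ^ (2 * l + j + 5) ≤ 384 * (1 + 1 / ε) ^ 2 * Real.log (1 / β) := hm
        _ ≤ 384 * (1 + 1 / ε) ^ 2 * max 0 (Real.log (1 / β)) :=
            mul_le_mul_of_nonneg_left (le_max_right _ _) (by positivity)
        _ ≤ 384 * (2 * (1 + 1 / ε ^ 2)) * max 0 (Real.log (1 / β)) :=
            mul_le_mul_of_nonneg_right (by linarith) (le_max_left _ _)
        _ = _ := by ring

end Guarantees
end RefereedLearning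

/-- Refereed learning protocol for the zero-one loss over precise distributions. -/
theorem theorem4p2 :
    ∃ (C : ℝ) (poly : Polynomial ℕ), ∀ (Y : Type*) (lam : ℕ), 1 ≤ lam →
      ∃ P : RefereedLearning.Protocol Y, ∀ (d : ℕ) (ε β : ℝ), 0 < ε → 0 < β →
        P.IsRefereedLearning d ε β Set.univ (RefereedLearning.preciseDistributions d lam)
          RefereedLearning.zeroOne (1 + ε) β ∧
        ∀ D ∈ RefereedLearning.preciseDistributions d lam,
          ∀ (f : RefereedLearning.Cube d → Y) (h : Bool → RefereedLearning.Cube d → Y)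
            (b : Bool) (adv : RefereedLearning.Adversary) (coin : ℕ → Bool),
            ∃ s, P.HaltsIn ε β D f h b adv coin s ∧
              (RefereedLearning.totalBits s.transcript : ℝ) ≤
                lam * (1 + 1 / ε) ^ 2 * max 1 (Real.log (1 + 1 / ε)) *
                  max 1 (Real.log (1 / β)) * (poly.eval d : ℕ) ∧
              (s.time : ℝ) ≤
                lam * (1 + 1 / ε) ^ 2 * max 1 (Real.log (1 + 1 / ε)) *
                  max 1 (Real.log (1 / β)) * (poly.eval d : ℕ) ∧
              (s.truthQueries : ℝ) ≤ C * (1 + 1 / ε ^ 2) * max 0 (Real.log (1 / β)) := by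
  refine ⟨768, Polynomial.C 7680000 * (Polynomial.C 2 * Polynomial.X + Polynomial.C 19) *
    (Polynomial.X + 1), fun Y lam hlam => ⟨RefereedLearning.protocol Y lam, fun d ε β hε hβ =>
      ⟨RefereedLearning.protocol_isRefereedLearning hε hβ, fun D hD f h b adv coin => ?_⟩⟩⟩
  obtain ⟨s, h1, h2, h3, h4⟩ :=
    RefereedLearning.protocol_cost hD hlam hε hβ f h b adv coin
  have hpoly : (((Polynomial.C 7680000 * (Polynomial.C 2 * Polynomial.X + Polynomial.C 19) *
      (Polynomial.X + 1) : Polynomial ℕ).eval d : ℕ) : ℝ) =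
      7680000 * (2 * d + 19) * (d + 1) := by
    simp only [Polynomial.eval_mul, Polynomial.eval_add, Polynomial.eval_C, Polynomial.eval_X,
      Polynomial.eval_one]
    push_cast
    ring
  rw [hpoly]
  exact ⟨s, h1, (Nat.cast_le.2 h2).trans h3, h3, h4⟩
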